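/- **Notation.** Let $\mathcal H$ be a separable complex Hilbert space and $\mathcal L(\mathcal H)$ the bounded operators on it. A kernel $K:X\times X\to\mathcal L(\mathcal H)$ is *positive definite* if $\sum_{i,j}\langle K(x_i,x_j)v_j,v_i\rangle\ge 0$ for all finitely many distinct points $x_i\in X$ and all vectors $v_i\in\mathcal H$, and *strictly positive definite* if moreover the sum vanishes only when all $v_i=0$ (for $\mathcal H=\mathbb C$ this defines positive definite scalar kernels). Its reproducing kernel Hilbert space $\mathcal H_K$ is the Hilbert space of functions $X\to\mathcal H$ obtained by completing the span of the functions $K_xv:=K(\cdot,x)v$ with respect to the inner product determined by $\langle K_xv,K_yu\rangle=\langle v,K(x,y)u\rangle$. $C_0$ denotes continuous functions vanishing at infinity, and $C_0^q(\mathbb R^m,\mathcal H)$ is the set of $f\in C^q(\mathbb R^m,\mathcal H)$ with $\partial^\alpha f\in C_0(\mathbb R^m,\mathcal H)$ for all $|\alpha|\le q$. A positive definite kernel $K$ on $\mathbb R^m$ is *$C^q$-universal* if $\mathcal H_K\subset C^q(\mathbb R^m,\mathcal H)$ and for every compact $\mathcal A\subset\mathbb R^m$, every $g\in C^q(\mathbb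 R^m,\mathcal H)$ and every $\varepsilon>0$ there is $f\in\mathcal H_K$ with $\sum_{|\alpha|\le q}\|\partial^\alpha f(x)-\partial^\alpha g(x)\|<\varepsilon$ for all $x\in\mathcal A$. It is *$C_0^q$-universal* if $\mathcal H_K\subset C^q(\mathbb R^m,\mathcal H)\cap C_0(\mathbb R^m,\mathcal H)$ and for every $g\in C_0^q(\mathbb R^m,\mathcal H)$ and every $\varepsilon>0$ there is $f\in\mathcal H_K$ with $\sum_{|\alpha|\le q}\|\partial^\alpha f(x)-\partial^\alpha g(x)\|<\varepsilon$ for all $x\in\mathbb R^m$. **Theorem.** Let $q\ge 0$ be an integer and let $F:[0,\infty)\to\mathcal L(\mathcal H)$ be ultraweakly continuous, such that $F(0)$ is trace class, the function $t\mapsto \operatorname{Tr}F(|t|)$ is of class $C^{2q}$ on $\mathbb R$, and for every $m\ge 1$ and every $v\in\mathcal H$ the scalar kernel $(x,y)\mapsto\langle F(\|x-y\|)v,v\rangle$ on $\mathbb R^m$ is positive definite. Then, for every $m\ge1$, the kernel $K_F(x,y):=F(\|x-y\|)$ on $\mathbb R^m$ is positive definite, $\mathcal H_{K_F}\subset C^q(\mathbb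 R^m,\mathcal H)$, and the following are equivalent: 1. $K_F$ is strictly positive definite; 2. $K_F$ is $C^q$-universal; 3. for every $v\in\mathcal H\setminus\{0\}$ the function $t\in[0,\infty)\mapsto\langle F(t)v,v\rangle$ is nonconstant. Moreover, $\mathcal H_{K_F}\subset C_0(\mathbb R^m,\mathcal H)$ if and only if for every $v\in\mathcal H\setminus\{0\}$ the function $t\mapsto\langle F(t)v,v\rangle$ belongs to $C_0([0,\infty))$. Under this additional hypothesis one has $\mathcal H_{K_F}\subset C_0^q(\mathbb R^m,\mathcal H)$, and the following are equivalent: 1. $K_F$ is strictly positive definite; 2. $K_F$ is $C_0^q$-universal; 3. for every $v\in\mathcal H\setminus\{0\}$ the function $t\mapsto\langle F(t)v,v\rangle$ is not identically zero. -/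

import Mathlib

open scoped NNReal ComplexOrder Topology
open Filter

namespace OpKernel

section Operators

variable {H : Type*} [NormedAddCommGroup H] [InnerProductSpace ℂ H]

/-- Ultraweak (σ-weak) continuity of an operator valued function: continuity of
`t ↦ ∑ₙ ⟨F(t) xₙ, yₙ⟩` for all square summable sequences `x`, `y` of vectors. -/
def UltraweaklyContinuous {T : Type*} [TopologicalSpace T] (F : T → H →L[ℂ] H) : Prop :=
  ∀ x y : ℕ → H, (Summable fun n => ‖x n‖ ^ 2) → (Summable fun n => ‖y n‖ ^ 2) →
    Continuous fun t => ∑' n, inner ℂ (y n) (F t (x n))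

variable [CompleteSpace H]

variable (H) in
/-- The index set of a fixed orthonormal basis of `H`. -/
def basisSet : Set H := (exists_hilbertBasis ℂ H).choose

variable (H) in
/-- A fixed orthonormal (Hilbert) basis of `H`, used to define the trace. -/
noncomputable def basis : HilbertBasis (basisSet H) ℂ H :=
  (exists_hilbertBasis ℂ H).choose_spec.choose

/-- `T` is trace class: `∑ᵢ ⟨|T| eᵢ, eᵢ⟩ < ∞`, where `|T| = (T* T)^{1/2}`. The terms are
nonnegative, and whether the sum is finite does not depend on the orthonormal basis. -/
def IsTraceClass (T : H →L[ℂ] H) : Prop :=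
  Summable fun i => inner ℂ (basis H i) (CFC.abs T (basis H i))

/-- The trace `∑ᵢ ⟨T eᵢ, eᵢ⟩`; for a trace class `T` the series converges absolutely and its sum
does not depend on the orthonormal basis. -/
noncomputable def trace (T : H →L[ℂ] H) : ℂ :=
  ∑' i, inner ℂ (basis H i) (T (basis H i))

end Operators

section Kernels

variable {X : Type*} {H : Type*} [NormedAddCommGroup H] [InnerProductSpace ℂ H]

/-- Positive definiteness of a complex valued kernel. -/
def IsPosDefScalarKernel (k : X → X → ℂ) : Prop :=
  ∀ (n : ℕ) (x : Fin n → X), Function.Injective x → ∀ c : Fin n → ℂ,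
    0 ≤ ∑ i, ∑ j, star (c i) * k (x i) (x j) * c j

/-- Positive definiteness of an operator valued kernel: for distinct points `xᵢ` and vectors `vᵢ`,
`∑ᵢⱼ ⟨K(xᵢ, xⱼ) vⱼ, vᵢ⟩` is a nonnegative real number (Mathlib's inner product is linear in its
second argument). -/
def IsPosDefKernel (K : X → X → H →L[ℂ] H) : Prop :=
  ∀ (n : ℕ) (x : Fin n → X), Function.Injective x → ∀ v : Fin n → H,
    0 ≤ ∑ i, ∑ j, inner ℂ (v i) (K (x i) (x j) (v j))

/-- Strict positive definiteness: the double sum vanishes only if all the vectors do. -/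
def IsStrictlyPosDefKernel (K : X → X → H →L[ℂ] H) : Prop :=
  IsPosDefKernel K ∧
    ∀ (n : ℕ) (x : Fin n → X), Function.Injective x → ∀ v : Fin n → H,
      ∑ i, ∑ j, inner ℂ (v i) (K (x i) (x j) (v j)) = 0 → ∀ i, v i = 0

theorem IsPosDefKernel.nonneg_finset {K : X → X → H →L[ℂ] H} (hK : IsPosDefKernel K)
    (s : Finset X) (v : X → H) :
    0 ≤ ∑ x ∈ s, ∑ y ∈ s, inner ℂ (v x) (K x y (v y)) := by
  classical
  have e := s.equivFin
  have h := hK s.card (fun i => (e.symm i : X))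
    (fun i j hij => e.symm.injective (Subtype.ext hij)) (fun i => v (e.symm i))
  have key : ∀ f : X → ℂ, ∑ i, f (e.symm i) = ∑ x ∈ s, f x := fun f => by
    rw [← Finset.sum_coe_sort s f]
    exact Equiv.sum_comp e.symm (fun x : s => f x)
  rw [key fun x => ∑ j, inner ℂ (v x) (K x (e.symm j) (v (e.symm j)))] at h
  have h2 : ∀ x, ∑ j, inner ℂ (v x) (K x (e.symm j) (v (e.symm j))) =
      ∑ y ∈ s, inner ℂ (v x) (K x y (v y)) := fun x => key fun y => inner ℂ (v x) (K x y (v y))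
  simpa only [h2] using h

theorem IsPosDefKernel.inner_diag {K : X → X → H →L[ℂ] H} (hK : IsPosDefKernel K)
    (x : X) (v : H) : (inner ℂ v (K x x v)).im = 0 := by
  have h := hK.nonneg_finset {x} (fun _ => v)
  simp only [Finset.sum_singleton] at h
  exact (Complex.le_def.1 h).2.symm

theorem IsPosDefKernel.inner_symm {K : X → X → H →L[ℂ] H} (hK : IsPosDefKernel K)
    (x y : X) (u v : H) : inner ℂ (K x y u) v = inner ℂ u (K y x v) := by
  classical
  rcases eq_or_ne x y with rfl | hxy
  · have hd : ∀ w : H, inner ℂ (K x x w) w = inner ℂ w (K x x w) := fun w => by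
      rw [← inner_conj_symm, Complex.conj_eq_iff_im.2 (hK.inner_diag x w)]
    have h1 := hd (u + v)
    have h2 := hd (u + Complex.I • v)
    simp only [map_add, map_smul, inner_add_left, inner_add_right, inner_smul_left,
      inner_smul_right, Complex.conj_I, hd u, hd v] at h1 h2
    linear_combination (1 / 2) * h1 - (Complex.I / 2) * h2 + (1 / 2) *
      (inner ℂ (K x x u) v - inner ℂ u (K x x v)
        - inner ℂ (K x x v) u + inner ℂ v (K x x u)) * Complex.I_sq
  · have hs : ∀ a b : H, (inner ℂ a (K x y b) + inner ℂ b (K y x a)).im = 0 := fun a b => by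
      have h := hK.nonneg_finset {x, y} (fun z => if z = x then a else b)
      rw [Finset.sum_pair hxy, Finset.sum_pair hxy, Finset.sum_pair hxy] at h
      simp only [if_true, if_neg hxy.symm] at h
      have h' := (Complex.le_def.1 h).2
      have ha := hK.inner_diag x a
      have hb := hK.inner_diag y b
      simp only [Complex.add_im, Complex.zero_im, ha, hb] at h' ⊢
      linarith
    have h1 := hs v u
    have h2 := hs (Complex.I • v) u
    simp only [map_smul, inner_smul_left, inner_smul_right, Complex.conj_I, Complex.add_im,
      Complex.mul_im, Complex.neg_re, Complex.neg_im, Complex.I_re, Complex.I_im] at h1 h2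
    rw [← inner_conj_symm]
    apply Complex.ext
    · rw [Complex.conj_re]; linarith
    · rw [Complex.conj_im]; linarith

variable [CompleteSpace H]

/-- Positive definite kernels are positive semidefinite matrices in the sense of Mathlib. -/
theorem IsPosDefKernel.posSemidef {K : X → X → H →L[ℂ] H} (hK : IsPosDefKernel K) :
    (Matrix.of K).PosSemidef := by
  have tfae := RKHS.posSemidef_tfae (𝕜 := ℂ) (K := (Matrix.of K : Matrix X X (H →L[ℂ] H)))
  have hiff := tfae.out 0 2
  refine hiff.2 (And.intro ?_ fun w => ?_)
  · ext x y u
    refine ext_inner_right ℂ fun v => ?_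
    rw [Matrix.conjTranspose_apply, ContinuousLinearMap.star_eq_adjoint,
      ContinuousLinearMap.adjoint_inner_left]
    exact (hK.inner_symm x y u v).symm
  · have h := hK.nonneg_finset w.support w
    have h' := (Complex.le_def.1 h).1
    simp only [Finsupp.sum, Matrix.of_apply]
    have e : ∀ a b : X, inner ℂ (K b a (w a)) (w b) = inner ℂ (w a) (K a b (w b)) :=
      fun a b => hK.inner_symm b a (w a) (w b)
    simp only [e]
    exact h'

/-- The reproducing kernel Hilbert space `H_K` of a positive definite kernel, as a set of functions
`X → H`: the completion of the span of the functions `z ↦ K(z, x) v` for the inner product with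
`⟨K_x v, K_y u⟩ = ⟨v, K(x, y) u⟩`, realised as functions by `⟨v, f(x)⟩ = ⟨K_x v, f⟩`. -/
def rkhs {K : X → X → H →L[ℂ] H} (hK : IsPosDefKernel K) : Set (X → H) :=
  haveI : Fact (Matrix.of K).PosSemidef := ⟨hK.posSemidef⟩
  Set.range fun g : RKHS.OfKernel (Matrix.of K) => (g : X → H)

end Kernels

section FunctionSpaces

/-- Continuous functions vanishing at infinity. -/
def IsC0 {X E : Type*} [TopologicalSpace X] [TopologicalSpace E] [Zero E] (f : X → E) : Prop :=
  Continuous f ∧ Tendsto f (cocompact X) (𝓝 0)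

variable {m : ℕ} {E : Type*} [NormedAddCommGroup E] [NormedSpace ℝ E]

/-- The partial derivative `∂^{e_i} f`. -/
noncomputable def partialDeriv (i : Fin m) (f : EuclideanSpace ℝ (Fin m) → E) :
    EuclideanSpace ℝ (Fin m) → E :=
  fun x => lineDeriv ℝ f x (EuclideanSpace.single i 1)

/-- The iterated partial derivative `∂^α f` for a multi-index `α`. -/
noncomputable def multiDeriv (α : Fin m → ℕ) (f : EuclideanSpace ℝ (Fin m) → E) :
    EuclideanSpace ℝ (Fin m) → E :=
  (List.finRange m).foldr (fun i g => (partialDeriv i)^[α i] g) f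

/-- The multi-indices `α` with `|α| ≤ q`. -/
def multiIndices (m q : ℕ) : Finset (Fin m → ℕ) :=
  (Fintype.piFinset fun _ => Finset.range (q + 1)).filter fun α => ∑ i, α i ≤ q

variable (m E) in
/-- `C^q(ℝ^m, E)`. -/
noncomputable def Cq (q : ℕ) : Set (EuclideanSpace ℝ (Fin m) → E) := {f | ContDiff ℝ (q : ℕ) f}

variable (m E) in
/-- `C_0(ℝ^m, E)`. -/
def C0 : Set (EuclideanSpace ℝ (Fin m) → E) := {f | IsC0 f}

variable (m E) in
/-- `C_0^q(ℝ^m, E)`: all derivatives up to order `q` exist and belong to `C_0`. -/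
def C0q (q : ℕ) : Set (EuclideanSpace ℝ (Fin m) → E) :=
  {f | f ∈ Cq m E q ∧ ∀ α ∈ multiIndices m q, multiDeriv α f ∈ C0 m E}

end FunctionSpaces

section Universality

variable {m : ℕ} {H : Type*} [NormedAddCommGroup H] [InnerProductSpace ℂ H] [CompleteSpace H]

/-- `K` is `C^q`-universal: `H_K ⊂ C^q`, and on every compact set every `C^q` function can be
approximated by elements of `H_K`, together with all derivatives up to order `q`. -/
def IsCqUniversal {K : EuclideanSpace ℝ (Fin m) → EuclideanSpace ℝ (Fin m) → H →L[ℂ] H}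
    (hK : IsPosDefKernel K) (q : ℕ) : Prop :=
  rkhs hK ⊆ Cq m H q ∧
    ∀ A : Set (EuclideanSpace ℝ (Fin m)), IsCompact A → ∀ g ∈ Cq m H q, ∀ ε : ℝ, 0 < ε →
      ∃ f ∈ rkhs hK, ∀ x ∈ A,
        ∑ α ∈ multiIndices m q, ‖multiDeriv α f x - multiDeriv α g x‖ < ε

/-- `K` is `C_0^q`-universal: `H_K ⊂ C^q ∩ C_0`, and every `C_0^q` function can be approximated by
elements of `H_K` uniformly on `ℝ^m`, together with all derivatives up to order `q`. -/
def IsC0qUniversal {K : EuclideanSpace ℝ (Fin m) → EuclideanSpace ℝ (Fin m) → H →L[ℂ] H}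
    (hK : IsPosDefKernel K) (q : ℕ) : Prop :=
  rkhs hK ⊆ Cq m H q ∧ rkhs hK ⊆ C0 m H ∧
    ∀ g ∈ C0q m H q, ∀ ε : ℝ, 0 < ε →
      ∃ f ∈ rkhs hK, ∀ x,
        ∑ α ∈ multiIndices m q, ‖multiDeriv α f x - multiDeriv α g x‖ < ε

end Universality

/-- The radial kernel `K_F(x, y) = F(‖x - y‖)` on `ℝ^m`. -/
noncomputable def radialKernel {H : Type*} [NormedAddCommGroup H] [InnerProductSpace ℂ H] (m : ℕ)
    (F : ℝ≥0 → H →L[ℂ] H) :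
    EuclideanSpace ℝ (Fin m) → EuclideanSpace ℝ (Fin m) → H →L[ℂ] H :=
  fun x y => F ‖x - y‖₊

end OpKernel

/-!
Universality of radial operator valued kernels, by way of their Fourier representation.

**Fourier representation.** Positive definiteness of `F(‖x - y‖)` in *all* dimensions makes
`t ↦ F(√t)` completely monotone (`IsRadialPosDef.shift`, `IsRadialPosDef.sub_shift`): a simplex
of many new orthogonal directions shifts the squared distances, and pairs of opposite weights
produce differences. The Hausdorff moment problem, solved with Bernstein polynomials directly in the
C⋆-algebra of operators, turns this into a positive linear map `radialCalculus` on `C([0,1])`,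
formally `f ↦ ∫ f dμ` for an operator measure `μ` with `F(√t) = ∫ r ^ t dμ(r)`
(`IsRadialOperator.calculus_rpowMap`). With `r = exp (-s)`, each `r ^ ‖x‖²` is the Fourier transform
of a Gaussian density which, at a frequency `w ≠ 0`, is a continuous function of `r ∈ [0,1]`.
Applying the calculus to it gives an operator density `h(w) ≥ 0`, norm continuous in `w ≠ 0`, with
`F(‖x‖) = C + 𝓕 h (x)` and a constant `C ≥ 0` coming from the mass of `μ` at `r = 1`
(`IsRadialOperator.eq_constPart_add`).

**Moments.** The norm of `h(w)` is at most its trace, and the trace of `F` is the scalar function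
`∫ r ^ t² dν(r)`. That this function is `C^{2q}` forces `∫ (-log r)^q dν < ∞`, by Fatou's lemma
applied to `q`-th differences, hence `∫ ‖w‖^{2q} ‖h(w)‖ dw < ∞`
(`IsRadialOperator.integrable_pow_mul_fourierDensity`).

**The reproducing kernel Hilbert space.** The norm of `∑ K(·, x) p(x)` is
`⟨∑ p, C ∑ p⟩ + ∫ ⟨p̂, h p̂⟩`, with `p̂` a trigonometric polynomial
(`IsFourierKernel.norm_kerSum_sq`). By the Cauchy-Schwarz inequality every element of the space is
a constant plus `𝓕 ζ` with `∫ ‖w‖^q ‖ζ‖ < ∞` (`IsFourierKernel.exists_eq_add_fourier`), so it is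
`C^q`; by the Riemann-Lebesgue lemma its derivatives vanish at infinity if `C = 0`, which is the
case exactly when `F` vanishes weakly at infinity. Conversely `𝓕 (h χ)` belongs to the space for
every bounded continuous `χ` (`IsFourierKernel.exists_coe_eq_fourier`).

**Equivalences.** If no `t ↦ ⟨F(t) v, v⟩` with `v ≠ 0` is constant, then `h(w)` is injective, so it
has dense range, for every `w ≠ 0`. By a partition of unity the functions `h χ` are then dense in
weighted `L¹` (`exists_integral_mul_norm_sub_lt`). A function whose derivatives vanish at infinity
is approximated by a compactly supported one, then by a smooth one, which is a Fourier transform,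
and finally by some `𝓕 (h χ)` (`exists_norm_iteratedFDeriv_fourier_sub_lt`). This is universality.
Universality gives approximate interpolation at finitely many points, hence strict positive
definiteness (`IsPosDefKernel.isStrictlyPosDefKernel`), and the weights `v, -v` at two points
exclude constants `⟨F(t) v, v⟩` for strictly positive definite kernels.
-/

namespace OpKernel

/-! ### Radial kernels in all dimensions -/

/-- `f` is a positive definite function of the squared distance in every Euclidean space. Points are
written as coordinate families and need not be distinct. -/
def IsRadialPosDef (f : ℝ → ℂ) : Prop :=
  ∀ (ι κ : Type) [Fintype ι] [Fintype κ] (x : ι → κ → ℝ) (c : ι → ℂ),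
    0 ≤ ∑ i, ∑ j, star (c i) * f (∑ k, (x i k - x j k) ^ 2) * c j

theorem nonneg_of_forall_nat_mul_add {z w : ℂ} (h : ∀ N : ℕ, 0 ≤ N * z + w) : 0 ≤ z := by
  have h0 := (Complex.le_def.1 (h 0)).2
  have h1 := (Complex.le_def.1 (h 1)).2
  refine Complex.le_def.2 ⟨?_, ?_⟩
  · by_contra! hz
    simp only [Complex.zero_re] at hz
    obtain ⟨N, hN⟩ := exists_nat_gt (w.re / (-z.re))
    have h2 := (Complex.le_def.1 (h N)).1
    simp at h2
    rw [div_lt_iff₀ (by linarith)] at hN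
    linarith
  · simp at h0 h1 ⊢
    rw [← h0] at h1
    simpa using h1

/-- Attaching to every point `N + 1` copies displaced in new mutually orthogonal directions turns
all but a fraction `1 / (N + 1)` of the squared distances `t` into `t + a`. -/
theorem IsRadialPosDef.shift {f : ℝ → ℂ} (hf : IsRadialPosDef f) {a : ℝ} (ha : 0 ≤ a) :
    IsRadialPosDef fun t => f (t + a) := by
  intro ι κ _ _ x c
  refine nonneg_of_forall_nat_mul_add
    (w := ∑ i, ∑ j, star (c i) * f (∑ k, (x i k - x j k) ^ 2) * c j) fun N => ?_
  have h := hf (ι × Fin (N + 1)) (κ ⊕ Fin (N + 1))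
    (fun p => Sum.elim (x p.1) fun l => if l = p.2 then √(a / 2) else 0) (fun p => c p.1)
  have hd : ∀ p q : ι × Fin (N + 1), ∑ k, (Sum.elim (x p.1)
      (fun l => if l = p.2 then √(a / 2) else 0) k - Sum.elim (x q.1)
      (fun l => if l = q.2 then √(a / 2) else 0) k) ^ 2 =
      (∑ k, (x p.1 k - x q.1 k) ^ 2) + if p.2 = q.2 then 0 else a := by
    intro p q
    rw [Fintype.sum_sum_type]
    simp only [Sum.elim_inl, Sum.elim_inr]
    congr 1
    by_cases hpq : p.2 = q.2
    · simp [hpq]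
    · have : ∀ l : Fin (N + 1), ((if l = p.2 then √(a / 2) else 0) -
          (if l = q.2 then √(a / 2) else 0)) ^ 2 =
          (if l = p.2 then a / 2 else 0) + (if l = q.2 then a / 2 else 0) := by
        intro l
        have hs : √(a / 2) ^ 2 = a / 2 := Real.sq_sqrt (by positivity)
        generalize √(a / 2) = b at hs
        by_cases h1 : l = p.2
        · simp [hpq, h1, hs]
        · by_cases h2 : l = q.2 <;> simp [h1, h2, hs, Ne.symm hpq]
      rw [Finset.sum_congr rfl fun l _ => this l, Finset.sum_add_distrib]
      simp [hpq]
  have hs : ∀ p q : ι × Fin (N + 1), star (c p.1) * f ((∑ k, (x p.1 k - x q.1 k) ^ 2) +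
      if p.2 = q.2 then 0 else a) * c q.1 =
      star (c p.1) * f ((∑ k, (x p.1 k - x q.1 k) ^ 2) + a) * c q.1 + if p.2 = q.2 then
      (star (c p.1) * f (∑ k, (x p.1 k - x q.1 k) ^ 2) * c q.1 -
        star (c p.1) * f ((∑ k, (x p.1 k - x q.1 k) ^ 2) + a) * c q.1) else 0 := by
    intro p q
    by_cases hpq : p.2 = q.2 <;> simp [hpq]
  simp only [hd, hs, Fintype.sum_prod_type] at h
  simp only [Finset.sum_add_distrib, Finset.sum_ite_eq, Finset.mem_univ, if_true,
    Finset.sum_const, Finset.card_univ, Fintype.card_fin, nsmul_eq_mul,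
    ← Finset.mul_sum, Finset.sum_sub_distrib] at h
  have hN : (0 : ℂ) < ((N + 1 : ℕ) : ℂ) := by exact_mod_cast Nat.succ_pos N
  refine le_of_mul_le_mul_left ?_ hN
  rw [mul_zero]
  convert h using 1
  push_cast
  ring

/-- Pairs of points with opposite weights, displaced in one new direction, realise the first
difference. -/
theorem IsRadialPosDef.sub_shift {f : ℝ → ℂ} (hf : IsRadialPosDef f) {a : ℝ} (ha : 0 ≤ a) :
    IsRadialPosDef fun t => f t - f (t + a) := by
  intro ι κ _ _ x c
  have h := hf (ι × Bool) (κ ⊕ Unit)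
    (fun p => Sum.elim (x p.1) fun _ => if p.2 then √a else 0)
    (fun p => if p.2 then c p.1 else -c p.1)
  have hs : √a ^ 2 = a := Real.sq_sqrt ha
  simp only [Fintype.sum_prod_type, Fintype.sum_sum_type, Fintype.sum_bool, Sum.elim_inl,
    Sum.elim_inr, Finset.univ_unique, Finset.sum_singleton, if_true, Bool.false_eq_true, if_false,
    sub_self, zero_sub, sub_zero, neg_sq, hs] at h
  refine le_of_mul_le_mul_left ?_ (zero_lt_two : (0 : ℂ) < 2)
  rw [mul_zero]
  convert h using 1
  rw [Finset.mul_sum]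
  refine Finset.sum_congr rfl fun i _ => ?_
  rw [Finset.mul_sum, ← Finset.sum_add_distrib]
  refine Finset.sum_congr rfl fun j _ => ?_
  simp
  ring

theorem IsRadialPosDef.nonneg {f : ℝ → ℂ} (hf : IsRadialPosDef f) {a : ℝ} (ha : 0 ≤ a) :
    0 ≤ f a := by
  simpa using hf.shift ha Unit Unit (fun _ _ => 0) (fun _ => 1)

/-- A positive definite kernel has nonnegative double sums also over families of points with
repetitions. -/
theorem IsPosDefScalarKernel.nonneg_family {X : Type*} {k : X → X → ℂ}
    (hk : IsPosDefScalarKernel k) {ι : Type*} [Fintype ι] (x : ι → X) (c : ι → ℂ) :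
    0 ≤ ∑ i, ∑ j, star (c i) * k (x i) (x j) * c j := by
  classical
  let s : Finset X := Finset.univ.image x
  let C : X → ℂ := fun p => ∑ i with x i = p, c i
  have h := hk s.card (fun i => (s.equivFin.symm i : X))
    (fun i j hij => s.equivFin.symm.injective (Subtype.ext hij)) (fun i => C (s.equivFin.symm i))
  have key : ∀ f : X → ℂ, ∑ i, f (s.equivFin.symm i) = ∑ p ∈ s, f p := fun f => by
    rw [← Finset.sum_coe_sort s f]
    exact Equiv.sum_comp s.equivFin.symm (fun p : s => f p)
  have h2 : ∀ p, ∑ j, star (C p) * k p (s.equivFin.symm j) * C (s.equivFin.symm j) =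
      ∑ r ∈ s, star (C p) * k p r * C r := fun p => key fun r => star (C p) * k p r * C r
  simp only [h2] at h
  rw [key fun p => ∑ r ∈ s, star (C p) * k p r * C r] at h
  convert h using 1
  have h3 : ∀ (g : X → ℂ), ∑ j, g (x j) * c j = ∑ p ∈ s, g p * C p := by
    intro g
    rw [← Finset.sum_fiberwise_of_maps_to (s := Finset.univ) (t := s) (g := x)
      (fun i _ => Finset.mem_image_of_mem x (Finset.mem_univ i))]
    refine Finset.sum_congr rfl fun p _ => ?_
    rw [Finset.mul_sum]
    exact Finset.sum_congr rfl fun j hj => by rw [(Finset.mem_filter.1 hj).2]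
  have h4 : ∀ (g : X → ℂ), ∑ j, star (c j) * g (x j) = ∑ p ∈ s, star (C p) * g p := by
    intro g
    rw [← Finset.sum_fiberwise_of_maps_to (s := Finset.univ) (t := s) (g := x)
      (fun i _ => Finset.mem_image_of_mem x (Finset.mem_univ i))]
    refine Finset.sum_congr rfl fun p _ => ?_
    rw [star_sum, Finset.sum_mul]
    exact Finset.sum_congr rfl fun j hj => by rw [(Finset.mem_filter.1 hj).2]
  simp only [mul_assoc, ← Finset.mul_sum, h3 (k _)]
  exact h4 fun p => ∑ r ∈ s, k p r * C r

section

variable {H : Type*} [NormedAddCommGroup H] [InnerProductSpace ℂ H]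

/-- The operator function in the variable `t = (distance)²`. -/
noncomputable def sqrtFun (F : ℝ≥0 → H →L[ℂ] H) (t : ℝ) : H →L[ℂ] H := F (NNReal.sqrt t.toNNReal)

theorem sqrtFun_sq_norm {E : Type*} [NormedAddCommGroup E] (F : ℝ≥0 → H →L[ℂ] H) (x : E) :
    sqrtFun F (‖x‖ ^ 2) = F ‖x‖₊ := by
  rw [sqrtFun]
  congr 1
  rw [Real.toNNReal_pow (norm_nonneg x), norm_toNNReal, NNReal.sqrt_sq]

theorem isRadialPosDef_of_forall (F : ℝ≥0 → H →L[ℂ] H) (v : H)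
    (hpd : ∀ m : ℕ, 1 ≤ m → IsPosDefScalarKernel
      (fun x y : EuclideanSpace ℝ (Fin m) => inner ℂ v (F ‖x - y‖₊ v))) :
    IsRadialPosDef fun t => inner ℂ v (sqrtFun F t v) := by
  intro ι κ _ _ x c
  -- The extra coordinate makes the dimension positive.
  let e := Fintype.equivFin (Option κ)
  let y : ι → EuclideanSpace ℝ (Fin (Fintype.card (Option κ))) :=
    fun i => WithLp.toLp 2 fun l => (e.symm l).elim 0 (x i)
  have h := (hpd _ (by simp)).nonneg_family y c
  convert h using 6 with i _ j _
  have : ∑ k, (x i k - x j k) ^ 2 = ‖y i - y j‖ ^ 2 := by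
    rw [EuclideanSpace.norm_sq_eq, ← e.sum_comp]
    simp [y, Fintype.sum_option]
  rw [this, sqrtFun_sq_norm]

end

/-! ### The Hausdorff moment problem in a C⋆-algebra -/

section Hausdorff

open Polynomial unitInterval

variable {A : Type*} [CStarAlgebra A]

/-- The linear map on polynomials with `X ^ k ↦ a k`. -/
noncomputable def momentMap (a : ℕ → A) : ℝ[X] →ₗ[ℝ] A :=
  Polynomial.lsum fun k => LinearMap.toSpanSingleton ℝ A (a k)

theorem momentMap_X_pow (a : ℕ → A) (k : ℕ) : momentMap a (X ^ k) = a k := by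
  rw [momentMap, Polynomial.lsum_apply, ← Polynomial.monomial_one_right_eq_X_pow,
    Polynomial.sum_monomial_index] <;> simp

/-- The exact expansion of `X ^ j` in Bernstein polynomials. -/
theorem choose_mul_X_pow_eq_sum (n j : ℕ) (h : j ≤ n) :
    (n.choose j : ℝ[X]) * X ^ j =
      ∑ k ∈ Finset.range (n + 1), (k.choose j : ℝ[X]) * bernsteinPolynomial ℝ n k := by
  obtain ⟨N, rfl⟩ := Nat.exists_eq_add_of_le h
  rw [add_assoc, Finset.sum_range_add]
  have h0 : ∑ k ∈ Finset.range j, (k.choose j : ℝ[X]) * bernsteinPolynomial ℝ (j + N) k = 0 :=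
    Finset.sum_eq_zero fun k hk => by
      rw [Nat.choose_eq_zero_of_lt (Finset.mem_range.1 hk)]; simp
  have h1 : ∀ i ∈ Finset.range (N + 1), ((j + i).choose j : ℝ[X]) *
      bernsteinPolynomial ℝ (j + N) (j + i) =
      ((j + N).choose j : ℝ[X]) * X ^ j * bernsteinPolynomial ℝ N i := by
    intro i hi
    have hc : ((j + N).choose (j + i) : ℝ[X]) * ((j + i).choose j : ℝ[X]) =
        ((j + N).choose j : ℝ[X]) * (N.choose i : ℝ[X]) := by
      have := Nat.choose_mul (n := j + N) (k := j + i) (s := j) (by omega)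
      rw [show j + N - j = N by omega, show j + i - j = i by omega] at this
      exact_mod_cast this
    rw [bernsteinPolynomial, bernsteinPolynomial, show j + N - (j + i) = N - i by omega, pow_add]
    linear_combination (X ^ j * X ^ i * (1 - X) ^ (N - i)) * hc
  rw [h0, zero_add, Finset.sum_congr rfl h1, ← Finset.mul_sum, bernsteinPolynomial.sum, mul_one]

/-- The exact Bernstein coefficients of `X ^ j` are close to its values at the nodes `k / n`. -/
theorem abs_choose_div_choose_sub_pow_le {n k : ℕ} (hk : k ≤ n) {j : ℕ} (hj : j ≤ n) :
    |(k.choose j : ℝ) / n.choose j - ((k : ℝ) / n) ^ j| ≤ (j : ℝ) ^ 2 / n := by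
  have hd : ∀ j ≤ n, (k.choose j : ℝ) / n.choose j =
      (k.descFactorial j : ℝ) / n.descFactorial j := by
    intro j _
    rw [Nat.descFactorial_eq_factorial_mul_choose, Nat.descFactorial_eq_factorial_mul_choose]
    push_cast
    rw [mul_div_mul_left _ _ (by positivity)]
  rw [hd j hj]
  induction j with
  | zero => simp
  | succ j ih =>
    have ih := ih (by omega)
    have hn : (0 : ℝ) < n := by exact_mod_cast (by omega : 0 < n)
    have hnj : (0 : ℝ) < n - j := by
      have : (j : ℝ) + 1 ≤ n := by exact_mod_cast hj
      linarith
    have hkn : (k : ℝ) ≤ n := by exact_mod_cast hk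
    have ht0 : (0 : ℝ) ≤ (k : ℝ) / n := by positivity
    have ht1 : (k : ℝ) / n ≤ 1 := div_le_one_of_le₀ hkn hn.le
    rw [Nat.descFactorial_succ, Nat.descFactorial_succ]
    push_cast [Nat.cast_sub (by omega : j ≤ n)]
    have hr : 0 ≤ ((k - j : ℕ) : ℝ) / (n - j) ∧ ((k - j : ℕ) : ℝ) / (n - j) ≤ 1 ∧
        |((k - j : ℕ) : ℝ) / (n - j) - k / n| ≤ j / n := by
      rcases le_total j k with h | h
      · rw [Nat.cast_sub h]
        have hjk : (j : ℝ) ≤ k := by exact_mod_cast h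
        refine ⟨by apply div_nonneg <;> linarith, by rw [div_le_one hnj]; linarith, ?_⟩
        have e : ((k : ℝ) - j) / (n - j) - k / n = - (j / n * ((n - k) / (n - j))) := by
          field_simp; ring
        rw [e, abs_neg, abs_of_nonneg (mul_nonneg (by positivity)
          (div_nonneg (by linarith) hnj.le))]
        refine mul_le_of_le_one_right (by positivity) ?_
        rw [div_le_one hnj]; linarith
      · rw [Nat.sub_eq_zero_of_le h]
        refine ⟨by simp, by simp, ?_⟩
        simp only [Nat.cast_zero, zero_div, zero_sub, abs_neg, abs_of_nonneg ht0]
        gcongr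
    obtain ⟨hr0, hr1, hr2⟩ := hr
    rw [mul_div_mul_comm, pow_succ']
    set r := ((k - j : ℕ) : ℝ) / (n - j)
    set u := (k.descFactorial j : ℝ) / n.descFactorial j
    set t := (k : ℝ) / n
    have e : r * u - t * t ^ j = r * (u - t ^ j) + (r - t) * t ^ j := by ring
    rw [e]
    have hp : 0 ≤ t ^ j ∧ t ^ j ≤ 1 := ⟨by positivity, pow_le_one₀ ht0 ht1⟩
    calc |r * (u - t ^ j) + (r - t) * t ^ j|
        ≤ |r * (u - t ^ j)| + |(r - t) * t ^ j| := abs_add_le _ _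
      _ = r * |u - t ^ j| + |r - t| * t ^ j := by
          rw [abs_mul, abs_mul, abs_of_nonneg hr0, abs_of_nonneg hp.1]
      _ ≤ 1 * ((j : ℝ) ^ 2 / n) + (j / n) * 1 := by gcongr; exact hp.2
      _ = ((j : ℝ) ^ 2 + j) / n := by ring
      _ ≤ ((j : ℝ) + 1) ^ 2 / n := by
          gcongr; nlinarith [Nat.cast_nonneg (α := ℝ) j]

theorem sum_momentMap_bernstein (a : ℕ → A) (n : ℕ) :
    ∑ k ∈ Finset.range (n + 1), momentMap a (bernsteinPolynomial ℝ n k) = a 0 := by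
  rw [← map_sum, bernsteinPolynomial.sum, ← pow_zero X, momentMap_X_pow]

variable [PartialOrder A] [StarOrderedRing A]

/-- Complete monotonicity of a sequence in a C⋆-algebra: all the differences
`∑ᵢ (-1)ⁱ (p choose i) a (k + i)` are nonnegative. -/
def IsCompletelyMonotone (a : ℕ → A) : Prop := ∀ p k, 0 ≤ momentMap a ((1 - X) ^ p * X ^ k)

theorem IsCompletelyMonotone.bernstein_nonneg {a : ℕ → A} (ha : IsCompletelyMonotone a)
    (n k : ℕ) : 0 ≤ momentMap a (bernsteinPolynomial ℝ n k) := by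
  have : bernsteinPolynomial ℝ n k = (n.choose k : ℝ) • ((1 - X) ^ (n - k) * X ^ k) := by
    rw [bernsteinPolynomial, Polynomial.smul_eq_C_mul]
    simp only [map_natCast]
    ring
  rw [this, map_smul]
  exact smul_nonneg (by positivity) (ha _ _)

/-- Real combinations of positive elements are controlled by the norm of their sum, since
`0 ≤ ∑ (w i + M) • b i ≤ 2 M • ∑ b i`. -/
theorem norm_sum_smul_le_of_nonneg {ι : Type*} (s : Finset ι) (w : ι → ℝ) (b : ι → A) {M : ℝ}
    (hM : 0 ≤ M) (hb : ∀ i ∈ s, 0 ≤ b i) (hw : ∀ i ∈ s, |w i| ≤ M) :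
    ‖∑ i ∈ s, w i • b i‖ ≤ 3 * M * ‖∑ i ∈ s, b i‖ := by
  have h1 : 0 ≤ ∑ i ∈ s, (w i + M) • b i := Finset.sum_nonneg fun i hi =>
    smul_nonneg (by have := abs_le.1 (hw i hi); linarith) (hb i hi)
  have h2 : ∑ i ∈ s, (w i + M) • b i ≤ (2 * M) • ∑ i ∈ s, b i := by
    rw [Finset.smul_sum]
    refine Finset.sum_le_sum fun i hi => ?_
    exact smul_le_smul_of_nonneg_right (by have := abs_le.1 (hw i hi); linarith) (hb i hi)
  have h3 := CStarAlgebra.norm_le_norm_of_nonneg_of_le h1 h2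
  have h4 : ∑ i ∈ s, w i • b i = ∑ i ∈ s, (w i + M) • b i - M • ∑ i ∈ s, b i := by
    simp [add_smul, Finset.sum_add_distrib, Finset.smul_sum]
  rw [h4]
  refine (norm_sub_le _ _).trans ?_
  rw [norm_smul, Real.norm_of_nonneg (by positivity)] at h3
  rw [norm_smul, Real.norm_of_nonneg hM]
  linarith

/-- The Bernstein sums of a polynomial converge to it already at the level of moments. -/
theorem IsCompletelyMonotone.tendsto_bernstein {a : ℕ → A} (ha : IsCompletelyMonotone a)
    (p : ℝ[X]) :
    Tendsto (fun n : ℕ => ∑ k ∈ Finset.range (n + 1),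
      p.eval ((k : ℝ) / n) • momentMap a (bernsteinPolynomial ℝ n k)) atTop
      (𝓝 (momentMap a p)) := by
  induction p using Polynomial.induction_on' with
  | add p q hp hq =>
    simpa [add_smul, Finset.sum_add_distrib] using hp.add hq
  | monomial j c =>
    have key : Tendsto (fun n : ℕ => ∑ k ∈ Finset.range (n + 1),
        ((k : ℝ) / n) ^ j • momentMap a (bernsteinPolynomial ℝ n k)) atTop (𝓝 (a j)) := by
      rw [tendsto_iff_norm_sub_tendsto_zero]
      have hlim : Tendsto (fun n : ℕ => 3 * ((j : ℝ) ^ 2 / n) * ‖a 0‖) atTop (𝓝 0) := by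
        simpa using ((tendsto_const_div_atTop_nhds_zero_nat ((j : ℝ) ^ 2)).const_mul 3).mul_const
          ‖a 0‖
      refine squeeze_zero' (Eventually.of_forall fun _ => norm_nonneg _) ?_ hlim
      filter_upwards [eventually_ge_atTop (max j 1)] with n hn
      have hj : j ≤ n := (le_max_left _ _).trans hn
      have hch : (n.choose j : ℝ) ≠ 0 := by
        exact_mod_cast (Nat.choose_pos hj).ne'
      have haj : a j = ∑ k ∈ Finset.range (n + 1), ((k.choose j : ℝ) / n.choose j) •
          momentMap a (bernsteinPolynomial ℝ n k) := by
        have h := congrArg (momentMap a) (choose_mul_X_pow_eq_sum n j hj)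
        have e : ∀ (c : ℕ) (p : ℝ[X]), (c : ℝ[X]) * p = (c : ℝ) • p := fun c p => by
          rw [Polynomial.smul_eq_C_mul]; simp
        simp only [e, map_sum, map_smul, momentMap_X_pow] at h
        simp only [div_eq_inv_mul, mul_smul, ← Finset.smul_sum, ← h]
        rw [smul_smul, inv_mul_cancel₀ hch, one_smul]
      nth_rewrite 1 [haj]
      rw [← Finset.sum_sub_distrib]
      simp only [← sub_smul]
      rw [← sum_momentMap_bernstein a n]
      refine norm_sum_smul_le_of_nonneg _ _ _ (by positivity)
        (fun k _ => ha.bernstein_nonneg n k) fun k hk => ?_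
      rw [abs_sub_comm]
      exact abs_choose_div_choose_sub_pow_le (by have := Finset.mem_range.1 hk; omega) hj
    have e : momentMap a (monomial j c) = c • a j := by
      rw [← momentMap_X_pow a j, ← map_smul, ← Polynomial.C_mul_X_pow_eq_monomial,
        Polynomial.smul_eq_C_mul]
    rw [e]
    simpa [Finset.smul_sum, smul_smul] using key.const_smul c

theorem div_natCast_mem_unitInterval {n k : ℕ} (hk : k ∈ Finset.range (n + 1)) :
    (k : ℝ) / n ∈ I :=
  ⟨by positivity, div_le_one_of_le₀ (by
    have := Finset.mem_range.1 hk
    exact_mod_cast (by omega : k ≤ n)) (by positivity)⟩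

/-- The moment map is bounded for the supremum norm on `[0,1]`, so it extends to `C([0,1])`. -/
theorem IsCompletelyMonotone.norm_momentMap_le {a : ℕ → A} (ha : IsCompletelyMonotone a)
    (p : ℝ[X]) : ‖momentMap a p‖ ≤ 3 * ‖a 0‖ * ‖p.toContinuousMapOn I‖ := by
  refine le_of_tendsto (ha.tendsto_bernstein p).norm (Eventually.of_forall fun n => ?_)
  refine (norm_sum_smul_le_of_nonneg _ _ _ (norm_nonneg (p.toContinuousMapOn I))
    (fun k _ => ha.bernstein_nonneg n k) fun k hk => ?_).trans ?_
  · exact (p.toContinuousMapOn I).norm_coe_le_norm ⟨_, div_natCast_mem_unitInterval hk⟩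
  · rw [sum_momentMap_bernstein]
    linarith

theorem IsCompletelyMonotone.momentMap_nonneg {a : ℕ → A} (ha : IsCompletelyMonotone a)
    {p : ℝ[X]} (hp : ∀ x ∈ I, 0 ≤ p.eval x) : 0 ≤ momentMap a p := by
  refine CStarAlgebra.isClosed_nonneg.mem_of_tendsto (ha.tendsto_bernstein p)
    (Eventually.of_forall fun n => Finset.sum_nonneg fun k hk => ?_)
  exact smul_nonneg (hp _ (div_natCast_mem_unitInterval hk)) (ha.bernstein_nonneg n k)

theorem denseRange_toContinuousMapOn :
    DenseRange (Polynomial.toContinuousMapOnAlgHom (R := ℝ) I).toLinearMap := by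
  have h := polynomialFunctions_closure_eq_top 0 1
  rw [DenseRange, dense_iff_closure_eq]
  have h2 := congrArg (fun S : Subalgebra ℝ C(I, ℝ) => (S : Set C(I, ℝ))) h
  simp only [Subalgebra.topologicalClosure_coe, Algebra.coe_top] at h2
  rw [← h2]
  congr 1
  ext f
  simp [polynomialFunctions]

/-- The positive linear map `C([0,1]) → A` with prescribed completely monotone moments. -/
noncomputable def calculus (a : ℕ → A) : C(I, ℝ) →L[ℝ] A :=
  (momentMap a).extendOfNorm (Polynomial.toContinuousMapOnAlgHom (R := ℝ) I).toLinearMap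

theorem IsCompletelyMonotone.calculus_polynomial {a : ℕ → A} (ha : IsCompletelyMonotone a) (p : ℝ[X]) :
    calculus a (p.toContinuousMapOn I) = momentMap a p :=
  LinearMap.extendOfNorm_eq denseRange_toContinuousMapOn
    ⟨3 * ‖a 0‖, fun p => ha.norm_momentMap_le p⟩ p

theorem IsCompletelyMonotone.calculus_nonneg {a : ℕ → A} (ha : IsCompletelyMonotone a)
    {f : C(I, ℝ)} (hf : 0 ≤ f) : 0 ≤ calculus a f := by
  -- Approximate the square root of `f` by polynomials and square.
  let g : C(I, ℝ) := ⟨fun x => √(f x), by fun_prop⟩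
  have hg : f = g * g := by
    ext x
    exact (Real.mul_self_sqrt (hf x)).symm
  have hcl : ∀ k : C(I, ℝ), 0 ≤ calculus a (k * k) := by
    intro k
    refine denseRange_toContinuousMapOn.induction_on (p := fun k => 0 ≤ calculus a (k * k)) k
      ?_ fun p => ?_
    · exact CStarAlgebra.isClosed_nonneg.preimage (by fun_prop)
    · have := ha.calculus_polynomial (p * p)
      have e : (p * p).toContinuousMapOn I =
        (Polynomial.toContinuousMapOnAlgHom (R := ℝ) I).toLinearMap p *
        (Polynomial.toContinuousMapOnAlgHom (R := ℝ) I).toLinearMap p :=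
        map_mul (Polynomial.toContinuousMapOnAlgHom (R := ℝ) I) p p
      rw [← e, this]
      exact ha.momentMap_nonneg fun x _ => by simpa using mul_self_nonneg (p.eval x)
  rw [hg]
  exact hcl g

end Hausdorff

/-! ### The functional calculus of a radial operator function -/

section Calculus

open unitInterval MeasureTheory

variable {H : Type*} [NormedAddCommGroup H] [InnerProductSpace ℂ H]

theorem nonneg_iff_forall_inner {T : H →L[ℂ] H} : 0 ≤ T ↔ ∀ v, 0 ≤ inner ℂ v (T v) := by
  rw [ContinuousLinearMap.nonneg_iff_isPositive]
  refine ⟨fun h v => h.inner_nonneg_right v, fun h => ?_⟩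
  rw [ContinuousLinearMap.isPositive_iff_complex]
  intro v
  have hv := Complex.le_def.1 (h v)
  have e : inner ℂ (T v) v = ((inner ℂ v (T v)).re : ℂ) := by
    rw [← inner_conj_symm]
    apply Complex.ext
    · rw [Complex.conj_re, Complex.ofReal_re]
    · rw [Complex.conj_im, Complex.ofReal_im, ← hv.2]; simp
  rw [e]
  exact ⟨by simp, by simpa using! hv.1⟩

/-- The hypotheses on `F` in scalar form, in the variable `t = (distance)²`: positive definiteness
in all dimensions and weak continuity. -/
structure IsRadialOperator (F : ℝ≥0 → H →L[ℂ] H) : Prop where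
  posDef : ∀ v, IsRadialPosDef fun t => inner ℂ v (sqrtFun F t v)
  continuous : ∀ u v, Continuous fun t => inner ℂ u (F t v)

theorem UltraweaklyContinuous.continuous_inner {F : ℝ≥0 → H →L[ℂ] H}
    (hF : UltraweaklyContinuous F) (u v : H) : Continuous fun t => inner ℂ u (F t v) := by
  have hs : ∀ w : H, Summable fun n => ‖(Pi.single 0 w : ℕ → H) n‖ ^ 2 := fun w =>
    summable_of_ne_finset_zero (s := {0}) fun n hn => by
      rw [Pi.single_eq_of_ne (by simpa using hn)]; simp
  have h := hF (Pi.single 0 v) (Pi.single 0 u) (hs v) (hs u)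
  convert h using 2 with t
  rw [tsum_eq_single 0 fun n hn => by rw [Pi.single_eq_of_ne hn]; simp]
  simp

theorem IsRadialOperator.continuous_sqrtFun {F : ℝ≥0 → H →L[ℂ] H}
    (hF : IsRadialOperator F) (u v : H) :
    Continuous fun t => inner ℂ u (sqrtFun F t v) :=
  (hF.continuous u v).comp (by fun_prop)

variable [CompleteSpace H]

/-- Sampling at equally spaced squared distances gives completely monotone sequences of operators. -/
theorem IsRadialPosDef.isCompletelyMonotone {G : ℝ → H →L[ℂ] H}
    (hG : ∀ v, IsRadialPosDef fun t => inner ℂ v (G t v)) {τ : ℝ} (hτ : 0 ≤ τ) :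
    IsCompletelyMonotone fun k : ℕ => G (k * τ) := by
  intro p k
  rw [nonneg_iff_forall_inner]
  intro v
  have key : ∀ p : ℕ, ∃ g, IsRadialPosDef g ∧ ∀ k : ℕ, inner ℂ v (momentMap
      (fun k : ℕ => G (k * τ)) ((1 - Polynomial.X) ^ p * Polynomial.X ^ k) v) = g (k * τ) := by
    intro p
    induction p with
    | zero => exact ⟨_, hG v, fun k => by rw [pow_zero, one_mul, momentMap_X_pow]⟩
    | succ p ih =>
      obtain ⟨g, hg, hgk⟩ := ih
      refine ⟨_, hg.sub_shift hτ, fun k => ?_⟩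
      have e : ((1 - Polynomial.X) ^ (p + 1) * Polynomial.X ^ k : Polynomial ℝ) =
          (1 - Polynomial.X) ^ p * Polynomial.X ^ k -
          (1 - Polynomial.X) ^ p * Polynomial.X ^ (k + 1) := by ring
      rw [e, map_sub, sub_apply, inner_sub_right, hgk, hgk]
      push_cast
      ring_nf
  obtain ⟨g, hg, hgk⟩ := key p
  rw [hgk]
  exact hg.nonneg (by positivity)

/-- The function `r ↦ r ^ t` on `[0,1]`; with `r = exp (-s)` it is `s ↦ exp (-s t)`. -/
noncomputable def rpowMap (t : ℝ≥0) : C(I, ℝ) :=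
  ⟨fun r => (r : ℝ) ^ (t : ℝ), (Real.continuous_rpow_const t.2).comp continuous_subtype_val⟩

/-- The functional calculus `f ↦ ∫ f dμ` of the operator measure `μ` on `[0,1]` for which
`F(√t) = ∫ r ^ t dμ(r)`. -/
noncomputable def radialCalculus (F : ℝ≥0 → H →L[ℂ] H) : C(I, ℝ) →L[ℝ] H →L[ℂ] H :=
  calculus fun k : ℕ => sqrtFun F k

theorem tendsto_rpowMap {ι : Type*} {l : Filter ι} {t : ι → ℝ≥0} {t₀ : ℝ≥0} (ht₀ : 0 < t₀)
    (ht : ∀ i, 0 < t i) (h : Tendsto t l (𝓝 t₀)) :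
    Tendsto (fun i => rpowMap (t i)) l (𝓝 (rpowMap t₀)) := by
  let f : C({t : ℝ≥0 // 0 < t} × I, ℝ) := ⟨fun p => (p.2 : ℝ) ^ (p.1 : ℝ), by
    rw [continuous_iff_continuousAt]
    intro p
    exact ContinuousAt.rpow (by fun_prop) (by fun_prop) (Or.inr (by simpa using p.1.2))⟩
  have h1 : Tendsto (fun i => (⟨t i, ht i⟩ : {t : ℝ≥0 // 0 < t})) l (𝓝 ⟨t₀, ht₀⟩) :=
    tendsto_subtype_rng.2 h
  exact (f.curry.continuous.tendsto _).comp h1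

variable {F : ℝ≥0 → H →L[ℂ] H}

theorem IsRadialOperator.calculus_nonneg (hF : IsRadialOperator F) {f : C(I, ℝ)} (hf : 0 ≤ f) :
    0 ≤ radialCalculus F f := by
  have h := IsRadialPosDef.isCompletelyMonotone hF.posDef (zero_le_one' ℝ)
  simp only [mul_one] at h
  exact h.calculus_nonneg hf

theorem IsRadialOperator.calculus_rpowMap_rat (hF : IsRadialOperator F) (k N : ℕ) (hN : 0 < N) :
    radialCalculus F (rpowMap (k / N)) = sqrtFun F (k / N) := by
  have hN' : (N : ℝ) ≠ 0 := by exact_mod_cast hN.ne'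
  have h1 := IsRadialPosDef.isCompletelyMonotone hF.posDef (zero_le_one' ℝ)
  simp only [mul_one] at h1
  have h2 := IsRadialPosDef.isCompletelyMonotone hF.posDef
    (τ := 1 / N) (by positivity)
  -- Composition with `r ↦ r ^ N` intertwines the calculi of step `1` and of step `1 / N`.
  let c : C(I, I) := ⟨fun r => r ^ N, by fun_prop⟩
  have key : ∀ f : C(I, ℝ), radialCalculus F f =
      calculus (fun k : ℕ => sqrtFun F (k * (1 / N))) (f.comp c) := by
    intro f
    refine denseRange_toContinuousMapOn.induction_on
      (p := fun f => radialCalculus F f =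
        calculus (fun k : ℕ => sqrtFun F (k * (1 / N))) (f.comp c)) f ?_ fun p => ?_
    · refine isClosed_eq (by fun_prop) ?_
      exact (ContinuousLinearMap.continuous _).comp (ContinuousMap.continuous_precomp c)
    · have e : (p.toContinuousMapOn I).comp c = (p.comp (Polynomial.X ^ N)).toContinuousMapOn I := by
        ext r; simp [c]
      change radialCalculus F (p.toContinuousMapOn I) = calculus _ ((p.toContinuousMapOn I).comp c)
      rw [e, h2.calculus_polynomial, radialCalculus, h1.calculus_polynomial]
      induction p using Polynomial.induction_on' with
      | add p q hp hq =>
        rw [map_add, Polynomial.add_comp, map_add, hp (by ext r; simp [c]), hq (by ext r; simp [c])]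
      | monomial j a =>
        rw [← Polynomial.C_mul_X_pow_eq_monomial, ← Polynomial.smul_eq_C_mul, Polynomial.smul_comp,
          map_smul, map_smul, Polynomial.X_pow_comp, ← pow_mul, momentMap_X_pow, momentMap_X_pow]
        congr 2
        push_cast
        field_simp
  rw [key]
  have e : (rpowMap (k / N)).comp c = (Polynomial.X ^ k : Polynomial ℝ).toContinuousMapOn I := by
    ext r
    simp only [rpowMap, c, ContinuousMap.comp_apply, ContinuousMap.coe_mk, NNReal.coe_div,
      NNReal.coe_natCast, Set.Icc.coe_pow, Polynomial.toContinuousMapOn_apply,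
      Polynomial.toContinuousMap_apply, Polynomial.eval_pow, Polynomial.eval_X]
    rw [← Real.rpow_natCast (r : ℝ) N, ← Real.rpow_mul r.2.1, mul_div_cancel₀ _ hN',
      Real.rpow_natCast]
  rw [e, h2.calculus_polynomial, momentMap_X_pow]
  congr 1
  ring

/-- The function `F(√t)` is the integral of `r ^ t`. -/
theorem IsRadialOperator.calculus_rpowMap (hF : IsRadialOperator F) (t : ℝ≥0) :
    radialCalculus F (rpowMap t) = sqrtFun F t := by
  rcases eq_or_ne t 0 with rfl | ht
  · simpa using hF.calculus_rpowMap_rat 0 1 one_pos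
  have ht0 : 0 < t := pos_iff_ne_zero.2 ht
  refine ContinuousLinearMap.ext fun v => ext_inner_left ℂ fun u => ?_
  -- Approximate `t` by positive rationals: `r ^ t` is norm continuous in `t > 0` only.
  let s : ℕ → ℝ≥0 := fun n => (⌈t * (n + 1 : ℕ)⌉₊ : ℝ≥0) / ((n + 1 : ℕ) : ℝ≥0)
  have hs : Tendsto s atTop (𝓝 t) := by
    have h := (tendsto_nat_ceil_mul_div_atTop (R := ℝ) t.2).comp
      (tendsto_natCast_atTop_atTop.comp (tendsto_add_atTop_nat 1))
    rw [← NNReal.tendsto_coe]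
    refine h.congr fun n => ?_
    simp only [s, Function.comp_apply, NNReal.coe_div, NNReal.coe_natCast]
    congr 2
  have hpos : ∀ n, 0 < s n := fun n => by
    have : 0 < ⌈t * (n + 1 : ℕ)⌉₊ := Nat.ceil_pos.2 (by positivity)
    simp only [s]
    positivity
  have h1 : Tendsto (fun n => inner ℂ u (radialCalculus F (rpowMap (s n)) v)) atTop
      (𝓝 (inner ℂ u (radialCalculus F (rpowMap t) v))) := by
    have := ((radialCalculus F).continuous.tendsto _).comp (tendsto_rpowMap ht0 hpos hs)
    exact (tendsto_const_nhds).inner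
      (((ContinuousLinearMap.apply ℂ H v).continuous.tendsto _).comp this)
  have h2 : Tendsto (fun n => inner ℂ u (sqrtFun F (s n) v)) atTop
      (𝓝 (inner ℂ u (sqrtFun F t v))) :=
    ((hF.continuous_sqrtFun u v).tendsto _).comp (NNReal.tendsto_coe.2 hs)
  refine tendsto_nhds_unique h1 (h2.congr fun n => ?_)
  simp only [s]
  rw [hF.calculus_rpowMap_rat _ _ n.succ_pos]
  simp

/-- Every vector `v` has a finite measure on `[0,1]` representing the calculus in the state `v`; it
is a form of Schoenberg's theorem. Continuity of `F` at `0` excludes an atom at `r = 0`. -/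
theorem IsRadialOperator.exists_measure (hF : IsRadialOperator F) (v : H) :
    ∃ ν : Measure I, IsFiniteMeasure ν ∧ ν {0} = 0 ∧
      ∀ f : C(I, ℝ), inner ℂ v (radialCalculus F f v) = ((∫ r, f r ∂ν : ℝ) : ℂ) := by
  have hnn : ∀ f : C(I, ℝ), 0 ≤ f → 0 ≤ inner ℂ v (radialCalculus F f v) := fun f hf =>
    nonneg_iff_forall_inner.1 (hF.calculus_nonneg hf) v
  let Λ : CompactlySupportedContinuousMap I ℝ →ₚ[ℝ] ℝ :=
    { toFun f := (inner ℂ v (radialCalculus F f.toContinuousMap v)).re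
      map_add' f g := by
        have : (f + g).toContinuousMap = f.toContinuousMap + g.toContinuousMap := rfl
        rw [this, map_add, add_apply, inner_add_right, Complex.add_re]
      map_smul' c f := by
        have : (c • f).toContinuousMap = c • f.toContinuousMap := rfl
        rw [this, map_smul, smul_apply, inner_smul_right_eq_smul]
        simp
      monotone' f g hfg := by
        have h := hnn (g.toContinuousMap - f.toContinuousMap)
          (sub_nonneg.2 fun x => hfg x)
        rw [map_sub, sub_apply, inner_sub_right] at h
        have := (Complex.le_def.1 h).1
        simp only [Complex.zero_re, Complex.sub_re] at this
        change (inner ℂ v (radialCalculus F f.toContinuousMap v)).re ≤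
          (inner ℂ v (radialCalculus F g.toContinuousMap v)).re
        linarith }
  let ν := RealRMK.rieszMeasure Λ
  have hfin : IsFiniteMeasure ν := by
    constructor
    let o : CompactlySupportedContinuousMap I ℝ :=
      { toFun := 1, hasCompactSupport' := HasCompactSupport.of_compactSpace 1 }
    exact (RealRMK.rieszMeasure_le_of_eq_one Λ (f := o) (fun x => by simp [o]) isCompact_univ
      (fun x => by simp [o])).trans_lt ENNReal.ofReal_lt_top
  have hre : ∀ f : C(I, ℝ), (inner ℂ v (radialCalculus F f v)).re = ∫ r, f r ∂ν := fun f =>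
    (RealRMK.integral_rieszMeasure Λ
      ⟨f, HasCompactSupport.of_compactSpace f⟩).symm
  have him : ∀ f : C(I, ℝ), (inner ℂ v (radialCalculus F f v)).im = 0 := by
    intro f
    have h1 := (Complex.le_def.1 (hnn (f ⊔ 0) le_sup_right)).2
    have h2 := (Complex.le_def.1 (hnn ((f ⊔ 0) - f) (sub_nonneg.2 le_sup_left))).2
    rw [map_sub, sub_apply, inner_sub_right, Complex.sub_im] at h2
    simp only [Complex.zero_im] at h1 h2
    linarith
  refine ⟨ν, hfin, ?_, fun f => ?_⟩
  · have h0 : ∀ t : ℝ≥0, ∫ r, rpowMap t r ∂ν = (inner ℂ v (sqrtFun F t v)).re := fun t => by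
      rw [← hre, hF.calculus_rpowMap]
    have hle : ∀ t : ℝ≥0, 0 < t → ∫ r, rpowMap t r ∂ν ≤ ν.real {0}ᶜ := by
      intro t ht
      rw [← setIntegral_one_eq_measureReal, ← integral_indicator (measurableSet_singleton 0).compl]
      refine integral_mono ((rpowMap t).continuous.integrable_of_hasCompactSupport
        (HasCompactSupport.of_compactSpace _)) ((integrable_const 1).indicator (measurableSet_singleton 0).compl)
        fun r => ?_
      by_cases hr : r = 0
      · subst hr
        rw [Set.indicator_of_notMem (by simp)]
        exact (Real.zero_rpow (NNReal.coe_ne_zero.2 ht.ne')).le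
      · rw [Set.indicator_of_mem (by simpa using hr)]
        exact Real.rpow_le_one r.2.1 r.2.2 t.2
    have hlim : Tendsto (fun t : ℝ≥0 => (inner ℂ v (sqrtFun F t v)).re) (𝓝[>] 0)
        (𝓝 (inner ℂ v (sqrtFun F (0 : ℝ≥0) v)).re) :=
      (((Complex.continuous_re.comp (hF.continuous_sqrtFun v v)).comp
        NNReal.continuous_coe).tendsto 0).mono_left nhdsWithin_le_nhds
    have h1 : (inner ℂ v (sqrtFun F (0 : ℝ≥0) v)).re ≤ ν.real {0}ᶜ := by
      refine le_of_tendsto hlim (eventually_nhdsWithin_of_forall fun t ht => ?_)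
      rw [← h0]
      exact hle t ht
    rw [← h0, measureReal_compl (measurableSet_singleton 0)] at h1
    have e : ∫ r, rpowMap 0 r ∂ν = ν.real Set.univ := by simp [rpowMap]
    rw [e] at h1
    have : ν.real {0} = 0 := le_antisymm (by linarith) measureReal_nonneg
    simpa [measureReal_def, ENNReal.toReal_eq_zero_iff] using this
  · rw [← hre]
    exact Complex.ext (by simp) (by simpa using him f)

end Calculus

/-! ### Gaussian densities -/

section Gaussian

open unitInterval MeasureTheory Real
open scoped FourierTransform

variable {V : Type*} [NormedAddCommGroup V] [InnerProductSpace ℝ V]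

/-- The Gaussian probability density on `V` whose Fourier transform is `x ↦ exp (-s ‖x‖²)`. At
`s = 0` the conventions for division give the value `0` in positive dimension. -/
noncomputable def gaussDensity (s : ℝ) (w : V) : ℝ :=
  (π * s⁻¹) ^ (Module.finrank ℝ V / 2 : ℝ) * rexp (-(π ^ 2 * ‖w‖ ^ 2) * s⁻¹)

theorem gaussDensity_nonneg {s : ℝ} (hs : 0 ≤ s) (w : V) : 0 ≤ gaussDensity s w := by
  rw [gaussDensity]; positivity

theorem gaussDensity_pos {s : ℝ} (hs : 0 < s) (w : V) : 0 < gaussDensity s w := by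
  rw [gaussDensity]; positivity

theorem continuous_gaussDensity (s : ℝ) : Continuous (gaussDensity (V := V) s) := by
  unfold gaussDensity
  fun_prop

theorem negLog_nonneg (r : I) : 0 ≤ -log r := neg_nonneg.2 (log_nonpos r.2.1 r.2.2)

theorem negLog_pos {r : I} (h0 : r ≠ 0) (h1 : r ≠ 1) : 0 < -log r :=
  neg_pos.2 (log_neg (lt_of_le_of_ne r.2.1 fun h => h0 (Subtype.ext h.symm))
    (lt_of_le_of_ne r.2.2 fun h => h1 (Subtype.ext h)))

theorem continuousAt_inv_negLog {r : I} (hr : r ≠ 1) :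
    ContinuousAt (fun r : I => (-log (r : ℝ))⁻¹) r := by
  suffices h : ContinuousAt (fun r : ℝ => (-log r)⁻¹) r from
    h.comp (f := fun r : I => (r : ℝ)) continuous_subtype_val.continuousAt
  rcases eq_or_ne r 0 with rfl | h0
  · have h : Tendsto (fun r : ℝ => (-log r)⁻¹) (𝓝[≠] 0) (𝓝 0) :=
      tendsto_inv_atTop_zero.comp (tendsto_neg_atBot_atTop.comp tendsto_log_nhdsNE_zero)
    rw [continuousAt_iff_punctured_nhds]
    simpa using h
  · have h0' : (r : ℝ) ≠ 0 := fun h => h0 (Subtype.ext h)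
    exact ((continuousAt_log h0').neg).inv₀ (negLog_pos h0 hr).ne'

theorem tendsto_inv_negLog_one : Tendsto (fun r : I => (-log (r : ℝ))⁻¹) (𝓝[≠] 1) atTop := by
  refine tendsto_inv_nhdsGT_zero.comp (tendsto_nhdsWithin_iff.2 ⟨?_, ?_⟩)
  · have h : ContinuousAt (fun r : ℝ => -log r) 1 := (continuousAt_log one_ne_zero).neg
    have h2 := (h.comp (f := fun r : I => (r : ℝ)) (x := 1) continuous_subtype_val.continuousAt)
    have h3 : Tendsto (fun r : I => -log (r : ℝ)) (𝓝 1) (𝓝 0) := by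
      simpa [ContinuousAt, Function.comp_def] using h2
    exact h3.mono_left nhdsWithin_le_nhds
  · have h0 : ∀ᶠ r : I in 𝓝[≠] 1, r ≠ 0 := nhdsWithin_le_nhds (isOpen_ne.mem_nhds (by simp))
    filter_upwards [h0, self_mem_nhdsWithin] with r hr0 hr1
    exact negLog_pos hr0 hr1

/-- Away from `w = 0` the density extends continuously to the two ends `s = 0` and `s = ∞`. -/
theorem continuousAt_gaussDensity_negLog [Nontrivial V] [FiniteDimensional ℝ V] {w₀ : V}
    (hw₀ : w₀ ≠ 0) (r₀ : I) :
    ContinuousAt (fun p : V × I => gaussDensity (-log (p.2 : ℝ)) p.1) (w₀, r₀) := by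
  have hd : 0 < (Module.finrank ℝ V / 2 : ℝ) := by
    have := Module.finrank_pos (R := ℝ) (M := V)
    positivity
  by_cases hr : r₀ = 1
  · subst hr
    have hval : gaussDensity (-log ((1 : I) : ℝ)) w₀ = 0 := by
      simp [gaussDensity, zero_rpow hd.ne']
    rw [ContinuousAt, hval]
    have hw : 0 < ‖w₀‖ := norm_pos_iff.2 hw₀
    set b : ℝ := π ^ 2 * (‖w₀‖ / 2) ^ 2
    have hb : 0 < b := by positivity
    have hG : Tendsto (fun y : ℝ => π ^ (Module.finrank ℝ V / 2 : ℝ) *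
        (y ^ (Module.finrank ℝ V / 2 : ℝ) * rexp (-b * y))) atTop (𝓝 0) := by
      simpa using (tendsto_rpow_mul_exp_neg_mul_atTop_nhds_zero _ b hb).const_mul
        (π ^ (Module.finrank ℝ V / 2 : ℝ))
    rw [Metric.tendsto_nhds]
    intro ε hε
    have h1 := (hG.comp tendsto_inv_negLog_one).eventually (gt_mem_nhds hε)
    rw [eventually_nhdsWithin_iff] at h1
    have h2 : ∀ᶠ w : V in 𝓝 w₀, ‖w₀‖ / 2 < ‖w‖ :=
      continuous_norm.continuousAt.eventually (lt_mem_nhds (half_lt_self hw))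
    rw [nhds_prod_eq]
    filter_upwards [h2.prod_mk h1] with p hp
    have hnn := gaussDensity_nonneg (negLog_nonneg p.2) p.1
    rw [dist_zero_right, norm_of_nonneg hnn]
    by_cases hp1 : p.2 = 1
    · rw [hp1]
      simpa [gaussDensity, zero_rpow hd.ne'] using hε
    · refine lt_of_le_of_lt ?_ (hp.2 hp1)
      have hy : 0 ≤ (-log (p.2 : ℝ))⁻¹ := inv_nonneg.2 (negLog_nonneg p.2)
      simp only [gaussDensity, Function.comp_apply]
      rw [mul_rpow pi_pos.le hy, mul_assoc]
      have hb' : b ≤ π ^ 2 * ‖p.1‖ ^ 2 := by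
        simp only [b]
        gcongr
        exact hp.1.le
      gcongr
  · have h : ContinuousAt (fun p : V × I => (-log (p.2 : ℝ))⁻¹) (w₀, r₀) :=
      (continuousAt_inv_negLog hr).comp (f := Prod.snd) (x := (w₀, r₀)) continuousAt_snd
    unfold gaussDensity
    refine ContinuousAt.mul ?_ ?_
    · exact (continuousAt_const.mul h).rpow_const (Or.inr hd.le)
    · exact (ContinuousAt.mul (by fun_prop) h).rexp

open Classical in
/-- The function `r = exp (-s) ↦ gaussDensity s w` on `[0,1]`, for `w ≠ 0`; zero for `w = 0`. -/
noncomputable def gaussMap [Nontrivial V] [FiniteDimensional ℝ V] (w : V) : C(I, ℝ) :=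
  if hw : w ≠ 0 then ⟨fun r => gaussDensity (-log (r : ℝ)) w, continuous_iff_continuousAt.2
    fun r => (continuousAt_gaussDensity_negLog hw r).comp (f := fun r : I => (w, r))
      (by fun_prop)⟩ else 0

section

variable [Nontrivial V] [FiniteDimensional ℝ V]

theorem gaussMap_apply {w : V} (hw : w ≠ 0) (r : I) :
    gaussMap w r = gaussDensity (-log (r : ℝ)) w := by
  simp [gaussMap, hw]

theorem gaussMap_nonneg (w : V) : 0 ≤ gaussMap w := by
  intro r
  by_cases hw : w = 0
  · simp [gaussMap, hw]
  · exact (gaussDensity_nonneg (negLog_nonneg r) w).trans_eq (gaussMap_apply hw r).symm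

theorem continuousOn_gaussMap : ContinuousOn (gaussMap (V := V)) {0}ᶜ := by
  rw [continuousOn_iff_continuous_domRestrict]
  let f : C(({0}ᶜ : Set V) × I, ℝ) := ⟨fun p => gaussDensity (-log (p.2 : ℝ)) (p.1 : V), by
    rw [continuous_iff_continuousAt]
    intro p
    exact (continuousAt_gaussDensity_negLog p.1.2 p.2).comp
      (f := fun p : ({0}ᶜ : Set V) × I => ((p.1 : V), p.2)) (by fun_prop)⟩
  convert f.curry.continuous using 1
  ext w r
  exact gaussMap_apply w.2 r

end

variable [FiniteDimensional ℝ V] [MeasurableSpace V] [BorelSpace V]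

theorem fourier_gaussDensity {s : ℝ} (hs : 0 < s) (x : V) :
    𝓕 (fun w : V => (gaussDensity s w : ℂ)) x = rexp (-s * ‖x‖ ^ 2) := by
  have hb : 0 < ((π ^ 2 / s : ℝ) : ℂ).re := by rw [Complex.ofReal_re]; positivity
  have h := fourier_gaussian_innerProductSpace hb x
  have e : (fun w : V => (gaussDensity s w : ℂ)) =
      (((π * s⁻¹) ^ (Module.finrank ℝ V / 2 : ℝ) : ℝ) : ℂ) •
        fun v : V => Complex.exp (-((π ^ 2 / s : ℝ) : ℂ) * ‖v‖ ^ 2) := by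
    ext w
    simp only [gaussDensity, Pi.smul_apply, smul_eq_mul]
    push_cast
    congr 2
    field_simp
  have h2 : 𝓕 ((((π * s⁻¹) ^ (Module.finrank ℝ V / 2 : ℝ) : ℝ) : ℂ) •
        fun v : V => Complex.exp (-((π ^ 2 / s : ℝ) : ℂ) * ‖v‖ ^ 2)) x =
      (((π * s⁻¹) ^ (Module.finrank ℝ V / 2 : ℝ) : ℝ) : ℂ) •
        𝓕 (fun v : V => Complex.exp (-((π ^ 2 / s : ℝ) : ℂ) * ‖v‖ ^ 2)) x := by
    simp only [Real.fourier_eq', Pi.smul_apply, smul_eq_mul]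
    rw [← integral_const_mul]
    congr 1
    ext v
    ring
  rw [e, h2, h]
  have e3 : ((π : ℂ) / ((π ^ 2 / s : ℝ) : ℂ)) ^ ((Module.finrank ℝ V : ℂ) / 2) =
      (((π / (π ^ 2 / s)) ^ (Module.finrank ℝ V / 2 : ℝ) : ℝ) : ℂ) := by
    rw [Complex.ofReal_cpow (by positivity)]
    push_cast
    rfl
  rw [e3, smul_eq_mul, ← mul_assoc, ← Complex.ofReal_mul, ← mul_rpow (by positivity)
    (by positivity)]
  have e4 : π * s⁻¹ * (π / (π ^ 2 / s)) = 1 := by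
    have := pi_pos.ne'
    field_simp
  rw [e4, one_rpow]
  push_cast
  rw [one_mul]
  congr 1
  have : (π : ℂ) ≠ 0 := by exact_mod_cast pi_pos.ne'
  have : (s : ℂ) ≠ 0 := by exact_mod_cast hs.ne'
  field_simp

theorem integrable_gaussDensity {s : ℝ} (hs : 0 < s) : Integrable (gaussDensity (V := V) s) := by
  have hb : 0 < ((π ^ 2 / s : ℝ) : ℂ).re := by rw [Complex.ofReal_re]; positivity
  have h := (GaussianFourier.integrable_cexp_neg_mul_sq_norm_add hb 0 (0 : V)).norm.const_mul
    ((π * s⁻¹) ^ (Module.finrank ℝ V / 2 : ℝ))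
  refine h.congr (ae_of_all _ fun w => ?_)
  simp only [gaussDensity, Complex.norm_exp]
  congr 2
  simp [← Complex.ofReal_pow]
  field_simp

theorem integral_gaussDensity {s : ℝ} (hs : 0 < s) : ∫ w : V, gaussDensity s w = 1 := by
  have h := fourier_gaussDensity hs (0 : V)
  simp only [Real.fourier_eq', inner_zero_right, mul_zero, Complex.ofReal_zero, zero_mul,
    Complex.exp_zero, one_smul, norm_zero] at h
  rw [integral_complex_ofReal] at h
  simpa using h

theorem lintegral_gaussDensity {s : ℝ} (hs : 0 < s) :
    ∫⁻ w : V, ENNReal.ofReal (gaussDensity s w) = 1 := by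
  rw [← ofReal_integral_eq_lintegral_ofReal (integrable_gaussDensity hs)
    (ae_of_all _ fun w => gaussDensity_nonneg hs.le w), integral_gaussDensity hs,
    ENNReal.ofReal_one]

/-- The moments of order `2k` of the Gaussian density are at most a constant times `s ^ k`. -/
theorem exists_lintegral_pow_mul_gaussDensity_le (k : ℕ) :
    ∃ C : ℝ, 0 ≤ C ∧ ∀ s : ℝ, 0 < s →
      ∫⁻ w : V, ENNReal.ofReal (‖w‖ ^ (2 * k) * gaussDensity s w) ≤ ENNReal.ofReal (C * s ^ k) := by
  refine ⟨(2 / π ^ 2) ^ k * k.factorial * 2 ^ (Module.finrank ℝ V / 2 : ℝ), by positivity,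
    fun s hs => ?_⟩
  have hpt : ∀ w : V, ‖w‖ ^ (2 * k) * gaussDensity s w ≤
      ((2 / π ^ 2) ^ k * k.factorial * 2 ^ (Module.finrank ℝ V / 2 : ℝ) * s ^ k) *
        gaussDensity (2 * s) w := by
    intro w
    set x : ℝ := π ^ 2 * ‖w‖ ^ 2 / (2 * s) with hx
    have hx0 : 0 ≤ x := by positivity
    have h1 : x ^ k ≤ k.factorial * rexp x := by
      have := pow_div_factorial_le_exp x hx0 k
      rw [div_le_iff₀ (by positivity)] at this
      linarith
    have e1 : ‖w‖ ^ (2 * k) = (2 / π ^ 2) ^ k * s ^ k * x ^ k := by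
      have := pi_pos.ne'
      rw [← mul_pow, ← mul_pow, pow_mul]
      congr 1
      rw [hx]
      field_simp
    have e2 : gaussDensity s w = 2 ^ (Module.finrank ℝ V / 2 : ℝ) * gaussDensity (2 * s) w *
        rexp (-x) := by
      have e3 : -(π ^ 2 * ‖w‖ ^ 2) * s⁻¹ = -(π ^ 2 * ‖w‖ ^ 2) * (2 * s)⁻¹ + -x := by
        rw [hx]; field_simp; ring
      have e4 : π * s⁻¹ = 2 * (π * (2 * s)⁻¹) := by field_simp
      rw [gaussDensity, gaussDensity, e3, exp_add, e4, mul_rpow zero_le_two (by positivity)]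
      ring
    have hg := gaussDensity_nonneg (by positivity : 0 ≤ 2 * s) w
    rw [e1, e2]
    calc (2 / π ^ 2) ^ k * s ^ k * x ^ k * (2 ^ (Module.finrank ℝ V / 2 : ℝ) *
        gaussDensity (2 * s) w * rexp (-x)) ≤
        (2 / π ^ 2) ^ k * s ^ k * (k.factorial * rexp x) * (2 ^ (Module.finrank ℝ V / 2 : ℝ) *
        gaussDensity (2 * s) w * rexp (-x)) := by gcongr
      _ = (2 / π ^ 2) ^ k * s ^ k * k.factorial * (2 ^ (Module.finrank ℝ V / 2 : ℝ) *
        gaussDensity (2 * s) w) * (rexp x * rexp (-x)) := by ring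
      _ = _ := by rw [← exp_add]; simp; ring
  calc ∫⁻ w : V, ENNReal.ofReal (‖w‖ ^ (2 * k) * gaussDensity s w)
      ≤ ∫⁻ w : V, ENNReal.ofReal ((2 / π ^ 2) ^ k * k.factorial *
          2 ^ (Module.finrank ℝ V / 2 : ℝ) * s ^ k) * ENNReal.ofReal (gaussDensity (2 * s) w) := by
        refine lintegral_mono fun w => ?_
        rw [← ENNReal.ofReal_mul (by positivity)]
        exact ENNReal.ofReal_le_ofReal (hpt w)
    _ = _ := by
        rw [lintegral_const_mul _ (by
          have := continuous_gaussDensity (V := V) (2 * s)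
          fun_prop), lintegral_gaussDensity (by positivity), mul_one]

end Gaussian

/-! ### Moments of the trace measure -/

section Moments

open unitInterval MeasureTheory

theorem sum_choose_mul_pow_eq_zero {i q : ℕ} (h : i < q) :
    ∑ k ∈ Finset.range (q + 1), ((-1 : ℝ) ^ (q - k) * q.choose k) * (k : ℝ) ^ i = 0 := by
  have h1 := congrFun (fwdDiff_iter_pow_eq_zero_of_lt (R := ℝ) h) 0
  rw [fwdDiff_iter_eq_sum_shift] at h1
  simpa [zsmul_eq_mul] using h1

/-- An even function of class `C^{2q}` agrees with a polynomial in `t ^ 2` up to `O(t^{2q})`. -/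
theorem exists_even_taylor {g : ℝ → ℝ} {q : ℕ} (hq : q ≠ 0) (hg : ContDiff ℝ (2 * q : ℕ) g)
    (heven : ∀ t, g (-t) = g t) :
    ∃ (a : ℕ → ℝ) (C : ℝ), ∀ t ∈ Set.Icc (0 : ℝ) 1,
      |g t - ∑ i ∈ Finset.range q, a i * t ^ (2 * i)| ≤ C * t ^ (2 * q) := by
  obtain ⟨n, hn⟩ : ∃ n, 2 * q = n + 1 := ⟨2 * q - 1, by omega⟩
  have hodd : ∀ k, Odd k → iteratedDeriv k g 0 = 0 := by
    intro k hk
    have h := iteratedDeriv_comp_neg k g 0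
    simp only [heven, neg_zero, hk.neg_one_pow, neg_smul, one_smul] at h
    linarith
  rw [hn] at hg
  obtain ⟨C, hC⟩ := exists_taylor_mean_remainder_bound (zero_le_one' ℝ)
    (f := g) (n := n) (by exact_mod_cast hg.contDiffOn)
  refine ⟨fun i => ((2 * i).factorial : ℝ)⁻¹ * iteratedDeriv (2 * i) g 0, C, fun t ht => ?_⟩
  have h := hC t ht
  rw [taylor_within_apply, sub_zero, ← hn, Real.norm_eq_abs] at h
  convert h using 3
  have e : ∀ k ∈ Finset.range (2 * q), ((k.factorial : ℝ)⁻¹ * t ^ k) •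
      iteratedDerivWithin k g (Set.Icc 0 1) 0 =
      (k.factorial : ℝ)⁻¹ * iteratedDeriv k g 0 * t ^ k := by
    intro k hk
    rw [iteratedDerivWithin_eq_iteratedDeriv (uniqueDiffOn_Icc one_pos)
      ((hg.of_le (by exact_mod_cast (by have := Finset.mem_range.1 hk; omega))).contDiffAt)
      (by simp)]
    simp only [smul_eq_mul]
    ring
  rw [Finset.sum_congr rfl e]
  clear e h hC hn hq
  induction q with
  | zero => simp
  | succ q ih =>
    rw [Finset.sum_range_succ, ih, show 2 * (q + 1) = 2 * q + 1 + 1 by ring,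
      Finset.sum_range_succ _ (2 * q + 1), Finset.sum_range_succ _ (2 * q),
      hodd (2 * q + 1) ⟨q, rfl⟩]
    ring

/-- If `t ↦ ∫ r ^ (t ^ 2) dν(r)` is of class `C^{2q}`, then `ν` has a finite moment of order `q` in
the variable `s = -log r`: the `q`-th difference of the function in `t ^ 2` is
`∫ (1 - r ^ ε) ^ q dν(r)` up to sign and is `O(ε ^ q)`. -/
theorem lintegral_negLog_pow_lt_top (ν : Measure I) [IsFiniteMeasure ν] {g : ℝ → ℝ} {q : ℕ}
    (hg : ContDiff ℝ (2 * q : ℕ) g) (h : ∀ t, g t = ∫ r, (r : ℝ) ^ (t ^ 2) ∂ν) :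
    ∫⁻ r, ENNReal.ofReal ((-Real.log (r : ℝ)) ^ q) ∂ν < ⊤ := by
  rcases eq_or_ne q 0 with rfl | hq
  · simp
  obtain ⟨a, C, hC⟩ := exists_even_taylor hq hg fun t => by rw [h, h, neg_sq]
  have hint : ∀ t : ℝ, 0 ≤ t → Integrable (fun r : I => (r : ℝ) ^ t) ν := fun t ht =>
    ((Real.continuous_rpow_const ht).comp continuous_subtype_val).integrable_of_hasCompactSupport
      (HasCompactSupport.of_compactSpace _)
  set C' : ℝ := ∑ k ∈ Finset.range (q + 1), q.choose k * (C * (k : ℝ) ^ q) with hC'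
  have hD : ∀ ε : ℝ, 0 < ε → q * ε ≤ 1 → ∫ r : I, (1 - (r : ℝ) ^ ε) ^ q ∂ν ≤ C' * ε ^ q := by
    intro ε hε hqε
    have e1 : ∀ r : I, ((r : ℝ) ^ ε - 1) ^ q = ∑ k ∈ Finset.range (q + 1),
        ((-1 : ℝ) ^ (q - k) * q.choose k) * (r : ℝ) ^ (k * ε) := by
      intro r
      rw [sub_eq_add_neg, add_pow]
      refine Finset.sum_congr rfl fun k _ => ?_
      rw [← Real.rpow_natCast ((r : ℝ) ^ ε) k, ← Real.rpow_mul r.2.1, mul_comm ε]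
      ring
    have e2 : ∫ r : I, ((r : ℝ) ^ ε - 1) ^ q ∂ν = ∑ k ∈ Finset.range (q + 1),
        ((-1 : ℝ) ^ (q - k) * q.choose k) * g √(k * ε) := by
      simp only [e1, h]
      rw [integral_finsetSum _ fun k _ => (hint _ (by positivity)).const_mul _]
      refine Finset.sum_congr rfl fun k _ => ?_
      rw [integral_const_mul, Real.sq_sqrt (by positivity)]
    have hP : ∑ k ∈ Finset.range (q + 1), ((-1 : ℝ) ^ (q - k) * q.choose k) *
        ∑ i ∈ Finset.range q, a i * √(k * ε) ^ (2 * i) = 0 := by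
      simp only [Finset.mul_sum]
      rw [Finset.sum_comm]
      refine Finset.sum_eq_zero fun i hi => ?_
      have := sum_choose_mul_pow_eq_zero (Finset.mem_range.1 hi)
      calc _ = (a i * ε ^ i) * ∑ k ∈ Finset.range (q + 1),
            ((-1 : ℝ) ^ (q - k) * q.choose k) * (k : ℝ) ^ i := by
            rw [Finset.mul_sum]
            refine Finset.sum_congr rfl fun k _ => ?_
            rw [pow_mul, Real.sq_sqrt (by positivity), mul_pow]
            ring
        _ = 0 := by rw [this, mul_zero]
    have e3 : ∫ r : I, (1 - (r : ℝ) ^ ε) ^ q ∂ν = |∫ r : I, ((r : ℝ) ^ ε - 1) ^ q ∂ν| := by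
      have : ∀ r : I, (1 - (r : ℝ) ^ ε) ^ q = (-1) ^ q * ((r : ℝ) ^ ε - 1) ^ q := fun r => by
        rw [← mul_pow]; ring
      simp only [this]
      rw [integral_const_mul, ← abs_of_nonneg (a := (-1) ^ q * ∫ r : I, ((r : ℝ) ^ ε - 1) ^ q ∂ν)]
      · simp [abs_mul]
      · rw [← integral_const_mul]
        refine integral_nonneg fun r => ?_
        rw [← this]
        exact pow_nonneg (sub_nonneg.2 (Real.rpow_le_one r.2.1 r.2.2 hε.le)) q
    rw [e3, e2, ← sub_zero (∑ k ∈ Finset.range (q + 1), _), ← hP, ← Finset.sum_sub_distrib]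
    refine (Finset.abs_sum_le_sum_abs _ _).trans ?_
    rw [hC', Finset.sum_mul]
    refine Finset.sum_le_sum fun k hk => ?_
    rw [← mul_sub, abs_mul, abs_mul, abs_pow, abs_neg, abs_one, one_pow, one_mul, Nat.abs_cast]
    have hk1 : √(k * ε) ∈ Set.Icc (0 : ℝ) 1 := by
      refine ⟨Real.sqrt_nonneg _, ?_⟩
      rw [Real.sqrt_le_one]
      refine le_trans ?_ hqε
      gcongr
      have := Finset.mem_range.1 hk
      omega
    have := hC _ hk1
    rw [pow_mul _ 2 q, Real.sq_sqrt (by positivity), mul_pow] at this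
    calc _ ≤ (q.choose k : ℝ) * (C * ((k : ℝ) ^ q * ε ^ q)) := by gcongr
      _ = _ := by ring
  -- Fatou's lemma along `ε = 1 / (n + 1)`.
  let ε : ℕ → ℝ := fun n => 1 / ((n : ℝ) + 1)
  have hε0 : ∀ n, 0 < ε n := fun n => by simp only [ε]; positivity
  have hεlim : Tendsto ε atTop (𝓝 0) := tendsto_one_div_add_atTop_nhds_zero_nat
  let f : ℕ → I → ENNReal := fun n r => ENNReal.ofReal (((1 - (r : ℝ) ^ ε n) / ε n) ^ q)
  have hfm : ∀ n, Measurable (f n) := fun n => by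
    have : Continuous fun r : I => (r : ℝ) ^ ε n :=
      (Real.continuous_rpow_const (hε0 n).le).comp continuous_subtype_val
    simp only [f]
    fun_prop
  have hpt : ∀ r : I, ENNReal.ofReal ((-Real.log (r : ℝ)) ^ q) ≤ liminf (fun n => f n r) atTop := by
    intro r
    rcases eq_or_lt_of_le r.2.1 with h0 | h0
    · rw [← h0]; simp [hq]
    · have hl : Tendsto (fun n => (1 - (r : ℝ) ^ ε n) / ε n) atTop (𝓝 (-Real.log (r : ℝ))) := by
        have h1 : Tendsto ε atTop (𝓝[>] 0) :=
          tendsto_nhdsWithin_iff.2 ⟨hεlim, Eventually.of_forall hε0⟩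
        exact (((tendsto_rpow_sub_one_log h0).comp h1).neg).congr fun n => by
          simp only [Function.comp_apply]; ring
      exact ((ENNReal.continuous_ofReal.tendsto _).comp (hl.pow q)).liminf_eq.ge
  refine lt_of_le_of_lt ((lintegral_mono hpt).trans (lintegral_liminf_le hfm)) ?_
  refine lt_of_le_of_lt (b := ENNReal.ofReal C') ?_ ENNReal.ofReal_lt_top
  refine liminf_le_of_frequently_le' (Eventually.frequently ?_)
  have hev : ∀ᶠ n in atTop, q * ε n ≤ 1 := by
    have : Tendsto (fun n => q * ε n) atTop (𝓝 0) := by simpa using hεlim.const_mul (q : ℝ)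
    filter_upwards [this.eventually (gt_mem_nhds one_pos)] with n hn using hn.le
  filter_upwards [hev] with n hn
  have hnn : ∀ r : I, 0 ≤ ((1 - (r : ℝ) ^ ε n) / ε n) ^ q := fun r =>
    pow_nonneg (div_nonneg (sub_nonneg.2 (Real.rpow_le_one r.2.1 r.2.2 (hε0 n).le)) (hε0 n).le) q
  have hcont : Continuous fun r : I => ((1 - (r : ℝ) ^ ε n) / ε n) ^ q := by
    have : Continuous fun r : I => (r : ℝ) ^ ε n :=
      (Real.continuous_rpow_const (hε0 n).le).comp continuous_subtype_val
    fun_prop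
  simp only [f]
  rw [← ofReal_integral_eq_lintegral_ofReal (hcont.integrable_of_hasCompactSupport
    (HasCompactSupport.of_compactSpace _)) (ae_of_all _ hnn)]
  refine ENNReal.ofReal_le_ofReal ?_
  simp only [div_pow]
  rw [integral_div, div_le_iff₀ (pow_pos (hε0 n) q)]
  exact hD _ (hε0 n) hn

end Moments

section TraceMeasure

open unitInterval MeasureTheory

variable {H : Type*} [NormedAddCommGroup H] [InnerProductSpace ℂ H] [CompleteSpace H]

theorem IsRadialOperator.zero_nonneg {H : Type*} [NormedAddCommGroup H] [InnerProductSpace ℂ H]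
    {F : ℝ≥0 → H →L[ℂ] H} (hF : IsRadialOperator F) : 0 ≤ F 0 := by
  have h : sqrtFun F 0 = F 0 := by simp [sqrtFun]
  rw [← h, nonneg_iff_forall_inner]
  exact fun v => (hF.posDef v).nonneg le_rfl

/-- The norm of a positive operator is at most its trace. -/
theorem ofReal_norm_le_tsum_inner {T : H →L[ℂ] H} (hT : 0 ≤ T) {ι : Type*}
    (b : HilbertBasis ι ℂ H) :
    ENNReal.ofReal ‖T‖ ≤ ∑' i, ENNReal.ofReal (inner ℂ (b i) (T (b i))).re := by
  by_cases hfin : ∑' i, ENNReal.ofReal (inner ℂ (b i) (T (b i))).re = ⊤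
  · rw [hfin]; exact le_top
  obtain ⟨S, rfl⟩ := CStarAlgebra.nonneg_iff_eq_star_mul_self.1 hT
  have hS : ∀ i, (inner ℂ (b i) ((star S * S) (b i))).re = ‖S (b i)‖ ^ 2 := fun i => by
    rw [mul_apply_eq_comp, ContinuousLinearMap.star_eq_adjoint,
      ContinuousLinearMap.adjoint_inner_right, inner_self_eq_norm_sq_to_K]
    norm_cast
  simp only [hS] at hfin ⊢
  have hsum : Summable fun i => ‖S (b i)‖ ^ 2 := by
    have := ENNReal.summable_toReal hfin
    simpa [ENNReal.toReal_ofReal] using this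
  rw [← ENNReal.ofReal_tsum_of_nonneg (fun i => by positivity) hsum]
  refine ENNReal.ofReal_le_ofReal ?_
  rw [CStarRing.norm_star_mul_self, ← sq, ← norm_star S, ContinuousLinearMap.star_eq_adjoint]
  set t := ∑' i, ‖S (b i)‖ ^ 2
  have ht : 0 ≤ t := tsum_nonneg fun i => by positivity
  rw [← Real.le_sqrt (norm_nonneg _) ht]
  refine ContinuousLinearMap.opNorm_le_bound _ (Real.sqrt_nonneg _) fun v => ?_
  rw [← sq_le_sq₀ (norm_nonneg _) (by positivity), mul_pow, Real.sq_sqrt ht]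
  have hP := b.hasSum_inner_mul_inner (ContinuousLinearMap.adjoint S v)
    (ContinuousLinearMap.adjoint S v)
  have hP' : HasSum (fun i => ‖inner ℂ (S (b i)) v‖ ^ 2) (‖ContinuousLinearMap.adjoint S v‖ ^ 2) := by
    have h2 := Complex.hasSum_re hP
    rw [inner_self_eq_norm_sq_to_K] at h2
    convert h2 using 1
    · ext i
      rw [← inner_conj_symm (ContinuousLinearMap.adjoint S v) (b i),
        ContinuousLinearMap.adjoint_inner_right, mul_comm, Complex.mul_conj,
        Complex.normSq_eq_norm_sq, Complex.ofReal_re]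
    · norm_cast
  refine hasSum_le (fun i => ?_) hP' (hsum.hasSum.mul_right (‖v‖ ^ 2))
  rw [← mul_pow]
  exact pow_le_pow_left₀ (norm_nonneg _) (norm_inner_le_norm _ _) 2

variable {F : ℝ≥0 → H →L[ℂ] H}

/-- The measure representing the calculus of `F` in the state `v`. -/
noncomputable def IsRadialOperator.measure (hF : IsRadialOperator F) (v : H) : Measure I :=
  (hF.exists_measure v).choose

instance (hF : IsRadialOperator F) (v : H) : IsFiniteMeasure (hF.measure v) :=
  (hF.exists_measure v).choose_spec.1

theorem IsRadialOperator.measure_zero (hF : IsRadialOperator F) (v : H) : hF.measure v {0} = 0 :=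
  (hF.exists_measure v).choose_spec.2.1

theorem IsRadialOperator.inner_calculus (hF : IsRadialOperator F) (v : H) (f : C(I, ℝ)) :
    inner ℂ v (radialCalculus F f v) = ((∫ r, f r ∂(hF.measure v) : ℝ) : ℂ) :=
  (hF.exists_measure v).choose_spec.2.2 f

theorem IsRadialOperator.inner_sqrtFun (hF : IsRadialOperator F) (v : H) (t : ℝ≥0) :
    inner ℂ v (sqrtFun F t v) = ((∫ r : I, (r : ℝ) ^ (t : ℝ) ∂(hF.measure v) : ℝ) : ℂ) := by
  rw [← hF.calculus_rpowMap, hF.inner_calculus]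
  rfl

/-- The sum of the measures of the vectors of an orthonormal basis. -/
noncomputable def IsRadialOperator.traceMeasure (hF : IsRadialOperator F) : Measure I :=
  Measure.sum fun i => hF.measure (basis H i)

theorem IsRadialOperator.isFiniteMeasure_traceMeasure (hF : IsRadialOperator F)
    (htr : IsTraceClass (F 0)) : IsFiniteMeasure hF.traceMeasure := by
  constructor
  rw [traceMeasure, Measure.sum_apply _ MeasurableSet.univ]
  rw [IsTraceClass, CFC.abs_of_nonneg _ hF.zero_nonneg] at htr
  have h : ∀ i, hF.measure (basis H i) Set.univ =
      ENNReal.ofReal (inner ℂ (basis H i) (F 0 (basis H i))).re := by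
    intro i
    have h0 : sqrtFun F (0 : ℝ≥0) = F 0 := by simp [sqrtFun]
    rw [← h0, hF.inner_sqrtFun, Complex.ofReal_re]
    simp [measureReal_def]
  simp only [h]
  have h2 : Summable fun i => (inner ℂ (basis H i) (F 0 (basis H i))).re :=
    (Complex.hasSum_re htr.hasSum).summable
  exact h2.tsum_ofReal_lt_top

theorem IsRadialOperator.trace_sqrtFun (hF : IsRadialOperator F) (htr : IsTraceClass (F 0))
    (t : ℝ≥0) :
    trace (sqrtFun F t) = ((∫ r : I, (r : ℝ) ^ (t : ℝ) ∂hF.traceMeasure : ℝ) : ℂ) := by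
  have := hF.isFiniteMeasure_traceMeasure htr
  have hint : Integrable (fun r : I => (r : ℝ) ^ (t : ℝ)) hF.traceMeasure :=
    (rpowMap t).continuous.integrable_of_hasCompactSupport (HasCompactSupport.of_compactSpace _)
  have h := hasSum_integral_measure (μ := fun i => hF.measure (basis H i)) hint
  rw [trace]
  simp only [hF.inner_sqrtFun]
  rw [← Complex.ofReal_tsum, h.tsum_eq]
  rfl

theorem IsRadialOperator.lintegral_traceMeasure_lt_top (hF : IsRadialOperator F)
    (htr : IsTraceClass (F 0)) {q : ℕ}
    (hCq : ContDiff ℝ (2 * q : ℕ) fun t : ℝ => trace (F ‖t‖₊)) :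
    ∫⁻ r, ENNReal.ofReal ((-Real.log (r : ℝ)) ^ q) ∂hF.traceMeasure < ⊤ := by
  have := hF.isFiniteMeasure_traceMeasure htr
  refine lintegral_negLog_pow_lt_top _
    (g := fun t => (trace (F ‖t‖₊)).re) (Complex.reCLM.contDiff.comp hCq) fun t => ?_
  have h : F ‖t‖₊ = sqrtFun F ((‖t‖₊ ^ 2 : ℝ≥0) : ℝ) := by
    rw [NNReal.coe_pow, coe_nnnorm, sqrtFun_sq_norm F t]
  rw [h, hF.trace_sqrtFun htr]
  simp

end TraceMeasure

/-! ### The Fourier density of a radial operator kernel -/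

section

open unitInterval MeasureTheory
open scoped FourierTransform

variable {V : Type*} [NormedAddCommGroup V] [InnerProductSpace ℝ V] [MeasurableSpace V]
  [BorelSpace V]

theorem measurable_gaussDensity_negLog :
    Measurable fun p : V × I => gaussDensity (-Real.log (p.2 : ℝ)) p.1 := by
  unfold gaussDensity
  fun_prop

theorem tendsto_fourier_cocompact {E : Type*} [NormedAddCommGroup E] [NormedSpace ℂ E]
    [FiniteDimensional ℝ V] (f : V → E) :
    Tendsto (𝓕 f) (cocompact V) (𝓝 0) :=
  tendsto_integral_exp_inner_smul_cocompact f

theorem inner_fourier_apply {H : Type*} [NormedAddCommGroup H] [InnerProductSpace ℂ H]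
    [CompleteSpace H] [FiniteDimensional ℝ V] {T : V → H →L[ℂ] H} (hT : Integrable T) (x : V) (u v : H) :
    inner ℂ u (𝓕 T x v) = ∫ w : V, Complex.exp (↑(-2 * Real.pi * inner ℝ w x) * Complex.I) •
      inner ℂ u (T w v) := by
  let L : (H →L[ℂ] H) →L[ℂ] ℂ := (innerSL ℂ u).comp (ContinuousLinearMap.apply ℂ H v)
  have hL : ∀ T, L T = inner ℂ u (T v) := fun T => rfl
  rw [← hL, Real.fourier_eq', ← L.integral_comp_comm]
  · simp only [hL, smul_apply, inner_smul_right, smul_eq_mul]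
  · refine hT.norm.mono' (AEStronglyMeasurable.smul
      (by fun_prop : Continuous fun w : V =>
        Complex.exp (↑(-2 * Real.pi * inner ℝ w x) * Complex.I)).aestronglyMeasurable
        hT.aestronglyMeasurable) (ae_of_all _ fun w => ?_)
    rw [norm_smul, Complex.norm_exp_ofReal_mul_I, one_mul]

end

section Density

open unitInterval MeasureTheory
open scoped FourierTransform

variable {H : Type*} [NormedAddCommGroup H] [InnerProductSpace ℂ H] [CompleteSpace H]
  {F : ℝ≥0 → H →L[ℂ] H}
  {V : Type*} [NormedAddCommGroup V] [InnerProductSpace ℝ V] [Nontrivial V]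
  [FiniteDimensional ℝ V]

/-- The operator valued Fourier density `∫ gaussDensity s w dμ(s)` of `x ↦ F ‖x‖`; for `w ≠ 0` it
is a bounded operator because the Gaussian density extends continuously to `s ∈ [0, ∞]`. -/
noncomputable def fourierDensity (F : ℝ≥0 → H →L[ℂ] H) (w : V) : H →L[ℂ] H :=
  radialCalculus F (gaussMap w)

theorem continuousOn_fourierDensity : ContinuousOn (fourierDensity (V := V) F) {0}ᶜ :=
  (radialCalculus F).continuous.comp_continuousOn continuousOn_gaussMap

theorem IsRadialOperator.fourierDensity_nonneg (hF : IsRadialOperator F) (w : V) :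
    0 ≤ fourierDensity F w :=
  hF.calculus_nonneg (gaussMap_nonneg w)

theorem IsRadialOperator.inner_fourierDensity (hF : IsRadialOperator F) {w : V} (hw : w ≠ 0)
    (v : H) : inner ℂ v (fourierDensity F w v) =
      ((∫ r : I, gaussDensity (-Real.log (r : ℝ)) w ∂hF.measure v : ℝ) : ℂ) := by
  rw [fourierDensity, hF.inner_calculus]
  simp only [gaussMap_apply hw]

theorem gaussDensity_zero (w : V) : gaussDensity 0 w = 0 := by
  have : (Module.finrank ℝ V / 2 : ℝ) ≠ 0 := by
    have := Module.finrank_pos (R := ℝ) (M := V)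
    positivity
  simp [gaussDensity, Real.zero_rpow this]

theorem coe_gaussMap {w : V} (hw : w ≠ 0) :
    ⇑(gaussMap w) = fun r : I => gaussDensity (-Real.log (r : ℝ)) w :=
  funext (gaussMap_apply hw)

theorem integrable_gaussDensity_negLog (w : V) (hw : w ≠ 0) (ν : Measure I) [IsFiniteMeasure ν] :
    Integrable (fun r : I => gaussDensity (-Real.log (r : ℝ)) w) ν := by
  rw [← coe_gaussMap hw]
  exact (gaussMap w).continuous.integrable_of_hasCompactSupport
    (HasCompactSupport.of_compactSpace _)

/-- If all the functions `t ↦ ⟨F(t) v, v⟩`, `v ≠ 0`, are nonconstant, then the Fourier density has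
dense range at every nonzero frequency. -/
theorem IsRadialOperator.denseRange_fourierDensity (hF : IsRadialOperator F)
    (hnc : ∀ v : H, v ≠ 0 → ¬ ∃ c : ℂ, ∀ t : ℝ≥0, inner ℂ v (F t v) = c) {w : V} (hw : w ≠ 0) :
    DenseRange (fourierDensity F w) := by
  have hpos := (ContinuousLinearMap.nonneg_iff_isPositive _).1 (hF.fourierDensity_nonneg w)
  have hinj : ∀ v : H, fourierDensity F w v = 0 → v = 0 := by
    intro v hv
    by_contra hv0
    refine hnc v hv0 ⟨((∫ r : I, 1 ∂hF.measure v : ℝ) : ℂ), fun t => ?_⟩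
    have h := hF.inner_fourierDensity hw v
    rw [hv, inner_zero_right, eq_comm, Complex.ofReal_eq_zero, integral_eq_zero_iff_of_nonneg
      (fun r => gaussDensity_nonneg (negLog_nonneg r) w)
      (integrable_gaussDensity_negLog w hw _)] at h
    have h0 : ∀ᵐ r : I ∂hF.measure v, r ≠ 0 := by
      rw [ae_iff]; simpa using hF.measure_zero v
    have h1 : ∀ᵐ r : I ∂hF.measure v, r = 1 := by
      filter_upwards [h, h0] with r hr hr0
      by_contra hr1
      exact (gaussDensity_pos (negLog_pos hr0 hr1) w).ne' hr
    have e : F t = sqrtFun F ((t ^ 2 : ℝ≥0) : ℝ) := by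
      simp [sqrtFun, Real.toNNReal_pow]
    rw [e, hF.inner_sqrtFun]
    congr 1
    refine integral_congr_ae ?_
    filter_upwards [h1] with r hr
    simp [hr]
  have hker : (LinearMap.range (fourierDensity F w).toLinearMap)ᗮ = ⊥ := by
    rw [Submodule.eq_bot_iff]
    intro v hv
    refine hinj v (ext_inner_left ℂ fun u => ?_)
    rw [← hpos.inner_left_eq_inner_right, inner_zero_right]
    exact (Submodule.mem_orthogonal _ _).1 hv _ ⟨u, rfl⟩
  have := (Submodule.topologicalClosure_eq_top_iff).2 hker
  rw [DenseRange, dense_iff_closure_eq]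
  have h2 := congrArg (fun S : Submodule ℂ H => (S : Set H)) this
  simpa using! h2

variable [MeasurableSpace V] [BorelSpace V]

theorem aestronglyMeasurable_of_continuousOn_compl_zero {E : Type*} [TopologicalSpace E]
    [TopologicalSpace.PseudoMetrizableSpace E] {f : V → E} (hf : ContinuousOn f {0}ᶜ) :
    AEStronglyMeasurable f (volume : Measure V) := by
  have h := hf.aestronglyMeasurable_of_isSeparable (μ := volume)
    (measurableSet_singleton (0 : V)).compl
    (TopologicalSpace.IsSeparable.of_separableSpace _)
  rwa [Measure.restrict_eq_self_of_ae_mem] at h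
  rw [ae_iff]
  simp

theorem ae_ne_zero : ∀ᵐ w : V, w ≠ 0 := by
  rw [ae_iff]
  simp

/-- The trace bounds the norm, so the Fourier density inherits the moments of the trace measure. -/
theorem IsRadialOperator.lintegral_norm_fourierDensity_lt_top (hF : IsRadialOperator F)
    (htr : IsTraceClass (F 0)) {q : ℕ}
    (hCq : ContDiff ℝ (2 * q : ℕ) fun t : ℝ => trace (F ‖t‖₊)) {k : ℕ} (hk : k ≤ q) :
    ∫⁻ w : V, ENNReal.ofReal (‖w‖ ^ (2 * k) * ‖fourierDensity F w‖) < ⊤ := by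
  have := hF.isFiniteMeasure_traceMeasure htr
  obtain ⟨C, hC, hCs⟩ := exists_lintegral_pow_mul_gaussDensity_le (V := V) k
  have hmeas : Measurable fun p : V × I =>
      ENNReal.ofReal (‖p.1‖ ^ (2 * k) * gaussDensity (-Real.log (p.2 : ℝ)) p.1) := by
    have := measurable_gaussDensity_negLog (V := V)
    fun_prop
  have h1 : ∀ᵐ w : V, ENNReal.ofReal (‖w‖ ^ (2 * k) * ‖fourierDensity F w‖) ≤
      ∫⁻ r : I, ENNReal.ofReal (‖w‖ ^ (2 * k) * gaussDensity (-Real.log (r : ℝ)) w)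
        ∂hF.traceMeasure := by
    filter_upwards [ae_ne_zero] with w hw
    have hc : Continuous fun r : I => gaussDensity (-Real.log (r : ℝ)) w := by
      rw [← coe_gaussMap hw]
      exact (gaussMap w).continuous
    simp only [ENNReal.ofReal_mul (show 0 ≤ ‖w‖ ^ (2 * k) by positivity)]
    rw [lintegral_const_mul _ hc.measurable.ennreal_ofReal]
    gcongr
    refine (ofReal_norm_le_tsum_inner (hF.fourierDensity_nonneg w) (basis H)).trans ?_
    rw [traceMeasure, lintegral_sum_measure]
    refine ENNReal.tsum_le_tsum fun i => ?_
    rw [hF.inner_fourierDensity hw, Complex.ofReal_re, ofReal_integral_eq_lintegral_ofReal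
      (integrable_gaussDensity_negLog w hw _)
      (ae_of_all _ fun r => gaussDensity_nonneg (negLog_nonneg r) w)]
  refine lt_of_le_of_lt (lintegral_mono_ae h1) ?_
  rw [lintegral_lintegral_swap hmeas.aemeasurable]
  have h2 : ∀ r : I, ∫⁻ w : V, ENNReal.ofReal
      (‖w‖ ^ (2 * k) * gaussDensity (-Real.log (r : ℝ)) w) ≤
      ENNReal.ofReal C * (1 + ENNReal.ofReal ((-Real.log (r : ℝ)) ^ q)) := by
    intro r
    rcases (negLog_nonneg r).eq_or_lt with h0 | h0
    · rw [← h0]; simp [gaussDensity_zero]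
    · refine (hCs _ h0).trans ?_
      rw [← ENNReal.ofReal_one, ← ENNReal.ofReal_add zero_le_one (by positivity),
        ← ENNReal.ofReal_mul hC]
      refine ENNReal.ofReal_le_ofReal ?_
      gcongr
      rcases le_total (-Real.log (r : ℝ)) 1 with h1 | h1
      · have := pow_le_one₀ (n := k) h0.le h1
        have : 0 ≤ (-Real.log (r : ℝ)) ^ q := by positivity
        linarith
      · have := pow_le_pow_right₀ h1 hk
        linarith
  refine lt_of_le_of_lt (lintegral_mono h2) ?_
  rw [lintegral_const_mul _ (by fun_prop), lintegral_add_left (by fun_prop)]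
  refine ENNReal.mul_lt_top ENNReal.ofReal_lt_top (ENNReal.add_lt_top.2 ⟨?_, ?_⟩)
  · simp
  · exact hF.lintegral_traceMeasure_lt_top htr hCq

theorem IsRadialOperator.integrable_pow_mul_fourierDensity (hF : IsRadialOperator F)
    (htr : IsTraceClass (F 0)) {q : ℕ}
    (hCq : ContDiff ℝ (2 * q : ℕ) fun t : ℝ => trace (F ‖t‖₊)) {n : ℕ} (hn : n ≤ 2 * q) :
    Integrable fun w : V => ‖w‖ ^ n * ‖fourierDensity F w‖ := by
  have hm : AEStronglyMeasurable (fourierDensity (V := V) F) volume :=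
    aestronglyMeasurable_of_continuousOn_compl_zero continuousOn_fourierDensity
  have h : ∀ k ≤ q, Integrable fun w : V => ‖w‖ ^ (2 * k) * ‖fourierDensity F w‖ := fun k hk => by
    refine ⟨(by fun_prop : AEStronglyMeasurable (fun w : V => ‖w‖ ^ (2 * k)) volume).mul hm.norm,
      ?_⟩
    rw [hasFiniteIntegral_iff_ofReal (ae_of_all _ fun w => by positivity)]
    exact hF.lintegral_norm_fourierDensity_lt_top htr hCq hk
  refine ((h 0 (Nat.zero_le q)).add (h q le_rfl)).mono'
    ((by fun_prop : AEStronglyMeasurable (fun w : V => ‖w‖ ^ n) volume).mul hm.norm)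
    (ae_of_all _ fun w => ?_)
  rw [Real.norm_of_nonneg (by positivity)]
  simp only [Pi.add_apply, ← add_mul]
  gcongr
  rcases le_total ‖w‖ 1 with h1 | h1
  · have := pow_le_one₀ (n := n) (norm_nonneg w) h1
    have : 0 ≤ ‖w‖ ^ (2 * q) := by positivity
    simp
    linarith
  · have := pow_le_pow_right₀ h1 hn
    simp
    linarith

/-- The part of `F` concentrated at frequency `0`. -/
noncomputable def constPart (V : Type*) [NormedAddCommGroup V] [InnerProductSpace ℝ V]
    [Nontrivial V] [FiniteDimensional ℝ V] [MeasurableSpace V] [BorelSpace V]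
    (F : ℝ≥0 → H →L[ℂ] H) : H →L[ℂ] H := F 0 - 𝓕 (fourierDensity (V := V) F) 0

/-- The Fourier transform of a mixture of Gaussian densities. The part of `ν` at `r = 1`, that is at
`s = 0`, has no density and is lost. -/
theorem integral_exp_smul_integral_gaussDensity (ν : Measure I) [IsFiniteMeasure ν]
    (hν : ν {0} = 0) (x : V) :
    ∫ w : V, Complex.exp (↑(-2 * Real.pi * inner ℝ w x) * Complex.I) •
        ((∫ r : I, gaussDensity (-Real.log (r : ℝ)) w ∂ν : ℝ) : ℂ) =
      ((∫ r : I, (r : ℝ) ^ (‖x‖ ^ 2) ∂ν : ℝ) : ℂ) - ν.real {1} := by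
  have hprod : Integrable (fun p : V × I => gaussDensity (-Real.log (p.2 : ℝ)) p.1)
      (volume.prod ν) := by
    refine ⟨measurable_gaussDensity_negLog.aestronglyMeasurable, ?_⟩
    have hnn : ∀ p : V × I, 0 ≤ gaussDensity (-Real.log (p.2 : ℝ)) p.1 := fun p =>
      gaussDensity_nonneg (negLog_nonneg p.2) p.1
    rw [hasFiniteIntegral_iff_ofReal (ae_of_all _ hnn),
      lintegral_prod_symm _ measurable_gaussDensity_negLog.ennreal_ofReal.aemeasurable]
    refine lt_of_le_of_lt (lintegral_mono (g := fun _ => 1) fun r => ?_) (by simp)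
    rcases (negLog_nonneg r).eq_or_lt with h0 | h0
    · simp [← h0, gaussDensity_zero]
    · exact (lintegral_gaussDensity h0).le
  obtain ⟨e, he⟩ : ∃ e : V → ℂ, e = fun w : V =>
    Complex.exp (↑(-2 * Real.pi * inner ℝ w x) * Complex.I) := ⟨_, rfl⟩
  have hec : Continuous e := by rw [he]; fun_prop
  have hen : ∀ w, ‖e w‖ = 1 := fun w => by rw [he]; exact Complex.norm_exp_ofReal_mul_I _
  let f : V → I → ℂ := fun w r => e w • ((gaussDensity (-Real.log (r : ℝ)) w : ℝ) : ℂ)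
  have hfint : Integrable (Function.uncurry f) (volume.prod ν) := by
    have h2 := hprod.ofReal (𝕜 := ℂ)
    refine h2.mono ((hec.comp continuous_fst).aestronglyMeasurable.smul h2.aestronglyMeasurable)
      (ae_of_all _ fun p => ?_)
    simp only [f, Function.uncurry_def, norm_smul, hen, one_mul]
    exact le_rfl
  have hfr : ∀ r : I, ∫ w, f w r =
      if r = 0 ∨ r = 1 then 0 else (((r : ℝ) ^ (‖x‖ ^ 2) : ℝ) : ℂ) := by
    intro r
    split_ifs with h
    · have h0 : -Real.log (r : ℝ) = 0 := by rcases h with h | h <;> simp [h]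
      simp [f, h0, gaussDensity_zero]
    · push Not at h
      have hs := negLog_pos h.1 h.2
      have h2 := fourier_gaussDensity hs x
      rw [Real.fourier_eq'] at h2
      simp only [f, he]
      rw [h2, neg_neg, Real.rpow_def_of_pos (lt_of_le_of_ne r.2.1 fun h0 =>
        h.1 (Subtype.ext h0.symm))]
  have hrpow : Integrable (fun r : I => (r : ℝ) ^ (‖x‖ ^ 2)) ν :=
    ((Real.continuous_rpow_const (by positivity)).comp
      continuous_subtype_val).integrable_of_hasCompactSupport (HasCompactSupport.of_compactSpace _)
  calc _ = ∫ w : V, ∫ r, f w r ∂ν := by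
        refine integral_congr_ae (ae_of_all _ fun w => ?_)
        simp only [f, he]
        rw [integral_smul, integral_complex_ofReal]
    _ = ∫ r, (∫ w : V, f w r) ∂ν := integral_integral_swap hfint
    _ = ∫ r : I, ((((r : ℝ) ^ (‖x‖ ^ 2) - Set.indicator {1} 1 r : ℝ)) : ℂ) ∂ν := by
        have h0 : ∀ᵐ r : I ∂ν, r ≠ 0 := by
          rw [ae_iff]; simpa using hν
        refine integral_congr_ae ?_
        filter_upwards [h0] with r hr
        rw [hfr]
        by_cases h1 : r = 1
        · simp [h1]
        · simp [h1, hr]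
    _ = _ := by
        have hind : Integrable (Set.indicator {(1 : I)} (1 : I → ℝ)) ν :=
          (integrable_const 1).indicator (measurableSet_singleton 1)
        rw [integral_complex_ofReal, integral_sub hrpow hind,
          integral_indicator_one (measurableSet_singleton 1), Complex.ofReal_sub]

theorem IsRadialOperator.inner_fourier_fourierDensity (hF : IsRadialOperator F)
    (hint : Integrable (fourierDensity (V := V) F)) (x : V) (v : H) :
    inner ℂ v (𝓕 (fourierDensity (V := V) F) x v) =
      inner ℂ v (F ‖x‖₊ v) - (hF.measure v).real {1} := by
  have e : F ‖x‖₊ = sqrtFun F ((‖x‖₊ ^ 2 : ℝ≥0) : ℝ) := by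
    rw [NNReal.coe_pow, coe_nnnorm, sqrtFun_sq_norm F x]
  rw [inner_fourier_apply hint, e, hF.inner_sqrtFun, NNReal.coe_pow, coe_nnnorm,
    ← integral_exp_smul_integral_gaussDensity _ (hF.measure_zero v)]
  refine integral_congr_ae ?_
  filter_upwards [ae_ne_zero] with w hw
  rw [hF.inner_fourierDensity hw]

theorem IsRadialOperator.inner_constPart (hF : IsRadialOperator F)
    (hint : Integrable (fourierDensity (V := V) F)) (v : H) :
    inner ℂ v (constPart V F v) = (hF.measure v).real {1} := by
  have h := hF.inner_fourier_fourierDensity hint 0 v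
  rw [nnnorm_zero] at h
  rw [constPart, sub_apply, inner_sub_right, h]
  ring

theorem IsRadialOperator.constPart_nonneg (hF : IsRadialOperator F)
    (hint : Integrable (fourierDensity (V := V) F)) : 0 ≤ constPart V F := by
  rw [nonneg_iff_forall_inner]
  intro v
  rw [hF.inner_constPart hint]
  exact_mod_cast measureReal_nonneg

/-- The operator form of the representation of a radial kernel as a Fourier integral. -/
theorem IsRadialOperator.eq_constPart_add (hF : IsRadialOperator F)
    (hint : Integrable (fourierDensity (V := V) F)) (x : V) :
    F ‖x‖₊ = constPart V F + 𝓕 (fourierDensity (V := V) F) x := by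
  have h : (F ‖x‖₊).toLinearMap = (constPart V F + 𝓕 (fourierDensity (V := V) F) x).toLinearMap := by
    rw [← ext_inner_map]
    intro v
    rw [← inner_conj_symm, ← inner_conj_symm _ v]
    congr 1
    simp only [ContinuousLinearMap.coe_coe, add_apply, inner_add_right]
    rw [hF.inner_constPart hint, hF.inner_fourier_fourierDensity hint]
    ring
  exact ContinuousLinearMap.coe_injective h

end Density

/-! ### The reproducing kernel Hilbert space of a Fourier kernel -/

section PositiveOperators

variable {H : Type*} [NormedAddCommGroup H] [InnerProductSpace ℂ H] [CompleteSpace H]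

/-- The Cauchy-Schwarz inequality for the form of a positive operator. -/
theorem norm_inner_apply_sq_le {T : H →L[ℂ] H} (hT : 0 ≤ T) (u v : H) :
    ‖inner ℂ u (T v)‖ ^ 2 ≤ (inner ℂ u (T u)).re * (inner ℂ v (T v)).re := by
  obtain ⟨S, rfl⟩ := CStarAlgebra.nonneg_iff_eq_star_mul_self.1 hT
  have hS : ∀ a b, inner ℂ a ((star S * S) b) = inner ℂ (S a) (S b) := fun a b => by
    rw [mul_apply_eq_comp, ContinuousLinearMap.star_eq_adjoint,
      ContinuousLinearMap.adjoint_inner_right]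
  have hS2 : ∀ a, (inner ℂ (S a) (S a)).re = ‖S a‖ ^ 2 := fun a => by
    rw [inner_self_eq_norm_sq_to_K]; norm_cast
  rw [hS, hS, hS, hS2, hS2, ← mul_pow]
  exact pow_le_pow_left₀ (norm_nonneg _) (norm_inner_le_norm _ _) 2

theorem norm_apply_sq_le {T : H →L[ℂ] H} (hT : 0 ≤ T) (v : H) :
    ‖T v‖ ^ 2 ≤ ‖T‖ * (inner ℂ v (T v)).re := by
  obtain ⟨S, rfl⟩ := CStarAlgebra.nonneg_iff_eq_star_mul_self.1 hT
  have hS : (inner ℂ v ((star S * S) v)).re = ‖S v‖ ^ 2 := by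
    rw [mul_apply_eq_comp, ContinuousLinearMap.star_eq_adjoint,
      ContinuousLinearMap.adjoint_inner_right, inner_self_eq_norm_sq_to_K]
    norm_cast
  rw [hS, CStarRing.norm_star_mul_self, ← sq, ← mul_pow, ← norm_star S]
  exact pow_le_pow_left₀ (norm_nonneg _) ((star S).le_opNorm _) 2

omit [CompleteSpace H] in
theorem re_inner_apply_nonneg {T : H →L[ℂ] H} (hT : 0 ≤ T) (v : H) : 0 ≤ (inner ℂ v (T v)).re :=
  (Complex.le_def.1 (nonneg_iff_forall_inner.1 hT v)).1

/-- The Cauchy-Schwarz inequality in linearised form, which can be integrated over a family of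
operators. -/
theorem norm_inner_apply_le {T : H →L[ℂ] H} (hT : 0 ≤ T) (u v : H) {t : ℝ} (ht : 0 < t) :
    ‖inner ℂ u (T v)‖ ≤ (t * (inner ℂ u (T u)).re + t⁻¹ * (inner ℂ v (T v)).re) / 2 := by
  have h := norm_inner_apply_sq_le hT u v
  have hu := re_inner_apply_nonneg hT u
  have hv := re_inner_apply_nonneg hT v
  set a := (inner ℂ u (T u)).re
  set b := (inner ℂ v (T v)).re
  refine abs_le_of_sq_le_sq' (b := (t * a + t⁻¹ * b) / 2) ?_ (by positivity) |>.2
  have e : ((t * a + t⁻¹ * b) / 2) ^ 2 - a * b = ((t * a - t⁻¹ * b) / 2) ^ 2 := by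
    field_simp
    ring
  nlinarith [sq_nonneg ((t * a - t⁻¹ * b) / 2)]

theorem mul_norm_apply_le {T : H →L[ℂ] H} (hT : 0 ≤ T) (v : H) (c : ℝ) {t : ℝ}
    (ht : 0 < t) :
    c * ‖T v‖ ≤ (t * (c ^ 2 * ‖T‖) + t⁻¹ * (inner ℂ v (T v)).re) / 2 := by
  have h := norm_apply_sq_le hT v
  have hv := re_inner_apply_nonneg hT v
  set b := (inner ℂ v (T v)).re
  refine abs_le_of_sq_le_sq' (b := (t * (c ^ 2 * ‖T‖) + t⁻¹ * b) / 2) ?_ (by positivity) |>.2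
  have e : ((t * (c ^ 2 * ‖T‖) + t⁻¹ * b) / 2) ^ 2 - c ^ 2 * (‖T‖ * b) =
      ((t * (c ^ 2 * ‖T‖) - t⁻¹ * b) / 2) ^ 2 := by
    field_simp
    ring
  have h2 : (c * ‖T v‖) ^ 2 ≤ c ^ 2 * (‖T‖ * b) := by
    rw [mul_pow]; gcongr
  nlinarith [sq_nonneg ((t * (c ^ 2 * ‖T‖) - t⁻¹ * b) / 2)]

/-- Undoing the linearisation with `t = g`; the additional `1` covers the case `g = 0`. -/
theorem le_mul_of_forall_le {N A g : ℝ} (hg : 0 ≤ g)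
    (h : ∀ t : ℝ, 0 < t → N ≤ (t * A + t⁻¹ * g ^ 2) / 2) : N ≤ (A + 1) / 2 * g := by
  rcases hg.eq_or_lt with rfl | hg
  · simp only [mul_zero]
    refine ge_of_tendsto (f := fun t : ℝ => t * A / 2) (x := 𝓝[>] 0) ?_ ?_
    · have : Tendsto (fun t : ℝ => t * A / 2) (𝓝 0) (𝓝 (0 * A / 2)) := by
        apply Continuous.tendsto; fun_prop
      simpa using this.mono_left nhdsWithin_le_nhds
    · filter_upwards [self_mem_nhdsWithin] with t ht
      simpa using h t ht
  · refine (h g hg).trans_eq ?_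
    field_simp

end PositiveOperators

section FourierKernel

open MeasureTheory
open scoped FourierTransform

variable {H : Type*} [NormedAddCommGroup H] [InnerProductSpace ℂ H] [CompleteSpace H]
  {V : Type*} [NormedAddCommGroup V] [InnerProductSpace ℝ V]
  [FiniteDimensional ℝ V] [MeasurableSpace V] [BorelSpace V]

/-- The kernel `K` is the constant `C ≥ 0` plus the Fourier transform of an integrable density
`h ≥ 0`, taken at `x - y`. -/
structure IsFourierKernel (K : V → V → H →L[ℂ] H) (C : H →L[ℂ] H) (h : V → H →L[ℂ] H) : Prop where
  const_nonneg : 0 ≤ C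
  density_nonneg : ∀ w, 0 ≤ h w
  integrable : Integrable h
  eq_add : ∀ x y, K x y = C + 𝓕 h (x - y)

/-- The function `w ↦ exp (2πi ⟨w, x⟩)`. -/
noncomputable def planeWave (x w : V) : ℂ := Complex.exp (↑(2 * Real.pi * inner ℝ w x) * Complex.I)

omit [FiniteDimensional ℝ V] [MeasurableSpace V] [BorelSpace V] in
theorem norm_planeWave (x w : V) : ‖planeWave x w‖ = 1 := Complex.norm_exp_ofReal_mul_I _

omit [FiniteDimensional ℝ V] [MeasurableSpace V] [BorelSpace V] in
theorem continuous_planeWave (x : V) : Continuous (planeWave x) := by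
  unfold planeWave
  fun_prop

omit [FiniteDimensional ℝ V] [MeasurableSpace V] [BorelSpace V] in
theorem conj_planeWave (x w : V) : (starRingEnd ℂ) (planeWave x w) =
    Complex.exp (↑(-2 * Real.pi * inner ℝ w x) * Complex.I) := by
  rw [planeWave, ← Complex.exp_conj]
  simp [Complex.conj_ofNat]

omit [FiniteDimensional ℝ V] [MeasurableSpace V] [BorelSpace V] in
theorem conj_planeWave_mul (x y w : V) : (starRingEnd ℂ) (planeWave x w) * planeWave y w =
    Complex.exp (↑(-2 * Real.pi * inner ℝ w (x - y)) * Complex.I) := by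
  rw [conj_planeWave, planeWave, ← Complex.exp_add]
  congr 1
  rw [inner_sub_right]
  push_cast
  ring

theorem fourier_eq_integral_planeWave {E : Type*} [NormedAddCommGroup E] [NormedSpace ℂ E]
    (f : V → E) (x : V) : 𝓕 f x = ∫ w, (starRingEnd ℂ) (planeWave x w) • f w := by
  rw [Real.fourier_eq']
  simp only [conj_planeWave]

theorem integrable_planeWave_smul {E : Type*} [NormedAddCommGroup E] [NormedSpace ℂ E]
    {f : V → E} (hf : Integrable f) (x : V) :
    Integrable fun w => (starRingEnd ℂ) (planeWave x w) • f w := by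
  refine hf.norm.mono' (((Complex.continuous_conj.comp
    (continuous_planeWave x)).aestronglyMeasurable).smul hf.aestronglyMeasurable)
    (ae_of_all _ fun w => ?_)
  rw [norm_smul, RCLike.norm_conj, norm_planeWave, one_mul]

variable {K : V → V → H →L[ℂ] H} {C : H →L[ℂ] H} {h : V → H →L[ℂ] H}

omit [CompleteSpace H] in
theorem integrable_apply (hh : Integrable h) {η : V → H} (hη : Continuous η) {B : ℝ}
    (hB : ∀ w, ‖η w‖ ≤ B) : Integrable fun w => h w (η w) := by
  refine (hh.norm.mul_const B).mono'
    (isBoundedBilinearMap_apply.continuous.comp_aestronglyMeasurable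
      (hh.aestronglyMeasurable.prodMk hη.aestronglyMeasurable)) (ae_of_all _ fun w => ?_)
  exact (h w).le_opNorm_of_le (hB w)

omit [CompleteSpace H] in
theorem integrable_inner_apply (hh : Integrable h) {η ζ : V → H} (hη : Continuous η)
    (hζ : Continuous ζ) {B : ℝ} (hB : ∀ w, ‖η w‖ ≤ B) (hB' : ∀ w, ‖ζ w‖ ≤ B) :
    Integrable fun w => inner ℂ (ζ w) (h w (η w)) := by
  refine ((integrable_apply hh hη hB).norm.const_mul B).mono'
    (hζ.aestronglyMeasurable.inner (integrable_apply hh hη hB).aestronglyMeasurable)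
    (ae_of_all _ fun w => ?_)
  refine (norm_inner_le_norm _ _).trans ?_
  gcongr
  exact hB' w

theorem IsFourierKernel.inner_apply (hK : IsFourierKernel K C h) (x y : V) (u v : H) :
    inner ℂ u (K x y v) = inner ℂ u (C v) +
      ∫ w, inner ℂ (planeWave x w • u) (h w (planeWave y w • v)) := by
  rw [hK.eq_add, add_apply, inner_add_right, inner_fourier_apply hK.integrable]
  congr 1
  refine integral_congr_ae (ae_of_all _ fun w => ?_)
  simp only [map_smul, inner_smul_left, inner_smul_right, ← conj_planeWave_mul, smul_eq_mul]
  ring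

/-- The trigonometric polynomial `w ↦ ∑ exp (2πi ⟨w, x⟩) v` of a finite family of pairs
`(x, v)`. -/
noncomputable def trigPoly {ι : Type*} (s : Finset ι) (x : ι → V) (v : ι → H) (w : V) : H :=
  ∑ i ∈ s, planeWave (x i) w • v i

omit [CompleteSpace H] [FiniteDimensional ℝ V] [MeasurableSpace V] [BorelSpace V] in
theorem continuous_trigPoly {ι : Type*} (s : Finset ι) (x : ι → V) (v : ι → H) :
    Continuous (trigPoly s x v) :=
  continuous_finsetSum _ fun i _ => (continuous_planeWave (x i)).smul continuous_const

omit [CompleteSpace H] [FiniteDimensional ℝ V] [MeasurableSpace V] [BorelSpace V] in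
theorem norm_trigPoly_le {ι : Type*} (s : Finset ι) (x : ι → V) (v : ι → H) (w : V) :
    ‖trigPoly s x v w‖ ≤ ∑ i ∈ s, ‖v i‖ :=
  norm_sum_le_of_le _ fun i _ => by rw [norm_smul, norm_planeWave, one_mul]

/-- The kernel form is diagonalised by the Fourier transform. -/
theorem IsFourierKernel.sum_sum_inner (hK : IsFourierKernel K C h) {ι : Type*} (s : Finset ι)
    (x : ι → V) (v : ι → H) :
    ∑ i ∈ s, ∑ j ∈ s, inner ℂ (v i) (K (x i) (x j) (v j)) =
      inner ℂ (∑ i ∈ s, v i) (C (∑ i ∈ s, v i)) +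
        ∫ w, inner ℂ (trigPoly s x v w) (h w (trigPoly s x v w)) := by
  simp only [hK.inner_apply, Finset.sum_add_distrib]
  congr 1
  · simp only [map_sum, sum_inner, inner_sum]
    exact Finset.sum_comm
  · have hint : ∀ i j, Integrable fun w =>
        inner ℂ (planeWave (x i) w • v i) (h w (planeWave (x j) w • v j)) := fun i j =>
      integrable_inner_apply hK.integrable ((continuous_planeWave (x j)).smul continuous_const)
        ((continuous_planeWave (x i)).smul continuous_const) (B := max ‖v i‖ ‖v j‖)
        (fun w => by rw [norm_smul, norm_planeWave, one_mul]; exact le_max_right _ _)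
        (fun w => by rw [norm_smul, norm_planeWave, one_mul]; exact le_max_left _ _)
    simp only [← integral_finsetSum _ fun j _ => hint _ j]
    rw [← integral_finsetSum _ fun i _ => integrable_finsetSum _ fun j _ => hint i j]
    simp only [trigPoly, map_sum, sum_inner, inner_sum]
    exact integral_congr_ae (ae_of_all _ fun w => Finset.sum_comm)

theorem IsFourierKernel.integral_inner_nonneg (hK : IsFourierKernel K C h) {η : V → H} :
    0 ≤ ∫ w, inner ℂ (η w) (h w (η w)) := by
  have e : ∀ w, inner ℂ (η w) (h w (η w)) = (((inner ℂ (η w) (h w (η w))).re : ℝ) : ℂ) := fun w =>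
    Complex.ext (by simp) (by
      simpa using (Complex.le_def.1 (nonneg_iff_forall_inner.1 (hK.density_nonneg w) (η w))).2.symm)
  rw [integral_congr_ae (ae_of_all _ e), integral_complex_ofReal]
  exact_mod_cast integral_nonneg fun w => re_inner_apply_nonneg (hK.density_nonneg w) _

theorem IsFourierKernel.isPosDefKernel (hK : IsFourierKernel K C h) : IsPosDefKernel K := by
  intro n x _ v
  rw [hK.sum_sum_inner Finset.univ x v]
  exact add_nonneg (nonneg_iff_forall_inner.1 hK.const_nonneg _) hK.integral_inner_nonneg

end FourierKernel

section FourierRKHS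

open MeasureTheory
open scoped FourierTransform

variable {H : Type*} [NormedAddCommGroup H] [InnerProductSpace ℂ H] [CompleteSpace H]
  {V : Type*} [NormedAddCommGroup V] [InnerProductSpace ℝ V]
  [FiniteDimensional ℝ V] [MeasurableSpace V] [BorelSpace V]

section

variable {X : Type*} (K : X → X → H →L[ℂ] H) [Fact (Matrix.of K).PosSemidef]

/-- The map `p ↦ ∑ₓ K(·, x) p(x)` from finitely supported functions to the reproducing kernel
Hilbert space. -/
noncomputable def kerSum : (X →₀ H) →ₗ[ℂ] RKHS.OfKernel (Matrix.of K) :=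
  Finsupp.lsum ℂ fun x => (RKHS.kerFun (RKHS.OfKernel (Matrix.of K)) x : H →ₗ[ℂ] _)

theorem kerSum_apply (p : X →₀ H) :
    kerSum K p = ∑ x ∈ p.support, RKHS.kerFun (RKHS.OfKernel (Matrix.of K)) x (p x) := rfl

theorem kerSum_single (x : X) (v : H) :
    kerSum K (Finsupp.single x v) = RKHS.kerFun (RKHS.OfKernel (Matrix.of K)) x v := by
  simp [kerSum]

theorem denseRange_kerSum : DenseRange (kerSum K) := by
  have h := RKHS.kerFun_dense (RKHS.OfKernel (Matrix.of K))
  have hle : Submodule.span ℂ {g | ∃ (x : X) (v : H),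
      RKHS.kerFun (RKHS.OfKernel (Matrix.of K)) x v = g} ≤ LinearMap.range (kerSum K) := by
    rw [Submodule.span_le]
    rintro _ ⟨x, v, rfl⟩
    exact ⟨_, kerSum_single K x v⟩
  have h2 := Submodule.topologicalClosure_mono hle
  rw [h, top_le_iff] at h2
  rw [DenseRange, ← LinearMap.coe_range]
  exact (Submodule.dense_iff_topologicalClosure_eq_top).2 h2

theorem kerSum_coe (p : X →₀ H) (x : X) :
    (kerSum K p) x = ∑ y ∈ p.support, K x y (p y) := by
  rw [← RKHS.coeCLM_apply, kerSum_apply, map_sum, Finset.sum_apply]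
  refine Finset.sum_congr rfl fun y _ => ?_
  rw [RKHS.coeCLM_apply, RKHS.kerFun_apply, RKHS.OfKernel.kernel_ofKernel]
  rfl

theorem norm_kerSum_sq (p : X →₀ H) : (‖kerSum K p‖ : ℂ) ^ 2 =
    ∑ x ∈ p.support, ∑ y ∈ p.support, inner ℂ (p x) (K x y (p y)) := by
  have h := inner_self_eq_norm_sq_to_K (𝕜 := ℂ) (kerSum K p)
  refine h.symm.trans ?_
  nth_rw 1 [kerSum_apply]
  rw [sum_inner]
  refine Finset.sum_congr rfl fun x _ => ?_
  rw [RKHS.kerFun_inner, kerSum_coe, inner_sum]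

end

variable {K : V → V → H →L[ℂ] H} {C : H →L[ℂ] H} {h : V → H →L[ℂ] H}

/-- `p ↦ ∑ₓ exp (2πi ⟨w, x⟩) p(x)`, for finitely supported `p`. -/
noncomputable def trigMap (w : V) : (V →₀ H) →ₗ[ℂ] H :=
  Finsupp.lsum ℂ fun x => planeWave x w • LinearMap.id

omit [CompleteSpace H] [FiniteDimensional ℝ V] [MeasurableSpace V] [BorelSpace V] in
theorem trigMap_eq (p : V →₀ H) (w : V) : trigMap w p = trigPoly p.support id p w := rfl

omit [CompleteSpace H] [FiniteDimensional ℝ V] [MeasurableSpace V] [BorelSpace V] in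
theorem trigMap_single (x : V) (v : H) (w : V) :
    trigMap w (Finsupp.single x v) = planeWave x w • v := by
  simp [trigMap]

omit [CompleteSpace H] [FiniteDimensional ℝ V] [MeasurableSpace V] [BorelSpace V] in
theorem continuous_trigMap (p : V →₀ H) : Continuous fun w => trigMap w p :=
  continuous_trigPoly p.support id p

omit [CompleteSpace H] [FiniteDimensional ℝ V] [MeasurableSpace V] [BorelSpace V] in
theorem norm_trigMap_le (p : V →₀ H) (w : V) : ‖trigMap w p‖ ≤ ∑ x ∈ p.support, ‖p x‖ :=
  norm_trigPoly_le p.support id p w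

theorem fourier_apply (hh : Integrable h) (x : V) (v : H) :
    𝓕 h x v = 𝓕 (fun w => h w v) x := by
  rw [fourier_eq_integral_planeWave, fourier_eq_integral_planeWave,
    ContinuousLinearMap.integral_apply (integrable_planeWave_smul hh x)]
  rfl

variable [Fact (Matrix.of K).PosSemidef]

theorem IsFourierKernel.kerSum_coe (hK : IsFourierKernel K C h) (p : V →₀ H) (x : V) :
    kerSum K p x = C (∑ y ∈ p.support, p y) + 𝓕 (fun w => h w (trigMap w p)) x := by
  simp only [OpKernel.kerSum_coe, hK.eq_add, add_apply, Finset.sum_add_distrib, map_sum]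
  congr 1
  have hint : ∀ y ∈ p.support, Integrable fun w =>
      (starRingEnd ℂ) (planeWave x w) • h w (planeWave y w • p y) := fun y _ =>
    integrable_planeWave_smul (integrable_apply hK.integrable (η := fun w => planeWave y w • p y)
      ((continuous_planeWave y).smul continuous_const) (B := ‖p y‖)
      fun w => by rw [norm_smul, norm_planeWave, one_mul]) x
  rw [fourier_eq_integral_planeWave]
  simp only [trigMap_eq, trigPoly, map_sum, Finset.smul_sum, id]
  rw [integral_finsetSum _ hint]
  refine Finset.sum_congr rfl fun y _ => ?_
  refine (fourier_apply hK.integrable (x - y) (p y)).trans ?_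
  rw [Real.fourier_eq']
  refine integral_congr_ae (ae_of_all _ fun w => ?_)
  simp only [map_smul, smul_smul, conj_planeWave_mul]

/-- The norm of the reproducing kernel Hilbert space in Fourier variables. -/
theorem IsFourierKernel.norm_kerSum_sq (hK : IsFourierKernel K C h) (p : V →₀ H) :
    ‖kerSum K p‖ ^ 2 = (inner ℂ (∑ y ∈ p.support, p y) (C (∑ y ∈ p.support, p y))).re +
      ∫ w, (inner ℂ (trigMap w p) (h w (trigMap w p))).re := by
  have e := congrArg Complex.re (OpKernel.norm_kerSum_sq K p)
  have e2 := hK.sum_sum_inner p.support id p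
  simp only [id] at e2
  rw [e2, Complex.add_re, ← Complex.ofReal_pow, Complex.ofReal_re] at e
  rw [e]
  congr 1
  refine (integral_re (𝕜 := ℂ) (integrable_inner_apply hK.integrable
    (continuous_trigPoly p.support id p) (continuous_trigPoly p.support id p)
    (norm_trigPoly_le p.support id p) (norm_trigPoly_le p.support id p))).symm

omit [CompleteSpace H] in
theorem integrable_re_inner_trigMap (hh : Integrable h) (p : V →₀ H) :
    Integrable fun w => (inner ℂ (trigMap w p) (h w (trigMap w p))).re :=
  (integrable_inner_apply hh (continuous_trigMap p) (continuous_trigMap p)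
    (norm_trigMap_le p) (norm_trigMap_le p)).re

theorem IsFourierKernel.integral_re_inner_le (hK : IsFourierKernel K C h) (p : V →₀ H) :
    ∫ w, (inner ℂ (trigMap w p) (h w (trigMap w p))).re ≤ ‖kerSum K p‖ ^ 2 := by
  rw [hK.norm_kerSum_sq]
  exact le_add_of_nonneg_left (re_inner_apply_nonneg hK.const_nonneg _)

theorem IsFourierKernel.norm_const_apply_le (hK : IsFourierKernel K C h) (p : V →₀ H) :
    ‖C (∑ y ∈ p.support, p y)‖ ≤ (‖C‖ + 1) / 2 * ‖kerSum K p‖ := by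
  refine le_mul_of_forall_le (norm_nonneg _) fun t ht => ?_
  have h1 := mul_norm_apply_le hK.const_nonneg (∑ y ∈ p.support, p y) 1 ht
  simp only [one_mul, one_pow] at h1
  refine h1.trans ?_
  gcongr
  rw [hK.norm_kerSum_sq]
  exact le_add_of_nonneg_right (integral_nonneg fun w =>
    re_inner_apply_nonneg (hK.density_nonneg w) _)

omit [CompleteSpace H] in
theorem integrable_mul_of_integrable_sq {ρ : V → ℝ} (hρc : Continuous ρ) (hρ : ∀ w, 1 ≤ ρ w)
    (hint : Integrable fun w => ρ w ^ 2 * ‖h w‖) (hh : Integrable h) {η : V → H}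
    (hη : Continuous η) {B : ℝ} (hB : ∀ w, ‖η w‖ ≤ B) :
    Integrable fun w => ρ w • h w (η w) := by
  refine (hint.mul_const B).mono' (hρc.aestronglyMeasurable.smul
    (integrable_apply hh hη hB).aestronglyMeasurable) (ae_of_all _ fun w => ?_)
  rw [norm_smul, Real.norm_of_nonneg (zero_le_one.trans (hρ w)), mul_assoc]
  have h1 : ‖h w (η w)‖ ≤ ‖h w‖ * B := (h w).le_opNorm_of_le (hB w)
  exact mul_le_mul (le_self_pow₀ (hρ w) two_ne_zero) h1 (norm_nonneg _)
    (sq_nonneg _)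

theorem IsFourierKernel.integral_norm_le (hK : IsFourierKernel K C h) {ρ : V → ℝ}
    (hρc : Continuous ρ) (hρ : ∀ w, 1 ≤ ρ w) (hint : Integrable fun w => ρ w ^ 2 * ‖h w‖)
    (p : V →₀ H) :
    ∫ w, ‖ρ w • h w (trigMap w p)‖ ≤ ((∫ w, ρ w ^ 2 * ‖h w‖) + 1) / 2 * ‖kerSum K p‖ := by
  refine le_mul_of_forall_le (norm_nonneg _) fun t ht => ?_
  have hi := integrable_mul_of_integrable_sq hρc hρ hint hK.integrable (continuous_trigMap p)
    (norm_trigMap_le p)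
  have hi2 := integrable_re_inner_trigMap hK.integrable p
  calc ∫ w, ‖ρ w • h w (trigMap w p)‖
      ≤ ∫ w, (t * (ρ w ^ 2 * ‖h w‖) + t⁻¹ * (inner ℂ (trigMap w p) (h w (trigMap w p))).re) / 2 := by
        refine integral_mono hi.norm (((hint.const_mul t).add (hi2.const_mul t⁻¹)).div_const 2)
          fun w => ?_
        simp only [norm_smul, Real.norm_of_nonneg (zero_le_one.trans (hρ w))]
        exact mul_norm_apply_le (hK.density_nonneg w) _ _ ht
    _ = (t * (∫ w, ρ w ^ 2 * ‖h w‖) +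
          t⁻¹ * ∫ w, (inner ℂ (trigMap w p) (h w (trigMap w p))).re) / 2 := by
        rw [integral_div, integral_add (hint.const_mul t) (hi2.const_mul t⁻¹),
          integral_const_mul, integral_const_mul]
    _ ≤ _ := by
        gcongr
        exact hK.integral_re_inner_le p

omit [CompleteSpace H] in
theorem continuous_fourier_smul_L1 {ρ : V → ℝ} (hρc : Continuous ρ) (hρ : ∀ w, 1 ≤ ρ w) (x : V) :
    Continuous fun Z : Lp H 1 (volume : Measure V) => 𝓕 (fun w => (ρ w)⁻¹ • Z w) x := by
  have hle : ∀ (Z : V → H) w, ‖(ρ w)⁻¹ • Z w‖ ≤ ‖Z w‖ := fun Z w => by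
    rw [norm_smul, norm_inv, Real.norm_of_nonneg (zero_le_one.trans (hρ w))]
    exact mul_le_of_le_one_left (norm_nonneg _) (inv_le_one_of_one_le₀ (hρ w))
  have hi : ∀ Z : Lp H 1 (volume : Measure V), Integrable fun w => (ρ w)⁻¹ • Z w := fun Z =>
    (L1.integrable_coeFn Z).mono ((hρc.inv₀ fun w => (zero_lt_one.trans_le (hρ w)).ne'
      ).aestronglyMeasurable.smul (Lp.aestronglyMeasurable Z)) (ae_of_all _ (hle Z))
  refine (LipschitzWith.of_dist_le_mul (K := 1) fun Z W => ?_).continuous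
  rw [dist_eq_norm, dist_eq_norm, NNReal.coe_one, one_mul, fourier_eq_integral_planeWave,
    fourier_eq_integral_planeWave, ← integral_sub (integrable_planeWave_smul (hi Z) x)
    (integrable_planeWave_smul (hi W) x), L1.norm_eq_integral_norm]
  refine norm_integral_le_of_norm_le (L1.integrable_coeFn (Z - W)).norm ?_
  filter_upwards [Lp.coeFn_sub Z W] with w hw
  rw [hw, ← smul_sub, ← smul_sub, norm_smul, RCLike.norm_conj, norm_planeWave, one_mul]
  exact hle (Z - W : V → H) w

/-- The weighted density `p ↦ ρ h p̂` as a map to `L¹`. -/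
noncomputable def densityMap {ρ : V → ℝ} (hρc : Continuous ρ) (hρ : ∀ w, 1 ≤ ρ w)
    (hint : Integrable fun w => ρ w ^ 2 * ‖h w‖) (hh : Integrable h) :
    (V →₀ H) →ₗ[ℂ] Lp H 1 (volume : Measure V) where
  toFun p := (integrable_mul_of_integrable_sq hρc hρ hint hh (continuous_trigMap p)
    (norm_trigMap_le p)).toL1 _
  map_add' p p' := by
    rw [← Integrable.toL1_add]
    congr 1
    ext w
    simp
  map_smul' c p := by
    rw [RingHom.id_apply, ← Integrable.toL1_smul]
    congr 1
    ext w
    simp only [map_smul]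
    exact smul_comm _ _ _

/-- The elements of the reproducing kernel Hilbert space are, up to constants, Fourier transforms
of densities with half as many moments as `h`. The constants are absent if `C = 0`. -/
theorem IsFourierKernel.exists_eq_add_fourier (hK : IsFourierKernel K C h) {ρ : V → ℝ}
    (hρc : Continuous ρ) (hρ : ∀ w, 1 ≤ ρ w) (hint : Integrable fun w => ρ w ^ 2 * ‖h w‖)
    (f : RKHS.OfKernel (Matrix.of K)) :
    ∃ (c : H) (ζ : V → H), (C = 0 → c = 0) ∧ AEStronglyMeasurable ζ ∧
      (Integrable fun w => ρ w * ‖ζ w‖) ∧ ∀ x, f x = c + 𝓕 ζ x := by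
  -- On finite kernel sums, the constant is `A` and the density is `ρ⁻¹ B`. Both maps are bounded for
  -- the norm of the space, and the representation passes to limits.
  let A : (V →₀ H) →ₗ[ℂ] H := (C : H →ₗ[ℂ] H) ∘ₗ Finsupp.lsum ℂ fun _ => LinearMap.id
  have hA : ∀ p, A p = C (∑ y ∈ p.support, p y) := fun p => rfl
  let B := densityMap hρc hρ hint hK.integrable
  have hd := denseRange_kerSum K
  have hAn : ∃ c, ∀ p, ‖A p‖ ≤ c * ‖kerSum K p‖ := ⟨_, hK.norm_const_apply_le⟩
  have hBn : ∃ c, ∀ p, ‖B p‖ ≤ c * ‖kerSum K p‖ := by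
    refine ⟨_, fun p => le_trans (le_of_eq ?_) (hK.integral_norm_le hρc hρ hint p)⟩
    rw [L1.norm_eq_integral_norm]
    refine integral_congr_ae ?_
    filter_upwards [Integrable.coeFn_toL1 (integrable_mul_of_integrable_sq hρc hρ hint
      hK.integrable (continuous_trigMap p) (norm_trigMap_le p))] with w hw
    exact congrArg norm hw
  let A' := A.extendOfNorm (kerSum K)
  let B' := B.extendOfNorm (kerSum K)
  have hne : ∀ w, ρ w ≠ 0 := fun w => (zero_lt_one.trans_le (hρ w)).ne'
  refine ⟨A' f, fun w => (ρ w)⁻¹ • B' f w, fun hC => ?_, ?_, ?_, fun x => ?_⟩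
  · have h0 := LinearMap.norm_extendOfNorm_apply_le (f := A) (e := kerSum K) hd 0 (fun p => by
      rw [hA, hC]; simp) f
    simpa using h0
  · exact (hρc.inv₀ hne).aestronglyMeasurable.smul (Lp.aestronglyMeasurable _)
  · refine (L1.integrable_coeFn (B' f)).norm.congr (ae_of_all _ fun w => ?_)
    simp only [norm_smul, norm_inv, Real.norm_of_nonneg (zero_le_one.trans (hρ w))]
    rw [mul_inv_cancel_left₀ (hne w)]
  · have key := hd.equalizer (RKHS.continuous_eval (H := RKHS.OfKernel (Matrix.of K)) x)
      ((A'.continuous).add ((continuous_fourier_smul_L1 hρc hρ x).comp B'.continuous))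
      (funext fun p => ?_)
    · exact congrFun key f
    · simp only [Function.comp_apply]
      rw [Pi.add_apply, Function.comp_apply]
      have eA : A' (kerSum K p) = A p := LinearMap.extendOfNorm_eq hd hAn p
      have eB : B' (kerSum K p) = B p := LinearMap.extendOfNorm_eq hd hBn p
      rw [eA, eB, hK.kerSum_coe, hA]
      congr 1
      rw [fourier_eq_integral_planeWave, fourier_eq_integral_planeWave]
      refine integral_congr_ae ?_
      filter_upwards [Integrable.coeFn_toL1 (integrable_mul_of_integrable_sq hρc hρ hint
        hK.integrable (continuous_trigMap p) (norm_trigMap_le p))] with w hw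
      have hw' : (B p) w = ρ w • h w (trigMap w p) := hw
      rw [hw', inv_smul_smul₀ (hne w)]

/-- The Fourier transform of `h χ` belongs to the reproducing kernel Hilbert space. -/
theorem IsFourierKernel.exists_coe_eq_fourier (hK : IsFourierKernel K C h) {χ : V → H}
    (hχ : Continuous χ) {b : ℝ} (hb : ∀ w, ‖χ w‖ ≤ b) :
    ∃ g : RKHS.OfKernel (Matrix.of K), ∀ x, g x = 𝓕 (fun w => h w (χ w)) x := by
  have hi : ∀ p : V →₀ H, Integrable fun w => inner ℂ (χ w) (h w (trigMap w p)) := fun p =>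
    integrable_inner_apply hK.integrable (continuous_trigMap p) hχ
      (B := max b (∑ x ∈ p.support, ‖p x‖)) (fun w => (norm_trigMap_le p w).trans (le_max_right _ _))
      fun w => (hb w).trans (le_max_left _ _)
  have hi2 : Integrable fun w => (inner ℂ (χ w) (h w (χ w))).re :=
    (integrable_inner_apply hK.integrable hχ hχ hb hb).re
  -- The function is the Riesz representative of the functional `p ↦ ∫ ⟨χ, h p̂⟩`.
  let l : (V →₀ H) →ₗ[ℂ] ℂ :=
    { toFun := fun p => ∫ w, inner ℂ (χ w) (h w (trigMap w p))
      map_add' := fun p p' => by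
        rw [← integral_add (hi p) (hi p')]
        simp only [map_add, inner_add_right]
      map_smul' := fun c p => by
        rw [RingHom.id_apply, smul_eq_mul, ← integral_const_mul]
        simp only [map_smul, inner_smul_right] }
  have hl : ∃ c, ∀ p, ‖l p‖ ≤ c * ‖kerSum K p‖ := by
    refine ⟨((∫ w, (inner ℂ (χ w) (h w (χ w))).re) + 1) / 2, fun p =>
      le_mul_of_forall_le (norm_nonneg _) fun t ht => ?_⟩
    have hi3 := integrable_re_inner_trigMap hK.integrable p
    refine (norm_integral_le_of_norm_le
      (((hi2.const_mul t).add (hi3.const_mul t⁻¹)).div_const 2) (ae_of_all _ fun w =>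
        norm_inner_apply_le (hK.density_nonneg w) _ _ ht)).trans ?_
    simp only [Pi.add_apply]
    rw [integral_div, integral_add (hi2.const_mul t) (hi3.const_mul t⁻¹), integral_const_mul,
      integral_const_mul]
    gcongr
    exact hK.integral_re_inner_le p
  let L := l.extendOfNorm (kerSum K)
  refine ⟨(InnerProductSpace.toDual ℂ (RKHS.OfKernel (Matrix.of K))).symm L, fun x => ?_⟩
  refine ext_inner_right ℂ fun v => ?_
  rw [← RKHS.inner_kerFun, InnerProductSpace.toDual_symm_apply, ← kerSum_single,
    LinearMap.extendOfNorm_eq (denseRange_kerSum K) hl, fourier_eq_integral_planeWave]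
  have hi4 := integrable_planeWave_smul (integrable_apply hK.integrable hχ hb) x
  rw [← inner_conj_symm, ← integral_inner hi4, ← integral_conj]
  refine integral_congr_ae (ae_of_all _ fun w => ?_)
  have hsa : inner ℂ (χ w) (h w v) = inner ℂ (h w (χ w)) v := by
    have := ((ContinuousLinearMap.nonneg_iff_isPositive _).1 (hK.density_nonneg w)).isSymmetric
    exact (this _ _).symm
  simp only [trigMap_single, map_smul, inner_smul_right, hsa, map_mul, inner_conj_symm,
    Complex.conj_conj]

end FourierRKHS

/-! ### Approximation by Fourier transforms -/

section WeightedApproximation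

open MeasureTheory

variable {V : Type*} [NormedAddCommGroup V]

/-- A cutoff function, equal to `1` where `2 / n ≤ ‖w‖ ≤ n - 1` and to `0` where `‖w‖ ≤ 1 / n` or
`n ≤ ‖w‖`. -/
noncomputable def annulusCutoff (n : ℕ) (w : V) : ℝ :=
  min 1 (max 0 (n * ‖w‖ - 1)) * min 1 (max 0 (n - ‖w‖))

theorem continuous_annulusCutoff (n : ℕ) : Continuous (annulusCutoff (V := V) n) := by
  unfold annulusCutoff
  fun_prop

theorem annulusCutoff_nonneg (n : ℕ) (w : V) : 0 ≤ annulusCutoff n w := by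
  unfold annulusCutoff
  positivity

theorem annulusCutoff_le_one (n : ℕ) (w : V) : annulusCutoff n w ≤ 1 :=
  mul_le_one₀ (min_le_left _ _) (by positivity) (min_le_left _ _)

theorem annulusCutoff_eventually_eq_zero (n : ℕ) : ∀ᶠ w : V in 𝓝 0, annulusCutoff n w = 0 := by
  have h : Tendsto (fun w : V => n * ‖w‖ - 1) (𝓝 0) (𝓝 (n * ‖(0 : V)‖ - 1)) := by
    apply Continuous.tendsto
    fun_prop
  have h0 : (n : ℝ) * ‖(0 : V)‖ - 1 < 0 := by simp
  filter_upwards [h.eventually_lt_const h0] with w hw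
  simp [annulusCutoff, max_eq_left hw.le]

theorem annulusCutoff_eventually_eq_one {w : V} (hw : w ≠ 0) :
    ∀ᶠ n : ℕ in atTop, annulusCutoff n w = 1 := by
  have hw' : 0 < ‖w‖ := norm_pos_iff.2 hw
  filter_upwards [(tendsto_natCast_atTop_atTop (R := ℝ)).eventually_ge_atTop (2 / ‖w‖),
    (tendsto_natCast_atTop_atTop (R := ℝ)).eventually_ge_atTop (1 + ‖w‖)] with n h1 h2
  rw [div_le_iff₀ hw'] at h1
  have e1 : (1 : ℝ) ≤ n * ‖w‖ - 1 := by linarith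
  have e2 : (1 : ℝ) ≤ n - ‖w‖ := by linarith
  rw [annulusCutoff, min_eq_left (e1.trans (le_max_right _ _)),
    min_eq_left (e2.trans (le_max_right _ _)), one_mul]

theorem hasCompactSupport_annulusCutoff [ProperSpace V] (n : ℕ) :
    HasCompactSupport (annulusCutoff (V := V) n) := by
  refine HasCompactSupport.of_support_subset_isCompact (isCompact_closedBall (0 : V) n)
    fun w hw => ?_
  by_contra hc
  rw [mem_closedBall_zero_iff, not_le] at hc
  refine hw ?_
  simp [annulusCutoff, max_eq_left (sub_nonpos.2 hc.le)]

variable [NormedSpace ℝ V] [FiniteDimensional ℝ V] [MeasurableSpace V] [BorelSpace V]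
  {H : Type*} [NormedAddCommGroup H] [InnerProductSpace ℂ H]
  {h : V → H →L[ℂ] H} (μ : Measure V) [IsFiniteMeasureOnCompacts μ] [NullSingletonClass μ]

/-- If the operators `h w` have dense range for `w ≠ 0` and depend continuously on `w ≠ 0`, then
the functions `w ↦ h w (χ w)`, with `χ` continuous and bounded, are dense in weighted `L¹`. The
function `χ` is glued from local constants by a partition of unity. -/
theorem exists_integral_mul_norm_sub_lt (hcont : ContinuousOn h {0}ᶜ)
    (hm : AEStronglyMeasurable h μ) (hd : ∀ w, w ≠ 0 → DenseRange (h w)) {ψ : V → H}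
    (hψ : Continuous ψ) {W : V → ℝ} (hW : Continuous W) (hW0 : ∀ w, 0 ≤ W w)
    (hint : Integrable (fun w => W w * ‖ψ w‖) μ) {ε : ℝ} (hε : 0 < ε) :
    ∃ χ : V → H, Continuous χ ∧ (∃ b, ∀ w, ‖χ w‖ ≤ b) ∧
      Integrable (fun w => W w * ‖h w (χ w) - ψ w‖) μ ∧
      ∫ w, W w * ‖h w (χ w) - ψ w‖ ∂μ < ε := by
  have hlim : Tendsto (fun n : ℕ => ∫ w, (1 - annulusCutoff n w ^ 2) * (W w * ‖ψ w‖) ∂μ) atTop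
      (𝓝 (∫ _, 0 ∂μ)) := by
    refine tendsto_integral_of_dominated_convergence (fun w => W w * ‖ψ w‖) (fun n => ?_) hint
      (fun n => ae_of_all _ fun w => ?_) ?_
    · exact (continuous_const.sub ((continuous_annulusCutoff n).pow 2)).aestronglyMeasurable.mul
        hint.aestronglyMeasurable
    · have h1 := pow_le_one₀ (n := 2) (annulusCutoff_nonneg n w) (annulusCutoff_le_one n w)
      have h2 := sq_nonneg (annulusCutoff n w)
      rw [norm_mul, Real.norm_of_nonneg (sub_nonneg.2 h1),
        Real.norm_of_nonneg (mul_nonneg (hW0 w) (norm_nonneg _))]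
      exact mul_le_of_le_one_left (mul_nonneg (hW0 w) (norm_nonneg _)) (by linarith)
    · have h0 : ∀ᵐ w ∂μ, w ≠ (0 : V) := by simp [ae_iff]
      filter_upwards [h0] with w hw
      refine tendsto_const_nhds.congr' ?_
      filter_upwards [annulusCutoff_eventually_eq_one hw] with n hn
      simp [hn]
  rw [integral_zero] at hlim
  obtain ⟨n, hn⟩ := (hlim.eventually_lt_const (half_pos hε)).exists
  set θ : V → ℝ := annulusCutoff n
  have hθc : Continuous θ := continuous_annulusCutoff n
  have hθ0 : ∀ w, 0 ≤ θ w := annulusCutoff_nonneg n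
  have hθ1 : ∀ w, θ w ≤ 1 := annulusCutoff_le_one n
  have hθW : Integrable (fun w => W w * θ w) μ :=
    (hW.mul hθc).integrable_of_hasCompactSupport (hasCompactSupport_annulusCutoff n).mul_left
  set I := ∫ w, W w * θ w ∂μ
  have hI : 0 ≤ I := integral_nonneg fun w => mul_nonneg (hW0 w) (hθ0 w)
  -- Up to the tolerance `δ`, the equation `h w v = ψ w` has to be solved only where `θ w ≠ 0`, hence
  -- away from `w = 0`.
  set δ := ε / (2 * (I + 1))
  have hδ : 0 < δ := by positivity
  obtain ⟨χ₀, hχ₀⟩ := exists_continuous_forall_mem_convex_of_local_const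
    (t := fun w : V => {v : H | θ w * ‖h w v - ψ w‖ < δ}) (fun w => by
      intro a ha b hb s t hs ht hst
      simp only [Set.mem_ofPred_eq] at ha hb ⊢
      have e : h w (s • a + t • b) - ψ w = s • (h w a - ψ w) + t • (h w b - ψ w) := by
        have : ψ w = s • ψ w + t • ψ w := by rw [← add_smul, hst, one_smul]
        nth_rw 1 [this]
        simp only [← Complex.coe_smul, map_add, map_smul, smul_sub]
        abel
      have e2 : ‖h w (s • a + t • b) - ψ w‖ ≤ s * ‖h w a - ψ w‖ + t * ‖h w b - ψ w‖ := by
        rw [e]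
        refine (norm_add_le _ _).trans ?_
        rw [norm_smul, norm_smul, Real.norm_of_nonneg hs, Real.norm_of_nonneg ht]
      have e3 : θ w * ‖h w (s • a + t • b) - ψ w‖ ≤
          s * (θ w * ‖h w a - ψ w‖) + t * (θ w * ‖h w b - ψ w‖) := by
        refine (mul_le_mul_of_nonneg_left e2 (hθ0 w)).trans_eq (by ring)
      exact e3.trans_lt ((convex_Iio δ) ha hb hs ht hst)) (fun w => by
      rcases eq_or_ne w 0 with rfl | hw
      · refine ⟨0, ?_⟩
        filter_upwards [annulusCutoff_eventually_eq_zero n] with y hy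
        simpa [θ, hy] using hδ
      · obtain ⟨c, hc⟩ := (hd w hw).exists_dist_lt (ψ w) hδ
        refine ⟨c, ?_⟩
        have hca : ContinuousAt (fun y => θ y * ‖h y c - ψ y‖) w := by
          have h1 : ContinuousAt h w := hcont.continuousAt (isOpen_compl_singleton.mem_nhds hw)
          exact hθc.continuousAt.mul ((h1.clm_apply continuousAt_const).sub hψ.continuousAt).norm
        refine hca.eventually_lt_const ?_
        rw [dist_comm, dist_eq_norm] at hc
        exact (mul_le_of_le_one_left (norm_nonneg _) (hθ1 w)).trans_lt hc)
  -- One factor `θ` makes the error small by the choice of `χ₀`, the other makes it integrable.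
  set χ : V → H := fun w => (θ w ^ 2) • χ₀ w
  have hχc : Continuous χ := (hθc.pow 2).smul χ₀.continuous
  have hχs : HasCompactSupport χ := by
    refine HasCompactSupport.smul_right (f := fun w => θ w ^ 2) ?_
    exact (hasCompactSupport_annulusCutoff n).comp_left (g := fun t : ℝ => t ^ 2) (by simp)
  obtain ⟨b, hb⟩ := hχc.bounded_above_of_compact_support hχs
  have hle : ∀ w, W w * ‖h w (χ w) - ψ w‖ ≤
      δ * (W w * θ w) + (1 - θ w ^ 2) * (W w * ‖ψ w‖) := fun w => by
    have h1 : θ w ^ 2 ≤ 1 := pow_le_one₀ (hθ0 w) (hθ1 w)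
    have e : h w (χ w) - ψ w = θ w ^ 2 • (h w (χ₀ w) - ψ w) - (1 - θ w ^ 2) • ψ w := by
      simp only [χ, ← Complex.coe_smul, map_smul, smul_sub]
      rw [Complex.ofReal_sub, sub_smul, Complex.ofReal_one, one_smul]
      abel
    have e2 : ‖h w (χ w) - ψ w‖ ≤ θ w * (θ w * ‖h w (χ₀ w) - ψ w‖) + (1 - θ w ^ 2) * ‖ψ w‖ := by
      rw [e]
      refine (norm_sub_le _ _).trans_eq ?_
      rw [norm_smul, norm_smul, Real.norm_of_nonneg (sq_nonneg _),
        Real.norm_of_nonneg (sub_nonneg.2 h1)]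
      ring
    have e3 : θ w * (θ w * ‖h w (χ₀ w) - ψ w‖) ≤ θ w * δ :=
      mul_le_mul_of_nonneg_left (hχ₀ w).le (hθ0 w)
    calc W w * ‖h w (χ w) - ψ w‖ ≤ W w * (θ w * δ + (1 - θ w ^ 2) * ‖ψ w‖) :=
          mul_le_mul_of_nonneg_left (by linarith) (hW0 w)
      _ = _ := by ring
  have hi2 : Integrable (fun w => (1 - θ w ^ 2) * (W w * ‖ψ w‖)) μ := by
    refine hint.mono ((continuous_const.sub (hθc.pow 2)).aestronglyMeasurable.mul
        hint.aestronglyMeasurable) (ae_of_all _ fun w => ?_)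
    have h1 : θ w ^ 2 ≤ 1 := pow_le_one₀ (hθ0 w) (hθ1 w)
    rw [norm_mul, Real.norm_of_nonneg (sub_nonneg.2 h1)]
    exact mul_le_of_le_one_left (norm_nonneg _) (by linarith [sq_nonneg (θ w)])
  have hmeas : AEStronglyMeasurable (fun w => W w * ‖h w (χ w) - ψ w‖) μ :=
    hW.aestronglyMeasurable.mul ((isBoundedBilinearMap_apply.continuous.comp_aestronglyMeasurable
      (hm.prodMk hχc.aestronglyMeasurable)).sub hψ.aestronglyMeasurable).norm
  have hi3 : Integrable (fun w => W w * ‖h w (χ w) - ψ w‖) μ :=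
    ((hθW.const_mul δ).add hi2).mono' hmeas (ae_of_all _ fun w => by
      rw [Real.norm_of_nonneg (mul_nonneg (hW0 w) (norm_nonneg _))]
      exact hle w)
  refine ⟨χ, hχc, ⟨b, hb⟩, hi3, ?_⟩
  calc ∫ w, W w * ‖h w (χ w) - ψ w‖ ∂μ
      ≤ ∫ w, δ * (W w * θ w) + (1 - θ w ^ 2) * (W w * ‖ψ w‖) ∂μ :=
        integral_mono hi3 ((hθW.const_mul δ).add hi2) hle
    _ = δ * I + ∫ w, (1 - θ w ^ 2) * (W w * ‖ψ w‖) ∂μ := by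
        rw [integral_add (hθW.const_mul δ) hi2, integral_const_mul]
    _ < ε / 2 + ε / 2 := by
        refine add_lt_add ?_ hn
        rw [div_mul_eq_mul_div, div_lt_div_iff₀ (by positivity) two_pos]
        nlinarith
    _ = ε := add_halves ε

end WeightedApproximation

section SmoothApproximation

open MeasureTheory
open scoped Convolution ContDiff

variable {V : Type*} [NormedAddCommGroup V] [InnerProductSpace ℝ V] [FiniteDimensional ℝ V]
  {E : Type*} [NormedAddCommGroup E] [NormedSpace ℝ E]

omit [FiniteDimensional ℝ V] in
theorem norm_iteratedFDeriv_comp_smul_le {φ : V → ℝ} {n : ℕ} (hφ : ContDiff ℝ n φ) {M : ℝ}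
    (hM : ∀ x, ‖iteratedFDeriv ℝ n φ x‖ ≤ M) {r : ℝ} (hr : |r| ≤ 1) (x : V) :
    ‖iteratedFDeriv ℝ n (fun x => φ (r • x)) x‖ ≤ M := by
  rw [iteratedFDeriv_comp_const_smul r hφ, norm_smul, norm_pow, Real.norm_eq_abs]
  exact (mul_le_of_le_one_left (norm_nonneg _) (pow_le_one₀ (abs_nonneg _) hr)).trans (hM _)

/-- Functions whose derivatives up to order `q` vanish at infinity are approximated by functions
with compact support. -/
theorem exists_hasCompactSupport_norm_iteratedFDeriv_sub_lt {q : ℕ} {g : V → E}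
    (hg : ContDiff ℝ q g)
    (hg0 : ∀ k ≤ q, Tendsto (iteratedFDeriv ℝ k g) (cocompact V) (𝓝 0)) {ε : ℝ} (hε : 0 < ε) :
    ∃ g₁ : V → E, ContDiff ℝ q g₁ ∧ HasCompactSupport g₁ ∧
      ∀ k ≤ q, ∀ x, ‖iteratedFDeriv ℝ k g₁ x - iteratedFDeriv ℝ k g x‖ < ε := by
  let φ : ContDiffBump (0 : V) := ⟨1, 2, one_pos, one_lt_two⟩
  -- The error of the cutoff `φ (x / R)` is `η (x / R) • g x`: it is zero where `‖x‖ < R`, and where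
  -- `R ≤ ‖x‖` the derivatives of `g` are small while those of `η (x / R)` are bounded uniformly in `R`.
  let η : V → ℝ := fun x => φ x - 1
  have hη : ContDiff ℝ q η := φ.contDiff.sub contDiff_const
  have hbd : ∀ k : ℕ, ∃ M, ∀ x, ‖iteratedFDeriv ℝ k η x‖ ≤ M := fun k => by
    rcases Nat.eq_zero_or_pos k with rfl | hk
    · refine ⟨1, fun x => ?_⟩
      rw [norm_iteratedFDeriv_zero, Real.norm_eq_abs, abs_le]
      have h0 := φ.nonneg (x := x)
      have h1 := φ.le_one (x := x)
      constructor <;> simp only [η] <;> linarith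
    · have e : iteratedFDeriv ℝ k η = iteratedFDeriv ℝ k φ := by
        funext x
        simp only [η]
        rw [fun_iteratedFDeriv_sub_apply φ.contDiffAt contDiffAt_const,
          iteratedFDeriv_const_of_ne hk.ne']
        simp
      rw [e]
      exact (φ.contDiff.continuous_iteratedFDeriv' (m := k)).bounded_above_of_compact_support
        (φ.hasCompactSupport.iteratedFDeriv k)
  choose M hM using hbd
  have hM0 : ∀ k, 0 ≤ M k := fun k => (norm_nonneg _).trans (hM k 0)
  set B := ∑ k ∈ Finset.range (q + 1), M k
  have hB : ∀ k ≤ q, M k ≤ B := fun k hk =>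
    Finset.single_le_sum (f := M) (fun i _ => hM0 i) (Finset.mem_range_succ_iff.2 hk)
  have hB0 : 0 ≤ B := Finset.sum_nonneg fun i _ => hM0 i
  set δ := ε / (2 ^ q * (B + 1))
  have hδ : 0 < δ := by positivity
  have hev : ∀ᶠ x in cocompact V, ∀ k ∈ Finset.range (q + 1), ‖iteratedFDeriv ℝ k g x‖ < δ := by
    rw [Filter.eventually_all_finset]
    intro k hk
    have := (hg0 k (Finset.mem_range_succ_iff.1 hk)).norm
    rw [norm_zero] at this
    exact this.eventually_lt_const hδ
  obtain ⟨R, hR1, hR⟩ : ∃ R : ℝ, 1 ≤ R ∧ ∀ x : V, R ≤ ‖x‖ → ∀ k ≤ q,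
      ‖iteratedFDeriv ℝ k g x‖ < δ := by
    obtain ⟨R, hR⟩ := (Metric.hasBasis_cobounded_compl_closedBall (0 : V)).mem_iff.1
      (Metric.cobounded_eq_cocompact (α := V) ▸ hev)
    refine ⟨max 1 (R + 1), le_max_left _ _, fun x hx k hk => ?_⟩
    refine hR.2 ?_ k (Finset.mem_range_succ_iff.2 hk)
    have := (le_max_right 1 (R + 1)).trans hx
    simp only [Set.mem_compl_iff, mem_closedBall_zero_iff, not_le]
    linarith
  have hR0 : 0 < R := by linarith
  have hsm : ∀ {n : WithTop ℕ∞}, ContDiff ℝ n fun x : V => R⁻¹ • x := fun {n} =>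
    contDiff_const.smul contDiff_id
  have hg₁ : ContDiff ℝ q fun x => φ (R⁻¹ • x) • g x :=
    (φ.contDiff.comp hsm).smul hg
  have hηR : ContDiff ℝ q fun x => η (R⁻¹ • x) := hη.comp hsm
  refine ⟨fun x => φ (R⁻¹ • x) • g x, hg₁, ?_, fun k hk x => ?_⟩
  · refine HasCompactSupport.smul_right (f := fun x => φ (R⁻¹ • x)) ?_
    exact φ.hasCompactSupport.comp_homeomorph (Homeomorph.smulOfNeZero R⁻¹ (inv_ne_zero hR0.ne'))
  have hkq : (k : WithTop ℕ∞) ≤ q := by exact_mod_cast hk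
  rw [← iteratedFDeriv_sub_apply (hg₁.of_le hkq).contDiffAt (hg.of_le hkq).contDiffAt]
  have e : ((fun x => φ (R⁻¹ • x) • g x) - g) = fun x => η (R⁻¹ • x) • g x := by
    funext y
    simp [η, sub_smul]
  rw [e]
  rcases lt_or_ge ‖x‖ R with hx | hx
  · have hz : (fun x => η (R⁻¹ • x) • g x) =ᶠ[𝓝 x] fun _ => 0 := by
      filter_upwards [(isOpen_lt continuous_norm continuous_const).mem_nhds hx] with y hy
      have : φ (R⁻¹ • y) = 1 := by
        refine φ.one_of_mem_closedBall ?_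
        rw [mem_closedBall_zero_iff, norm_smul, norm_inv, Real.norm_of_nonneg hR0.le]
        rw [inv_mul_le_iff₀ hR0]
        simpa [φ] using le_of_lt hy
      simp [η, this]
    rw [(hz.iteratedFDeriv ℝ k).eq_of_nhds]
    simpa using hε
  · refine (norm_iteratedFDeriv_smul_le hηR hg x hkq).trans_lt ?_
    have hinv : |R⁻¹| ≤ 1 := by
      rw [abs_of_pos (inv_pos.2 hR0)]
      exact inv_le_one_of_one_le₀ hR1
    have h2 : ∑ i ∈ Finset.range (k + 1), (k.choose i : ℝ) * B * δ = 2 ^ k * B * δ := by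
      rw [← Finset.sum_mul, ← Finset.sum_mul]
      norm_cast
      rw [Nat.sum_range_choose]
    calc _ ≤ ∑ i ∈ Finset.range (k + 1), (k.choose i : ℝ) * B * δ := by
          refine Finset.sum_le_sum fun i hi => ?_
          have hik : i ≤ k := Finset.mem_range_succ_iff.1 hi
          gcongr
          · exact (norm_iteratedFDeriv_comp_smul_le
              (hη.of_le (by exact_mod_cast hik.trans hk)) (hM i) hinv x).trans (hB i (hik.trans hk))
          · exact (hR x hx (k - i) ((Nat.sub_le _ _).trans hk)).le
      _ = 2 ^ k * B * δ := h2
      _ ≤ 2 ^ q * B * δ := by gcongr; exact one_le_two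
      _ < 2 ^ q * (B + 1) * δ := by gcongr; linarith
      _ = ε := by simp only [δ]; field_simp

variable [MeasurableSpace V] [BorelSpace V] [CompleteSpace E]

omit [CompleteSpace E] in
theorem convolution_comp_linearIsometryEquiv {E' : Type*} [NormedAddCommGroup E']
    [NormedSpace ℝ E'] [CompleteSpace E'] (L : E ≃ₗᵢ[ℝ] E') (f : V → ℝ) (g : V → E) :
    f ⋆[ContinuousLinearMap.lsmul ℝ ℝ, volume] (L ∘ g) =
      L ∘ (f ⋆[ContinuousLinearMap.lsmul ℝ ℝ, volume] g) := by
  funext x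
  rw [Function.comp_apply, convolution_def, convolution_def]
  refine Eq.trans ?_ (L.toContinuousLinearEquiv.integral_comp_comm _)
  simp

omit [CompleteSpace E] in
theorem fderiv_convolution {f : V → ℝ} (hf : LocallyIntegrable f volume) {g : V → E}
    (hg : ContDiff ℝ 1 g) (hgs : HasCompactSupport g) :
    fderiv ℝ (f ⋆[ContinuousLinearMap.lsmul ℝ ℝ, volume] g) =
      f ⋆[ContinuousLinearMap.lsmul ℝ ℝ, volume] fderiv ℝ g := by
  funext x
  rw [(hgs.hasFDerivAt_convolution_right _ hf hg x).fderiv]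
  rfl

/-- Convolution with an integrable function commutes with differentiation. -/
theorem iteratedFDeriv_convolution {f : V → ℝ} (hf : LocallyIntegrable f volume) {q : ℕ} {g : V → E}
    (hg : ContDiff ℝ q g) (hgs : HasCompactSupport g) {k : ℕ} (hk : k ≤ q) :
    iteratedFDeriv ℝ k (f ⋆[ContinuousLinearMap.lsmul ℝ ℝ, volume] g) =
      f ⋆[ContinuousLinearMap.lsmul ℝ ℝ, volume] iteratedFDeriv ℝ k g := by
  induction k with
  | zero =>
    rw [iteratedFDeriv_zero_eq_comp, iteratedFDeriv_zero_eq_comp,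
      convolution_comp_linearIsometryEquiv]
  | succ k ih =>
    have hC1 : ContDiff ℝ 1 (iteratedFDeriv ℝ k g) :=
      hg.iteratedFDeriv_right (by exact_mod_cast (add_comm 1 k).trans_le hk)
    rw [iteratedFDeriv_succ_eq_comp_left, iteratedFDeriv_succ_eq_comp_left,
      ih (Nat.le_of_succ_le hk), fderiv_convolution hf hC1 (hgs.iteratedFDeriv k)]
    exact (convolution_comp_linearIsometryEquiv (E := V →L[ℝ] V [×k]→L[ℝ] E)
      (E' := V [×(k + 1)]→L[ℝ] E)
      (continuousMultilinearCurryLeftEquiv ℝ (fun _ : Fin (k + 1) => V) E).symm f _).symm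

/-- Functions of class `C^q` with compact support are approximated by smooth ones. -/
theorem exists_contDiff_infty_norm_iteratedFDeriv_sub_lt {q : ℕ} {g : V → E}
    (hg : ContDiff ℝ q g) (hgs : HasCompactSupport g) {ε : ℝ} (hε : 0 < ε) :
    ∃ g₁ : V → E, ContDiff ℝ ∞ g₁ ∧ HasCompactSupport g₁ ∧
      ∀ k ≤ q, ∀ x, ‖iteratedFDeriv ℝ k g₁ x - iteratedFDeriv ℝ k g x‖ < ε := by
  have huc : ∀ k ∈ Finset.range (q + 1), ∀ᶠ r in 𝓝[>] (0 : ℝ), ∀ x y : V, dist x y < r →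
      dist (iteratedFDeriv ℝ k g x) (iteratedFDeriv ℝ k g y) < ε / 2 := fun k hk => by
    have hc : Continuous (iteratedFDeriv ℝ k g) := hg.continuous_iteratedFDeriv
      (by exact_mod_cast Finset.mem_range_succ_iff.1 hk)
    obtain ⟨δ, hδ, h⟩ := Metric.uniformContinuous_iff.1
      (hc.uniformContinuous_of_tendsto_cocompact (hgs.iteratedFDeriv k).is_zero_at_infty) (ε / 2)
      (half_pos hε)
    filter_upwards [Ioo_mem_nhdsGT hδ] with r hr x y hxy
    exact h (hxy.trans hr.2)
  obtain ⟨r, hr, hr0⟩ := (((Filter.eventually_all_finset _).2 huc).and self_mem_nhdsWithin).exists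
  let φ : ContDiffBump (0 : V) := ⟨r / 2, r, half_pos hr0, half_lt_self hr0⟩
  have hφc : Continuous (φ.normed volume) := φ.continuous_normed
  refine ⟨φ.normed volume ⋆[ContinuousLinearMap.lsmul ℝ ℝ, volume] g, ?_, ?_, fun k hk x => ?_⟩
  · exact φ.hasCompactSupport_normed.contDiff_convolution_left _ φ.contDiff_normed
      hg.continuous.locallyIntegrable
  · exact φ.hasCompactSupport_normed.convolution _ hgs
  · rw [iteratedFDeriv_convolution hφc.locallyIntegrable hg hgs hk, ← dist_eq_norm]
    have hc : Continuous (iteratedFDeriv ℝ k g) := hg.continuous_iteratedFDeriv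
      (by exact_mod_cast hk)
    refine (φ.dist_normed_convolution_le hc.aestronglyMeasurable fun y hy => ?_).trans_lt
      (half_lt_self hε)
    exact (hr k (Finset.mem_range_succ_iff.2 hk) y x hy).le

end SmoothApproximation

section FourierApproximation

open MeasureTheory
open scoped FourierTransform

variable {H : Type*} [NormedAddCommGroup H] [InnerProductSpace ℂ H]
  {V : Type*} [NormedAddCommGroup V] [InnerProductSpace ℝ V]
  [FiniteDimensional ℝ V] [MeasurableSpace V] [BorelSpace V]

theorem pow_le_one_add_pow {t : ℝ} (ht : 0 ≤ t) {k q : ℕ} (hk : k ≤ q) : t ^ k ≤ 1 + t ^ q := by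
  rcases le_total t 1 with h | h
  · exact (pow_le_one₀ ht h).trans (le_add_of_nonneg_right (pow_nonneg ht q))
  · exact (pow_le_pow_right₀ h hk).trans (le_add_of_nonneg_left zero_le_one)

omit [InnerProductSpace ℂ H] in
theorem integrable_pow_mul_norm {f : V → H} (hm : AEStronglyMeasurable f volume) {q : ℕ}
    (hf : Integrable fun w => (1 + ‖w‖ ^ q) * ‖f w‖) {k : ℕ} (hk : k ≤ q) :
    Integrable fun w => ‖w‖ ^ k * ‖f w‖ :=
  hf.mono' ((continuous_norm.pow k).aestronglyMeasurable.mul hm.norm) (ae_of_all _ fun w => by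
    rw [norm_mul, norm_norm, norm_pow, norm_norm]
    exact mul_le_mul_of_nonneg_right (pow_le_one_add_pow (norm_nonneg w) hk) (norm_nonneg _))

theorem contDiff_fourier_of_integrable {f : V → H} (hm : AEStronglyMeasurable f volume) {q : ℕ}
    (hf : Integrable fun w => (1 + ‖w‖ ^ q) * ‖f w‖) : ContDiff ℝ q (𝓕 f) :=
  Real.contDiff_fourier (N := q) fun k hk =>
    integrable_pow_mul_norm hm hf (by exact_mod_cast hk)

theorem iteratedFDeriv_fourier_of_integrable {f : V → H} (hm : AEStronglyMeasurable f volume)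
    {q : ℕ} (hf : Integrable fun w => (1 + ‖w‖ ^ q) * ‖f w‖) {k : ℕ} (hk : k ≤ q) :
    iteratedFDeriv ℝ k (𝓕 f) =
      𝓕 (fun v => VectorFourier.fourierPowSMulRight (innerSL ℝ) f v k) :=
  Real.iteratedFDeriv_fourier (N := q) (fun k hk =>
    integrable_pow_mul_norm hm hf (by exact_mod_cast hk)) hm (by exact_mod_cast hk)

theorem tendsto_iteratedFDeriv_fourier {f : V → H} (hm : AEStronglyMeasurable f volume)
    {q : ℕ} (hf : Integrable fun w => (1 + ‖w‖ ^ q) * ‖f w‖) {k : ℕ} (hk : k ≤ q) :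
    Tendsto (iteratedFDeriv ℝ k (𝓕 f)) (cocompact V) (𝓝 0) := by
  rw [iteratedFDeriv_fourier_of_integrable hm hf hk]
  exact tendsto_fourier_cocompact _

theorem norm_iteratedFDeriv_fourier_le {f : V → H} (hm : AEStronglyMeasurable f volume)
    {q : ℕ} (hf : Integrable fun w => (1 + ‖w‖ ^ q) * ‖f w‖) {k : ℕ} (hk : k ≤ q) (x : V) :
    ‖iteratedFDeriv ℝ k (𝓕 f) x‖ ≤ (2 * Real.pi) ^ q * ∫ w, (1 + ‖w‖ ^ q) * ‖f w‖ := by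
  rw [iteratedFDeriv_fourier_of_integrable hm hf hk, fourier_eq_integral_planeWave,
    ← integral_const_mul]
  refine norm_integral_le_of_norm_le (hf.const_mul _) (ae_of_all _ fun w => ?_)
  rw [norm_smul, RCLike.norm_conj, norm_planeWave, one_mul]
  refine (VectorFourier.norm_fourierPowSMulRight_le _ f w k).trans ?_
  rw [mul_assoc]
  have h1 : (2 * Real.pi * ‖innerSL ℝ (E := V)‖) ^ k ≤ (2 * Real.pi) ^ q := by
    have h2 : 1 ≤ 2 * Real.pi := by linarith [Real.pi_gt_three]
    refine le_trans ?_ (pow_le_pow_right₀ h2 hk)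
    refine pow_le_pow_left₀ (by positivity) ?_ k
    exact mul_le_of_le_one_right (by positivity) (norm_innerSL_le (𝕜 := ℝ) (E := V))
  refine mul_le_mul h1 ?_ (by positivity) (by positivity)
  exact mul_le_mul_of_nonneg_right (pow_le_one_add_pow (norm_nonneg w) hk) (norm_nonneg _)

variable [CompleteSpace H] [Nontrivial V]

/-- If the operators `h w` have dense range for `w ≠ 0`, then Fourier transforms of `w ↦ h w (χ w)`
approximate every function whose derivatives up to order `q` vanish at infinity. -/
theorem exists_norm_iteratedFDeriv_fourier_sub_lt {h : V → H →L[ℂ] H} {q : ℕ}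
    (hcont : ContinuousOn h {0}ᶜ) (hm : AEStronglyMeasurable h volume)
    (hd : ∀ w, w ≠ 0 → DenseRange (h w)) {g : V → H} (hg : ContDiff ℝ q g)
    (hg0 : ∀ k ≤ q, Tendsto (iteratedFDeriv ℝ k g) (cocompact V) (𝓝 0)) {ε : ℝ} (hε : 0 < ε) :
    ∃ χ : V → H, Continuous χ ∧ (∃ b, ∀ w, ‖χ w‖ ≤ b) ∧
      ContDiff ℝ q (𝓕 fun w => h w (χ w)) ∧
      ∀ k ≤ q, ∀ x, ‖iteratedFDeriv ℝ k (𝓕 fun w => h w (χ w)) x - iteratedFDeriv ℝ k g x‖ < ε := by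
  obtain ⟨g₁, hg₁, hs₁, h₁⟩ := exists_hasCompactSupport_norm_iteratedFDeriv_sub_lt hg hg0
    (ε := ε / 3) (by positivity)
  obtain ⟨g₂, hg₂, hs₂, h₂⟩ := exists_contDiff_infty_norm_iteratedFDeriv_sub_lt hg₁ hs₁
    (ε := ε / 3) (by positivity)
  let G : SchwartzMap V H := hs₂.toSchwartzMap hg₂
  let ψ : SchwartzMap V H := 𝓕⁻ G
  have hψ : 𝓕 (ψ : V → H) = g₂ := by
    rw [← SchwartzMap.fourier_coe, FourierTransform.fourier_fourierInv_eq]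
    rfl
  have hψi : Integrable fun w => (1 + ‖w‖ ^ q) * ‖ψ w‖ := by
    simp only [add_mul, one_mul]
    exact ψ.integrable.norm.add (ψ.integrable_pow_mul volume q)
  have hW : Continuous fun w : V => 1 + ‖w‖ ^ q := by fun_prop
  obtain ⟨χ, hχ, hb, hi, hlt⟩ := exists_integral_mul_norm_sub_lt volume hcont hm hd ψ.continuous hW
    (fun w => by positivity) hψi (ε := ε / 3 / (2 * Real.pi) ^ q) (by positivity)
  have hmχ : AEStronglyMeasurable (fun w => h w (χ w)) volume :=
    isBoundedBilinearMap_apply.continuous.comp_aestronglyMeasurable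
      (hm.prodMk hχ.aestronglyMeasurable)
  have hmd : AEStronglyMeasurable (fun w => h w (χ w) - ψ w) volume :=
    hmχ.sub ψ.continuous.aestronglyMeasurable
  have hχi : Integrable fun w => (1 + ‖w‖ ^ q) * ‖h w (χ w)‖ := by
    refine (hi.add hψi).mono' (hW.aestronglyMeasurable.mul hmχ.norm) (ae_of_all _ fun w => ?_)
    rw [Real.norm_of_nonneg (by positivity), Pi.add_apply, ← mul_add]
    refine mul_le_mul_of_nonneg_left ?_ (by positivity)
    simpa using norm_add_le (h w (χ w) - ψ w) (ψ w)
  have hint : ∀ {f : V → H}, AEStronglyMeasurable f volume →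
      Integrable (fun w => (1 + ‖w‖ ^ q) * ‖f w‖) → Integrable f := fun hf hf' =>
    (integrable_norm_iff hf).1 (by simpa using integrable_pow_mul_norm hf hf' (Nat.zero_le q))
  have hCd := contDiff_fourier_of_integrable hmχ hχi
  refine ⟨χ, hχ, hb, hCd, fun k hk x => ?_⟩
  have hsub : 𝓕 (fun w => h w (χ w) - ψ w) = 𝓕 (fun w => h w (χ w)) - g₂ := by
    rw [← hψ]
    funext y
    rw [Pi.sub_apply]
    simp only [fourier_eq_integral_planeWave]
    rw [← integral_sub (integrable_planeWave_smul (hint hmχ hχi) y)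
      (integrable_planeWave_smul ψ.integrable y)]
    simp only [smul_sub]
  have hkq : (k : WithTop ℕ∞) ≤ q := by exact_mod_cast hk
  have hg₂' : ContDiff ℝ k g₂ := hg₂.of_le (by exact_mod_cast le_top)
  have h3 : ‖iteratedFDeriv ℝ k (𝓕 fun w => h w (χ w)) x - iteratedFDeriv ℝ k g₂ x‖ < ε / 3 := by
    rw [← iteratedFDeriv_sub_apply (hCd.of_le hkq).contDiffAt hg₂'.contDiffAt, ← hsub]
    refine (norm_iteratedFDeriv_fourier_le hmd hi hk x).trans_lt ?_
    rwa [lt_div_iff₀ (by positivity), mul_comm] at hlt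
  calc _ ≤ ‖iteratedFDeriv ℝ k (𝓕 fun w => h w (χ w)) x - iteratedFDeriv ℝ k g₂ x‖ +
        ‖iteratedFDeriv ℝ k g₂ x - iteratedFDeriv ℝ k g₁ x‖ +
        ‖iteratedFDeriv ℝ k g₁ x - iteratedFDeriv ℝ k g x‖ := by
        refine le_trans (le_of_eq ?_) norm_add₃_le
        congr 1
        abel
    _ < ε / 3 + ε / 3 + ε / 3 := add_lt_add (add_lt_add h3 (h₂ k hk x)) (h₁ k hk x)
    _ = ε := by ring

end FourierApproximation

/-! ### Partial derivatives and iterated Fréchet derivatives -/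

section PartialDerivatives

variable {m : ℕ} {E : Type*} [NormedAddCommGroup E] [NormedSpace ℝ E]

/-- The list of indices in which `i` occurs `α i` times, in increasing order. -/
def indexList (α : Fin m → ℕ) : List (Fin m) :=
  (List.finRange m).flatMap fun i => List.replicate (α i) i

theorem multiDeriv_eq_foldr (α : Fin m → ℕ) (f : EuclideanSpace ℝ (Fin m) → E) :
    multiDeriv α f = (indexList α).foldr partialDeriv f := by
  have h1 : ∀ (i : Fin m) (n : ℕ) (g : EuclideanSpace ℝ (Fin m) → E),
      (partialDeriv i)^[n] g = (List.replicate n i).foldr partialDeriv g := fun i n g => by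
    induction n with
    | zero => rfl
    | succ n ih => rw [Function.iterate_succ_apply', ih, List.replicate_succ, List.foldr_cons]
  have h2 : ∀ l : List (Fin m), l.foldr (fun i g => (partialDeriv i)^[α i] g) f =
      (l.flatMap fun i => List.replicate (α i) i).foldr partialDeriv f := fun l => by
    induction l with
    | nil => rfl
    | cons i l ih => rw [List.foldr_cons, ih, h1, List.flatMap_cons, List.foldr_append]
  exact h2 _

theorem count_indexList (α : Fin m → ℕ) (i : Fin m) : (indexList α).count i = α i := by
  rw [indexList, List.count_flatMap, ← Fin.sum_univ_def]
  simp [List.count_replicate]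

theorem length_indexList (α : Fin m → ℕ) : (indexList α).length = ∑ i, α i := by
  rw [indexList, List.length_flatMap, Fin.sum_univ_def]
  simp

theorem mem_multiIndices {q : ℕ} {α : Fin m → ℕ} : α ∈ multiIndices m q ↔ ∑ i, α i ≤ q := by
  rw [multiIndices, Finset.mem_filter, Fintype.mem_piFinset, and_iff_right_iff_imp]
  intro h i
  exact Finset.mem_range_succ_iff.2
    ((Finset.single_le_sum (f := α) (fun j _ => Nat.zero_le _) (Finset.mem_univ i)).trans h)

theorem contDiff_partialDeriv {n : ℕ} {f : EuclideanSpace ℝ (Fin m) → E}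
    (hf : ContDiff ℝ (n + 1 : ℕ) f) (i : Fin m) : ContDiff ℝ n (partialDeriv i f) := by
  have e : partialDeriv i f = fun x => fderiv ℝ f x (EuclideanSpace.single i 1) := funext fun x =>
    ((hf.differentiable (by simp)) x).lineDeriv_eq_fderiv
  rw [e]
  exact (hf.fderiv_right (by exact_mod_cast le_rfl)).clm_apply contDiff_const

theorem contDiff_foldr_partialDeriv (l : List (Fin m)) {n : ℕ} {f : EuclideanSpace ℝ (Fin m) → E}
    (hf : ContDiff ℝ (n + l.length : ℕ) f) : ContDiff ℝ n (l.foldr partialDeriv f) := by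
  induction l generalizing n with
  | nil => exact hf
  | cons i l ih =>
    rw [List.foldr_cons]
    refine contDiff_partialDeriv (ih ?_) i
    rwa [List.length_cons, add_comm l.length, ← add_assoc] at hf

theorem foldr_partialDeriv_eq_iteratedFDeriv (l : List (Fin m))
    {f : EuclideanSpace ℝ (Fin m) → E} (hf : ContDiff ℝ l.length f)
    (x : EuclideanSpace ℝ (Fin m)) :
    l.foldr partialDeriv f x =
      iteratedFDeriv ℝ l.length f x fun k => EuclideanSpace.single (l.get k) 1 := by
  induction l generalizing x with
  | nil => simp
  | cons i l ih =>
    have hf' : ContDiff ℝ l.length f := hf.of_le (by simp)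
    rw [List.foldr_cons, partialDeriv, funext (ih hf')]
    have hd : DifferentiableAt ℝ (iteratedFDeriv ℝ l.length f) x :=
      (hf.differentiable_iteratedFDeriv (by
        rw [List.length_cons]; exact_mod_cast Nat.lt_succ_self _)) x
    have hd2 : DifferentiableAt ℝ (fun x => iteratedFDeriv ℝ l.length f x
        fun k => EuclideanSpace.single (l.get k) (1 : ℝ)) x :=
      (ContinuousMultilinearMap.apply ℝ (fun _ => EuclideanSpace ℝ (Fin m)) E
        fun k => EuclideanSpace.single (l.get k) (1 : ℝ)).differentiableAt.comp x hd
    rw [hd2.lineDeriv_eq_fderiv]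
    have e := ((ContinuousMultilinearMap.apply ℝ (fun _ => EuclideanSpace ℝ (Fin m)) E
        fun k => EuclideanSpace.single (l.get k) (1 : ℝ)).hasFDerivAt.comp x hd.hasFDerivAt).fderiv
    refine (congrArg (fun T => T (EuclideanSpace.single i (1 : ℝ))) e).trans ?_
    rfl

/-- Partial derivatives of sufficiently smooth functions commute. -/
theorem foldr_partialDeriv_perm {l l' : List (Fin m)} (h : l.Perm l')
    {f : EuclideanSpace ℝ (Fin m) → E} (hf : ContDiff ℝ l.length f) :
    l.foldr partialDeriv f = l'.foldr partialDeriv f := by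
  induction h with
  | nil => rfl
  | cons i _ ih => rw [List.foldr_cons, List.foldr_cons, ih (hf.of_le (by simp))]
  | swap i j l =>
    simp only [List.foldr_cons]
    have h2 : ContDiff ℝ 2 (l.foldr partialDeriv f) := by
      refine contDiff_foldr_partialDeriv (n := 2) l (hf.of_le ?_)
      simp only [List.length_cons]
      exact_mod_cast (by omega : 2 + l.length ≤ l.length + 1 + 1)
    set g := l.foldr partialDeriv f
    have hg : ∀ i, partialDeriv i g = fun x => fderiv ℝ g x (EuclideanSpace.single i 1) :=
      fun i => funext fun x => ((h2.differentiable (by simp)) x).lineDeriv_eq_fderiv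
    have hg2 : ∀ (i j : Fin m) x, partialDeriv j (partialDeriv i g) x =
        fderiv ℝ (fderiv ℝ g) x (EuclideanSpace.single j 1) (EuclideanSpace.single i 1) := by
      intro i j x
      have hd : DifferentiableAt ℝ (fderiv ℝ g) x :=
        ((h2.fderiv_right (m := 1) (by norm_num)).differentiable (by simp)) x
      rw [hg i, partialDeriv, (hd.clm_apply (differentiableAt_const _)).lineDeriv_eq_fderiv,
        fderiv_clm_apply hd (differentiableAt_const _)]
      simp
    funext x
    rw [hg2, hg2]
    exact (h2.contDiffAt.isSymmSndFDerivAt (by simp)) _ _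
  | trans h₁ _ ih₁ ih₂ => rw [ih₁ hf, ih₂ (h₁.length_eq ▸ hf)]

/-- Partial derivatives are values of the iterated derivative on basis vectors. -/
theorem multiDeriv_eq_iteratedFDeriv {α : Fin m → ℕ} {n : ℕ} (hα : ∑ i, α i = n)
    {f : EuclideanSpace ℝ (Fin m) → E} (hf : ContDiff ℝ n f) :
    ∃ j : Fin n → Fin m, ∀ x, multiDeriv α f x =
      iteratedFDeriv ℝ n f x fun k => EuclideanSpace.single (j k) 1 := by
  rw [← length_indexList] at hα
  subst hα
  refine ⟨(indexList α).get, fun x => ?_⟩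
  rw [multiDeriv_eq_foldr, foldr_partialDeriv_eq_iteratedFDeriv _ hf]

/-- Values of the iterated derivative on basis vectors are partial derivatives. -/
theorem exists_multiDeriv_eq_iteratedFDeriv {n : ℕ} (j : Fin n → Fin m)
    {f : EuclideanSpace ℝ (Fin m) → E} (hf : ContDiff ℝ n f) :
    ∃ α ∈ multiIndices m n, ∀ x, multiDeriv α f x =
      iteratedFDeriv ℝ n f x fun k => EuclideanSpace.single (j k) 1 := by
  have hl : (List.ofFn j).length = n := List.length_ofFn
  have hp : (indexList fun i => (List.ofFn j).count i).Perm (List.ofFn j) :=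
    List.perm_iff_count.2 fun i => by rw [count_indexList]
  refine ⟨fun i => (List.ofFn j).count i, ?_, fun x => ?_⟩
  · rw [mem_multiIndices, ← length_indexList, hp.length_eq, hl]
  · rw [multiDeriv_eq_foldr, foldr_partialDeriv_perm hp (by rwa [hp.length_eq, hl]),
      foldr_partialDeriv_eq_iteratedFDeriv _ (by rwa [hl])]
    have key : ∀ (l : List (Fin m)) (hl : l.length = n) (hj : ∀ k, l.get (Fin.cast hl.symm k) = j k),
        (iteratedFDeriv ℝ l.length f x fun k => EuclideanSpace.single (l.get k) (1 : ℝ)) =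
          iteratedFDeriv ℝ n f x fun k => EuclideanSpace.single (j k) 1 := by
      intro l hl hj
      subst hl
      congr 1
      funext k
      rw [← hj k]
      rfl
    exact key _ hl fun k => by simp

theorem norm_multilinear_le_sum {n : ℕ}
    (T : ContinuousMultilinearMap ℝ (fun _ : Fin n => EuclideanSpace ℝ (Fin m)) E) :
    ‖T‖ ≤ ∑ j : Fin n → Fin m, ‖T fun k => EuclideanSpace.single (j k) 1‖ := by
  classical
  refine T.opNorm_le_bound (Finset.sum_nonneg fun _ _ => norm_nonneg _) fun v => ?_
  have e : v = fun k => ∑ i, v k i • EuclideanSpace.single i (1 : ℝ) := by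
    funext k
    ext a
    simp [Finset.sum_apply, Pi.single_apply]
  have e2 : T v = ∑ j : Fin n → Fin m,
      (∏ k, v k (j k)) • T fun k => EuclideanSpace.single (j k) 1 := by
    conv_lhs => rw [e]
    rw [← ContinuousMultilinearMap.coe_coe, MultilinearMap.map_sum]
    exact Finset.sum_congr rfl fun j _ => MultilinearMap.map_smul_univ _ _ _
  rw [e2, Finset.sum_mul]
  refine norm_sum_le_of_le _ fun j _ => ?_
  rw [norm_smul, mul_comm]
  refine mul_le_mul_of_nonneg_left ?_ (norm_nonneg _)
  rw [norm_prod]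
  exact Finset.prod_le_prod (fun _ _ => norm_nonneg _) fun k _ => PiLp.norm_apply_le (v k) (j k)

/-- If all partial derivatives vanish at infinity, then so do the iterated Fréchet derivatives. -/
theorem tendsto_iteratedFDeriv_of_mem_C0q {q : ℕ} {g : EuclideanSpace ℝ (Fin m) → E}
    (hg : g ∈ C0q m E q) {k : ℕ} (hk : k ≤ q) :
    Tendsto (iteratedFDeriv ℝ k g) (cocompact (EuclideanSpace ℝ (Fin m))) (𝓝 0) := by
  refine squeeze_zero_norm (fun x => norm_multilinear_le_sum _) ?_
  rw [← Finset.sum_const_zero (s := (Finset.univ : Finset (Fin k → Fin m)))]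
  refine tendsto_finsetSum _ fun j _ => ?_
  have hgk : ContDiff ℝ k g :=
    (show ContDiff ℝ q g from hg.1).of_le (by exact_mod_cast hk)
  obtain ⟨α, hα, h⟩ := exists_multiDeriv_eq_iteratedFDeriv j hgk
  simp only [← h]
  have := (hg.2 α (mem_multiIndices.2 ((mem_multiIndices.1 hα).trans hk))).2
  simpa using this.norm

theorem mem_C0q_of_tendsto {q : ℕ} {g : EuclideanSpace ℝ (Fin m) → E} (hg : ContDiff ℝ q g)
    (h : ∀ k ≤ q, Tendsto (iteratedFDeriv ℝ k g) (cocompact (EuclideanSpace ℝ (Fin m))) (𝓝 0)) :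
    g ∈ C0q m E q := by
  refine ⟨hg, fun α hα => ?_⟩
  rw [mem_multiIndices] at hα
  have hgk : ContDiff ℝ (∑ i, α i : ℕ) g := hg.of_le (by exact_mod_cast hα)
  obtain ⟨j, hj⟩ := multiDeriv_eq_iteratedFDeriv rfl hgk
  rw [funext hj]
  refine ⟨?_, ?_⟩
  · exact (ContinuousMultilinearMap.apply ℝ (fun _ => EuclideanSpace ℝ (Fin m)) E _).continuous.comp
      (hgk.continuous_iteratedFDeriv le_rfl)
  · have := ((ContinuousMultilinearMap.apply ℝ (fun _ => EuclideanSpace ℝ (Fin m)) E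
      fun k => EuclideanSpace.single (j k) (1 : ℝ)).continuous.tendsto 0).comp (h _ hα)
    simpa [Function.comp_def] using this

/-- If all the derivatives of `f` and `g` up to order `q` are uniformly close, then so are the
partial derivatives. -/
theorem sum_norm_multiDeriv_sub_lt {q : ℕ} {f g : EuclideanSpace ℝ (Fin m) → E}
    (hf : ContDiff ℝ q f) (hg : ContDiff ℝ q g) {ε : ℝ} {x : EuclideanSpace ℝ (Fin m)}
    (h : ∀ k ≤ q, ‖iteratedFDeriv ℝ k f x - iteratedFDeriv ℝ k g x‖ <
      ε / (multiIndices m q).card) :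
    ∑ α ∈ multiIndices m q, ‖multiDeriv α f x - multiDeriv α g x‖ < ε := by
  have hne : (multiIndices m q).Nonempty := ⟨0, mem_multiIndices.2 (by simp)⟩
  have hcard : ((multiIndices m q).card : ℝ) ≠ 0 := by exact_mod_cast hne.card_pos.ne'
  have e : ε = ∑ _α ∈ multiIndices m q, ε / (multiIndices m q).card := by
    rw [Finset.sum_const, nsmul_eq_mul, mul_div_cancel₀ _ hcard]
  rw [e]
  refine Finset.sum_lt_sum_of_nonempty hne fun α hα => ?_
  rw [mem_multiIndices] at hα
  have hle : ((∑ i, α i : ℕ) : WithTop ℕ∞) ≤ q := by exact_mod_cast hα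
  have hl : ((indexList α).length : WithTop ℕ∞) ≤ q := by rwa [length_indexList]
  rw [multiDeriv_eq_foldr, multiDeriv_eq_foldr,
    foldr_partialDeriv_eq_iteratedFDeriv _ (hf.of_le hl),
    foldr_partialDeriv_eq_iteratedFDeriv _ (hg.of_le hl), ← sub_apply]
  refine lt_of_le_of_lt ?_ (h (indexList α).length (by rwa [length_indexList]))
  refine (ContinuousMultilinearMap.le_opNorm _ _).trans_eq ?_
  simp

end PartialDerivatives

/-! ### Strict positive definiteness and universality -/

section StrictPosDef

variable {X : Type*} {H : Type*} [NormedAddCommGroup H] [InnerProductSpace ℂ H] [CompleteSpace H]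
  {K : X → X → H →L[ℂ] H}

/-- If the functions in the reproducing kernel Hilbert space interpolate arbitrary values at
finitely many points up to an arbitrarily small error, then the kernel is strictly positive
definite: a vanishing combination of kernel functions is orthogonal to the whole space. -/
theorem IsPosDefKernel.isStrictlyPosDefKernel (hK : IsPosDefKernel K)
    (h : ∀ (n : ℕ) (x : Fin n → X), Function.Injective x → ∀ (v : Fin n → H) (ε : ℝ), 0 < ε →
      ∃ f ∈ rkhs hK, ∀ i, ‖f (x i) - v i‖ < ε) : IsStrictlyPosDefKernel K := by
  refine ⟨hK, fun n x hx v h0 => ?_⟩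
  have : Fact (Matrix.of K).PosSemidef := ⟨hK.posSemidef⟩
  let k : RKHS.OfKernel (Matrix.of K) :=
    ∑ i, RKHS.kerFun (RKHS.OfKernel (Matrix.of K)) (x i) (v i)
  have hk : k = 0 := by
    rw [← inner_self_eq_zero (𝕜 := ℂ), ← h0, sum_inner]
    refine Finset.sum_congr rfl fun i _ => ?_
    rw [inner_sum]
    refine Finset.sum_congr rfl fun j _ => ?_
    rw [RKHS.kerFun_inner, RKHS.kerFun_apply, RKHS.OfKernel.kernel_ofKernel]
    rfl
  have horth : ∀ f ∈ rkhs hK, ∑ i, inner ℂ (v i) (f (x i)) = 0 := by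
    rintro _ ⟨g, rfl⟩
    have : inner ℂ k g = 0 := by rw [hk, inner_zero_left]
    simpa only [k, sum_inner, RKHS.kerFun_inner] using this
  have hle : ∀ ε : ℝ, 0 < ε → ∑ i, ‖v i‖ ^ 2 ≤ ε * ∑ i, ‖v i‖ := fun ε hε => by
    obtain ⟨f, hf, hfx⟩ := h n x hx v ε hε
    have e : ((∑ i, ‖v i‖ ^ 2 : ℝ) : ℂ) = ∑ i, inner ℂ (v i) (v i - f (x i)) := by
      simp only [inner_sub_right, Finset.sum_sub_distrib, horth f hf, sub_zero]
      push_cast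
      exact Finset.sum_congr rfl fun i _ => (inner_self_eq_norm_sq_to_K (𝕜 := ℂ) (v i)).symm
    have e2 : ∑ i, ‖v i‖ ^ 2 = ‖∑ i, inner ℂ (v i) (v i - f (x i))‖ := by
      rw [← e, Complex.norm_real, Real.norm_of_nonneg (Finset.sum_nonneg fun i _ => sq_nonneg _)]
    rw [e2, Finset.mul_sum]
    refine norm_sum_le_of_le _ fun i _ => (norm_inner_le_norm _ _).trans ?_
    rw [mul_comm, norm_sub_rev]
    exact mul_le_mul_of_nonneg_right (hfx i).le (norm_nonneg _)
  have hzero : ∑ i, ‖v i‖ ^ 2 ≤ 0 := by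
    refine ge_of_tendsto (f := fun ε : ℝ => ε * ∑ i, ‖v i‖) (x := 𝓝[>] 0) ?_ ?_
    · have : Tendsto (fun ε : ℝ => ε * ∑ i, ‖v i‖) (𝓝 0) (𝓝 (0 * ∑ i, ‖v i‖)) := by
        apply Continuous.tendsto
        fun_prop
      simpa using this.mono_left nhdsWithin_le_nhds
    · filter_upwards [self_mem_nhdsWithin] with ε hε
      exact hle ε hε
  intro i
  have := (Finset.single_le_sum (f := fun i => ‖v i‖ ^ 2) (fun j _ => sq_nonneg _)
    (Finset.mem_univ i)).trans hzero
  simpa using this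

end StrictPosDef

section Interpolation

variable {V : Type*} [NormedAddCommGroup V] [NormedSpace ℝ V] [FiniteDimensional ℝ V]
  {H : Type*} [NormedAddCommGroup H] [NormedSpace ℝ H]

/-- Interpolation at finitely many points by compactly supported functions of class `C^q`. -/
theorem exists_contDiff_hasCompactSupport_apply_eq (q : ℕ) {n : ℕ} {x : Fin n → V}
    (hx : Function.Injective x) (v : Fin n → H) :
    ∃ g : V → H, ContDiff ℝ q g ∧ HasCompactSupport g ∧ ∀ i, g (x i) = v i := by
  have hb : ∀ i, ∃ f : V → ℝ, HasCompactSupport f ∧ ContDiff ℝ q f ∧ f (x i) = 1 ∧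
      ∀ j, j ≠ i → f (x j) = 0 := fun i => by
    have hs : (x '' {i}ᶜ)ᶜ ∈ 𝓝 (x i) :=
      ((Set.toFinite _).image x).isClosed.isOpen_compl.mem_nhds (by
        rintro ⟨j, hj, hji⟩
        exact hj (hx hji))
    obtain ⟨f, hf, hfc, hfd, -, hf1⟩ := exists_contDiff_tsupport_subset (n := q) hs
    refine ⟨f, hfc, by exact_mod_cast hfd, hf1, fun j hj => ?_⟩
    by_contra h0
    exact hf (subset_tsupport f h0) ⟨j, hj, rfl⟩
  choose f hfc hfd hf1 hf0 using hb
  refine ⟨fun y => ∑ i, f i y • v i, ContDiff.sum fun i _ => (hfd i).smul contDiff_const, ?_,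
    fun i => ?_⟩
  · have : (fun y => ∑ i, f i y • v i) = ∑ i, fun y => f i y • v i := by
      funext y
      rw [Finset.sum_apply]
    rw [this]
    exact Finset.sum_induction (fun i y => f i y • v i) HasCompactSupport
      (fun _ _ => HasCompactSupport.add) HasCompactSupport.zero fun i _ =>
        (hfc i).smul_right (f' := fun _ => v i)
  · simp only
    rw [Finset.sum_eq_single i (fun j _ hj => by rw [hf0 j i hj.symm, zero_smul])
      (fun hi => absurd (Finset.mem_univ i) hi), hf1, one_smul]

end Interpolation

section Universality

open MeasureTheory
open scoped FourierTransform

variable {H : Type*} [NormedAddCommGroup H] [InnerProductSpace ℂ H]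

theorem tendsto_iteratedFDeriv_of_hasCompactSupport {V : Type*} [NormedAddCommGroup V]
    [NormedSpace ℝ V] {E : Type*} [NormedAddCommGroup E] [NormedSpace ℝ E] {g : V → E}
    (hg : HasCompactSupport g) (k : ℕ) :
    Tendsto (iteratedFDeriv ℝ k g) (cocompact V) (𝓝 0) :=
  (hg.iteratedFDeriv k).is_zero_at_infty

theorem multiDeriv_zero {m : ℕ} {E : Type*} [NormedAddCommGroup E] [NormedSpace ℝ E]
    (f : EuclideanSpace ℝ (Fin m) → E) : multiDeriv 0 f = f := by
  rw [multiDeriv_eq_foldr, List.eq_nil_of_length_eq_zero (l := indexList (0 : Fin m → ℕ))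
    (by rw [length_indexList]; simp), List.foldr_nil]

theorem C0q_subset_C0 (m : ℕ) (E : Type*) [NormedAddCommGroup E] [NormedSpace ℝ E] (q : ℕ) :
    C0q m E q ⊆ C0 m E := fun f hf => by
  have h := hf.2 0 (mem_multiIndices.2 (by simp))
  rwa [multiDeriv_zero] at h

theorem norm_sub_le_sum_multiDeriv {m : ℕ} {E : Type*} [NormedAddCommGroup E] [NormedSpace ℝ E]
    (q : ℕ) (f g : EuclideanSpace ℝ (Fin m) → E) (x : EuclideanSpace ℝ (Fin m)) :
    ‖f x - g x‖ ≤ ∑ α ∈ multiIndices m q, ‖multiDeriv α f x - multiDeriv α g x‖ := by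
  have := Finset.single_le_sum (f := fun α => ‖multiDeriv α f x - multiDeriv α g x‖)
    (fun α _ => norm_nonneg _) (mem_multiIndices.2 (by simp) : (0 : Fin m → ℕ) ∈ multiIndices m q)
  simpa only [multiDeriv_zero] using this

variable [CompleteSpace H] {m : ℕ}
  {K : EuclideanSpace ℝ (Fin m) → EuclideanSpace ℝ (Fin m) → H →L[ℂ] H}

/-- Approximation of compactly supported functions suffices for strict positive definiteness. -/
theorem isStrictlyPosDefKernel_of_approx (hK : IsPosDefKernel K) (q : ℕ)
    (h : ∀ g : EuclideanSpace ℝ (Fin m) → H, ContDiff ℝ q g → HasCompactSupport g →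
      ∀ A : Set (EuclideanSpace ℝ (Fin m)), IsCompact A → ∀ ε : ℝ, 0 < ε → ∃ f ∈ rkhs hK, ∀ x ∈ A,
        ∑ α ∈ multiIndices m q, ‖multiDeriv α f x - multiDeriv α g x‖ < ε) :
    IsStrictlyPosDefKernel K := by
  refine hK.isStrictlyPosDefKernel fun n x hx v ε hε => ?_
  obtain ⟨g, hg, hgc, hgx⟩ := exists_contDiff_hasCompactSupport_apply_eq q hx v
  obtain ⟨f, hf, hfx⟩ := h g hg hgc (Set.range x) (Set.finite_range x).isCompact ε hε
  refine ⟨f, hf, fun i => ?_⟩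
  rw [← hgx i]
  exact (norm_sub_le_sum_multiDeriv q f g (x i)).trans_lt (hfx _ ⟨i, rfl⟩)

theorem IsCqUniversal.isStrictlyPosDefKernel {hK : IsPosDefKernel K} {q : ℕ}
    (h : IsCqUniversal hK q) : IsStrictlyPosDefKernel K :=
  isStrictlyPosDefKernel_of_approx hK q fun g hg _ A hA ε hε => h.2 A hA g hg ε hε

theorem IsC0qUniversal.isStrictlyPosDefKernel {hK : IsPosDefKernel K} {q : ℕ}
    (h : IsC0qUniversal hK q) : IsStrictlyPosDefKernel K :=
  isStrictlyPosDefKernel_of_approx hK q fun g hg hgc _ _ ε hε => by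
    obtain ⟨f, hf, hfx⟩ := h.2.2 g (mem_C0q_of_tendsto hg fun k _ =>
      tendsto_iteratedFDeriv_of_hasCompactSupport hgc k) ε hε
    exact ⟨f, hf, fun x _ => hfx x⟩

variable {C : H →L[ℂ] H} {h : EuclideanSpace ℝ (Fin m) → H →L[ℂ] H}

/-- The representation of `IsFourierKernel.exists_eq_add_fourier` for the weight `1 + ‖w‖ ^ q`. -/
theorem IsFourierKernel.exists_eq_of_mem_rkhs (hF : IsFourierKernel K C h) (hK : IsPosDefKernel K)
    {q : ℕ} (hint : ∀ n ≤ 2 * q, Integrable fun w => ‖w‖ ^ n * ‖h w‖)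
    {f : EuclideanSpace ℝ (Fin m) → H} (hf : f ∈ rkhs hK) :
    ∃ (c : H) (ζ : EuclideanSpace ℝ (Fin m) → H), (C = 0 → c = 0) ∧
      AEStronglyMeasurable ζ ∧ (Integrable fun w => (1 + ‖w‖ ^ q) * ‖ζ w‖) ∧
      f = fun x => c + 𝓕 ζ x := by
  have : Fact (Matrix.of K).PosSemidef := ⟨hK.posSemidef⟩
  obtain ⟨g, rfl⟩ := hf
  obtain ⟨c, ζ, hc, hζ, hi, he⟩ := hF.exists_eq_add_fourier (ρ := fun w => 1 + ‖w‖ ^ q)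
    (by fun_prop) (fun w => le_add_of_nonneg_right (by positivity)) (by
      refine (((hint 0 (Nat.zero_le _)).add ((hint q (by omega)).const_mul 2)).add
        (hint (2 * q) le_rfl)).congr (ae_of_all _ fun w => ?_)
      simp only [Pi.add_apply, pow_zero, pow_mul, mul_comm 2 q]
      ring) g
  exact ⟨c, ζ, hc, hζ, hi, funext he⟩

theorem IsFourierKernel.rkhs_subset_Cq (hF : IsFourierKernel K C h) (hK : IsPosDefKernel K)
    {q : ℕ} (hint : ∀ n ≤ 2 * q, Integrable fun w => ‖w‖ ^ n * ‖h w‖) :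
    rkhs hK ⊆ Cq m H q := by
  intro f hf
  obtain ⟨c, ζ, -, hζ, hi, rfl⟩ := hF.exists_eq_of_mem_rkhs hK hint hf
  exact contDiff_const.add (contDiff_fourier_of_integrable hζ hi)

theorem IsFourierKernel.rkhs_subset_C0q (hF : IsFourierKernel K C h) (hK : IsPosDefKernel K)
    {q : ℕ} (hint : ∀ n ≤ 2 * q, Integrable fun w => ‖w‖ ^ n * ‖h w‖) (hC : C = 0) :
    rkhs hK ⊆ C0q m H q := by
  intro f hf
  obtain ⟨c, ζ, hc, hζ, hi, rfl⟩ := hF.exists_eq_of_mem_rkhs hK hint hf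
  simp only [hc hC, zero_add]
  exact mem_C0q_of_tendsto (contDiff_fourier_of_integrable hζ hi) fun k hk =>
    tendsto_iteratedFDeriv_fourier hζ hi hk

variable [Nontrivial (EuclideanSpace ℝ (Fin m))]

/-- Density of the reproducing kernel Hilbert space in `C_0^q`. -/
theorem IsFourierKernel.exists_mem_rkhs_sum_lt (hF : IsFourierKernel K C h)
    (hK : IsPosDefKernel K) {q : ℕ} (hcont : ContinuousOn h {0}ᶜ)
    (hd : ∀ w, w ≠ 0 → DenseRange (h w)) {g : EuclideanSpace ℝ (Fin m) → H} (hg : ContDiff ℝ q g)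
    (hg0 : ∀ k ≤ q, Tendsto (iteratedFDeriv ℝ k g) (cocompact (EuclideanSpace ℝ (Fin m))) (𝓝 0))
    {ε : ℝ} (hε : 0 < ε) :
    ∃ f ∈ rkhs hK, ∀ x, ∑ α ∈ multiIndices m q, ‖multiDeriv α f x - multiDeriv α g x‖ < ε := by
  have : Fact (Matrix.of K).PosSemidef := ⟨hK.posSemidef⟩
  have hne : (multiIndices m q).Nonempty := ⟨0, mem_multiIndices.2 (by simp)⟩
  obtain ⟨χ, hχ, ⟨b, hb⟩, hCd, hlt⟩ := exists_norm_iteratedFDeriv_fourier_sub_lt hcont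
    hF.integrable.aestronglyMeasurable hd hg hg0
    (ε := ε / (multiIndices m q).card) (div_pos hε (by exact_mod_cast hne.card_pos))
  obtain ⟨f, hf⟩ := hF.exists_coe_eq_fourier hχ hb
  refine ⟨f, ⟨f, rfl⟩, fun x => ?_⟩
  rw [funext hf]
  exact sum_norm_multiDeriv_sub_lt hCd hg fun k hk => hlt k hk x

theorem IsFourierKernel.isC0qUniversal (hF : IsFourierKernel K C h) (hK : IsPosDefKernel K)
    {q : ℕ} (hint : ∀ n ≤ 2 * q, Integrable fun w => ‖w‖ ^ n * ‖h w‖) (hC : C = 0)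
    (hcont : ContinuousOn h {0}ᶜ) (hd : ∀ w, w ≠ 0 → DenseRange (h w)) :
    IsC0qUniversal hK q := by
  exact ⟨hF.rkhs_subset_Cq hK hint, (hF.rkhs_subset_C0q hK hint hC).trans (C0q_subset_C0 m H q),
    fun g hg ε hε => hF.exists_mem_rkhs_sum_lt hK hcont hd hg.1
      (fun k hk => tendsto_iteratedFDeriv_of_mem_C0q hg hk) hε⟩

theorem IsFourierKernel.isCqUniversal (hF : IsFourierKernel K C h) (hK : IsPosDefKernel K)
    {q : ℕ} (hint : ∀ n ≤ 2 * q, Integrable fun w => ‖w‖ ^ n * ‖h w‖)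
    (hcont : ContinuousOn h {0}ᶜ) (hd : ∀ w, w ≠ 0 → DenseRange (h w)) :
    IsCqUniversal hK q := by
  refine ⟨hF.rkhs_subset_Cq hK hint, fun A hA g hg ε hε => ?_⟩
  obtain ⟨R, hR0, hR⟩ := hA.isBounded.subset_ball_lt 0 0
  -- Replace `g` by a compactly supported function that agrees with it near `A`.
  let φ : ContDiffBump (0 : EuclideanSpace ℝ (Fin m)) := ⟨R, R + 1, hR0, lt_add_one R⟩
  have hg' : ContDiff ℝ q fun x => φ x • g x := φ.contDiff.smul hg
  obtain ⟨f, hf, hfx⟩ := hF.exists_mem_rkhs_sum_lt hK hcont hd hg' (fun k _ =>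
    tendsto_iteratedFDeriv_of_hasCompactSupport (φ.hasCompactSupport.smul_right (f' := g)) k) hε
  refine ⟨f, hf, fun x hx => ?_⟩
  have heq : (fun x => φ x • g x) =ᶠ[𝓝 x] g := by
    filter_upwards [Metric.isOpen_ball.mem_nhds (hR hx)] with y hy
    rw [φ.one_of_mem_closedBall (Metric.ball_subset_closedBall hy), one_smul]
  have hα : ∀ α ∈ multiIndices m q, multiDeriv α (fun x => φ x • g x) x = multiDeriv α g x := by
    intro α hα
    rw [mem_multiIndices, ← length_indexList] at hα
    have hl : ((indexList α).length : WithTop ℕ∞) ≤ q := by exact_mod_cast hα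
    rw [multiDeriv_eq_foldr, multiDeriv_eq_foldr,
      foldr_partialDeriv_eq_iteratedFDeriv _ (hg'.of_le hl),
      foldr_partialDeriv_eq_iteratedFDeriv _ ((show ContDiff ℝ q g from hg).of_le hl),
      (heq.iteratedFDeriv ℝ _).eq_of_nhds]
  refine lt_of_eq_of_lt (Finset.sum_congr rfl fun α h => ?_) (hfx x)
  rw [hα α h]

end Universality

/-! ### Radial kernels as Fourier kernels -/

section RadialKernels

open MeasureTheory
open scoped FourierTransform

variable {H : Type*} [NormedAddCommGroup H] [InnerProductSpace ℂ H]

theorem tendsto_nnnorm_cocompact_atTop (V : Type*) [NormedAddCommGroup V] [ProperSpace V] :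
    Tendsto (fun x : V => ‖x‖₊) (cocompact V) atTop :=
  tendsto_atTop.2 fun r => by
    filter_upwards [(tendsto_norm_cocompact_atTop (E := V)).eventually_ge_atTop (r : ℝ)] with x hx
    exact_mod_cast hx

theorem tendsto_nnreal_smul_cocompact {V : Type*} [NormedAddCommGroup V] [NormedSpace ℝ V]
    [ProperSpace V] {e : V} (he : ‖e‖ = 1) :
    Tendsto (fun t : ℝ≥0 => (t : ℝ) • e) atTop (cocompact V) := by
  rw [← Metric.cobounded_eq_cocompact, ← tendsto_norm_atTop_iff_cobounded]
  simp only [norm_smul, he, mul_one, NNReal.norm_eq]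
  exact NNReal.tendsto_coe_atTop.2 tendsto_id

variable {F : ℝ≥0 → H →L[ℂ] H} {m : ℕ}

/-- If `⟨F(t) v, v⟩` is constant, the weights `v` and `-v` at two points annihilate the kernel form. -/
theorem inner_ne_const_of_isStrictlyPosDefKernel [Nontrivial (EuclideanSpace ℝ (Fin m))]
    (hF : IsStrictlyPosDefKernel (radialKernel m F)) (v : H) (hv : v ≠ 0) :
    ¬ ∃ c : ℂ, ∀ t : ℝ≥0, inner ℂ v (F t v) = c := by
  rintro ⟨c, hc⟩
  obtain ⟨x, hx⟩ := exists_ne (0 : EuclideanSpace ℝ (Fin m))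
  have hinj : Function.Injective ![x, 0] := by
    intro i j hij
    fin_cases i <;> fin_cases j <;> simp_all
  refine hv ?_
  have h := hF.2 2 ![x, 0] hinj ![v, -v] (by
    simp [Fin.sum_univ_two, radialKernel, hc]) 0
  simpa using h

theorem exists_inner_ne_zero_of_isStrictlyPosDefKernel
    (hF : IsStrictlyPosDefKernel (radialKernel m F)) (v : H) (hv : v ≠ 0) :
    ∃ t : ℝ≥0, inner ℂ v (F t v) ≠ 0 := by
  by_contra! hc
  refine hv ?_
  have h := hF.2 1 ![0] (Function.injective_of_subsingleton _) ![v] (by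
    simp [radialKernel, hc]) 0
  simpa using h

theorem ne_const_of_isC0 {f : ℝ≥0 → ℂ} (hf : IsC0 f) (h0 : ∃ t, f t ≠ 0) :
    ¬ ∃ c : ℂ, ∀ t, f t = c := by
  rintro ⟨c, hc⟩
  have h := hf.2
  rw [cocompact_eq_atTop, funext hc] at h
  obtain ⟨t, ht⟩ := h0
  exact ht ((hc t).trans (tendsto_nhds_unique tendsto_const_nhds h))

variable [CompleteSpace H]

theorem IsRadialOperator.isFourierKernel (hF : IsRadialOperator F)
    [Nontrivial (EuclideanSpace ℝ (Fin m))]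
    (hint : Integrable (fourierDensity (V := EuclideanSpace ℝ (Fin m)) F)) :
    IsFourierKernel (radialKernel m F) (constPart (EuclideanSpace ℝ (Fin m)) F)
      (fourierDensity F) where
  const_nonneg := hF.constPart_nonneg hint
  density_nonneg := hF.fourierDensity_nonneg
  integrable := hint
  eq_add x y := hF.eq_constPart_add hint (x - y)

omit [CompleteSpace H] in
theorem eq_zero_of_forall_inner_apply_self {T : H →L[ℂ] H} (h : ∀ v, inner ℂ v (T v) = 0) : T = 0 := by
  have h2 : T.toLinearMap = 0 := by
    rw [← inner_map_self_eq_zero]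
    intro v
    rw [← inner_conj_symm]
    exact (congrArg _ (h v)).trans (map_zero _)
  ext v
  exact LinearMap.congr_fun h2 v

/-- By the Riemann-Lebesgue lemma, the constant part is the weak limit of `F` at infinity. -/
theorem IsRadialOperator.constPart_eq_zero (hF : IsRadialOperator F)
    [Nontrivial (EuclideanSpace ℝ (Fin m))]
    (hint : Integrable (fourierDensity (V := EuclideanSpace ℝ (Fin m)) F))
    (h0 : ∀ v : H, v ≠ 0 → IsC0 fun t : ℝ≥0 => inner ℂ v (F t v)) :
    constPart (EuclideanSpace ℝ (Fin m)) F = 0 := by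
  refine eq_zero_of_forall_inner_apply_self fun v => ?_
  rcases eq_or_ne v 0 with rfl | hv
  · simp
  have h1 : Tendsto (fun x : EuclideanSpace ℝ (Fin m) => inner ℂ v (F ‖x‖₊ v))
      (cocompact (EuclideanSpace ℝ (Fin m))) (𝓝 0) := by
    have := (h0 v hv).2
    rw [cocompact_eq_atTop] at this
    exact this.comp (tendsto_nnnorm_cocompact_atTop _)
  have h2 : Tendsto (fun x : EuclideanSpace ℝ (Fin m) => inner ℂ v (F ‖x‖₊ v))
      (cocompact (EuclideanSpace ℝ (Fin m)))
      (𝓝 (inner ℂ v ((constPart (EuclideanSpace ℝ (Fin m)) F + 0) v))) := by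
    simp only [hF.eq_constPart_add hint]
    have hc : Continuous fun T : H →L[ℂ] H => inner ℂ v (T v) := by fun_prop
    exact (hc.tendsto _).comp (tendsto_const_nhds.add (tendsto_fourier_cocompact _))
  rw [add_zero] at h2
  exact tendsto_nhds_unique h2 h1

/-- The function `x ↦ F ‖x‖ v` belongs to the reproducing kernel Hilbert space, and every `t ≥ 0` is
the norm of a point because the dimension is positive. -/
theorem IsRadialOperator.isC0_of_rkhs_subset (hF : IsRadialOperator F) (hm : 1 ≤ m)
    (hK : IsPosDefKernel (radialKernel m F)) (h : rkhs hK ⊆ C0 m H) (v : H) :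
    IsC0 fun t : ℝ≥0 => inner ℂ v (F t v) := by
  refine ⟨hF.continuous v v, ?_⟩
  have : Fact (Matrix.of (radialKernel m F)).PosSemidef := ⟨hK.posSemidef⟩
  let k := RKHS.kerFun (RKHS.OfKernel (Matrix.of (radialKernel m F))) 0 v
  have hk : ∀ x, k x = F ‖x‖₊ v := fun x => by
    rw [RKHS.kerFun_apply, RKHS.OfKernel.kernel_ofKernel]
    simp [radialKernel]
  have h0 : Tendsto (fun x : EuclideanSpace ℝ (Fin m) => F ‖x‖₊ v)
      (cocompact (EuclideanSpace ℝ (Fin m))) (𝓝 0) := by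
    rw [← funext hk]
    exact (h ⟨k, rfl⟩).2
  have he : ‖EuclideanSpace.single (⟨0, hm⟩ : Fin m) (1 : ℝ)‖ = 1 := by simp
  have h1 : Tendsto (fun t : ℝ≥0 => inner ℂ v
      (F ‖(t : ℝ) • EuclideanSpace.single (⟨0, hm⟩ : Fin m) (1 : ℝ)‖₊ v)) atTop
      (𝓝 (inner ℂ v (0 : H))) :=
    tendsto_const_nhds.inner (h0.comp (tendsto_nnreal_smul_cocompact he))
  rw [cocompact_eq_atTop]
  rw [inner_zero_right] at h1
  refine h1.congr fun t => ?_
  have : ‖(t : ℝ) • EuclideanSpace.single (⟨0, hm⟩ : Fin m) (1 : ℝ)‖₊ = t := by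
    rw [nnnorm_smul, ← NNReal.coe_inj]
    simp
  rw [this]

end RadialKernels

end OpKernel

theorem mainTheorem6 {H : Type*} [NormedAddCommGroup H] [InnerProductSpace ℂ H] [CompleteSpace H]
    [TopologicalSpace.SeparableSpace H] (q : ℕ) (F : ℝ≥0 → H →L[ℂ] H)
    (hcont : OpKernel.UltraweaklyContinuous F)
    (htr : OpKernel.IsTraceClass (F 0))
    (hCq : ContDiff ℝ (2 * q : ℕ) (fun t : ℝ => OpKernel.trace (F ‖t‖₊)))
    (hpd : ∀ m : ℕ, 1 ≤ m → ∀ v : H, OpKernel.IsPosDefScalarKernel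
      (fun x y : EuclideanSpace ℝ (Fin m) => inner ℂ v (F ‖x - y‖₊ v)))
    (m : ℕ) (hm : 1 ≤ m) :
    ∃ hK : OpKernel.IsPosDefKernel (OpKernel.radialKernel m F),
      OpKernel.rkhs hK ⊆ OpKernel.Cq m H q ∧
      List.TFAE [
        OpKernel.IsStrictlyPosDefKernel (OpKernel.radialKernel m F),
        OpKernel.IsCqUniversal hK q,
        ∀ v : H, v ≠ 0 → ¬ ∃ c : ℂ, ∀ t : ℝ≥0, inner ℂ v (F t v) = c] ∧
      (OpKernel.rkhs hK ⊆ OpKernel.C0 m H ↔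
        ∀ v : H, v ≠ 0 → OpKernel.IsC0 (fun t : ℝ≥0 => inner ℂ v (F t v))) ∧
      (OpKernel.rkhs hK ⊆ OpKernel.C0 m H →
        OpKernel.rkhs hK ⊆ OpKernel.C0q m H q ∧
        List.TFAE [
          OpKernel.IsStrictlyPosDefKernel (OpKernel.radialKernel m F),
          OpKernel.IsC0qUniversal hK q,
          ∀ v : H, v ≠ 0 → ∃ t : ℝ≥0, inner ℂ v (F t v) ≠ 0]) := by
  have hne : Nonempty (Fin m) := ⟨⟨0, hm⟩⟩
  have hF : OpKernel.IsRadialOperator F :=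
    ⟨fun v => OpKernel.isRadialPosDef_of_forall F v fun m hm => hpd m hm v, hcont.continuous_inner⟩
  have hint : ∀ n ≤ 2 * q, MeasureTheory.Integrable fun w : EuclideanSpace ℝ (Fin m) =>
      ‖w‖ ^ n * ‖OpKernel.fourierDensity F w‖ := fun n hn =>
    hF.integrable_pow_mul_fourierDensity htr hCq hn
  have hcd : ContinuousOn (OpKernel.fourierDensity (V := EuclideanSpace ℝ (Fin m)) F) {0}ᶜ :=
    OpKernel.continuousOn_fourierDensity
  have hi : MeasureTheory.Integrable (OpKernel.fourierDensity (V := EuclideanSpace ℝ (Fin m)) F) :=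
    (MeasureTheory.integrable_norm_iff
      (OpKernel.aestronglyMeasurable_of_continuousOn_compl_zero hcd)).1
      (by simpa using hint 0 (Nat.zero_le _))
  have hFK := hF.isFourierKernel hi
  have hK := hFK.isPosDefKernel
  have hC0 : (∀ v : H, v ≠ 0 → OpKernel.IsC0 (fun t : ℝ≥0 => inner ℂ v (F t v))) →
      OpKernel.constPart (EuclideanSpace ℝ (Fin m)) F = 0 := hF.constPart_eq_zero hi
  have hiff : OpKernel.rkhs hK ⊆ OpKernel.C0 m H ↔
      ∀ v : H, v ≠ 0 → OpKernel.IsC0 (fun t : ℝ≥0 => inner ℂ v (F t v)) := by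
    exact ⟨fun h v _ => hF.isC0_of_rkhs_subset hm hK h v, fun h =>
      (hFK.rkhs_subset_C0q hK hint (hC0 h)).trans (OpKernel.C0q_subset_C0 m H q)⟩
  refine ⟨hK, hFK.rkhs_subset_Cq hK hint, ?_, hiff, fun h => ⟨?_, ?_⟩⟩
  · tfae_have 1 → 3 := OpKernel.inner_ne_const_of_isStrictlyPosDefKernel
    tfae_have 3 → 2 := fun hnc =>
      hFK.isCqUniversal hK hint hcd fun w hw => hF.denseRange_fourierDensity hnc hw
    tfae_have 2 → 1 := OpKernel.IsCqUniversal.isStrictlyPosDefKernel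
    tfae_finish
  · exact hFK.rkhs_subset_C0q hK hint (hC0 (hiff.1 h))
  · tfae_have 1 → 3 := OpKernel.exists_inner_ne_zero_of_isStrictlyPosDefKernel
    tfae_have 3 → 2 := fun hnz =>
      hFK.isC0qUniversal hK hint (hC0 (hiff.1 h)) hcd fun w hw =>
        hF.denseRange_fourierDensity
          (fun v hv => OpKernel.ne_const_of_isC0 (hiff.1 h v hv) (hnz v hv)) hw
    tfae_have 2 → 1 := OpKernel.IsC0qUniversal.isStrictlyPosDefKernel
    tfae_finish
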